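/- Let $\mathbf A$ be a finite dimensional algebra over an algebraically closed field $\mathbf k$, let $\mathbf I\subseteq\operatorname{rad}\mathbf A$ be a two-sided ideal, and let $A_1,\dots,A_s$ be representatives of the isomorphism classes of indecomposable finitely generated projective $\mathbf A$-modules. For $\mathbf v=(v_1,\dots,v_s)\in\mathbb N^s$ put $\mathbf v\mathbf A=\bigoplus_i v_iA_i$. Let $X$ be a connected algebraic variety over $\mathbf k$ (a non-empty connected reduced separated scheme of finite type over $\mathbf k$; "points" are closed points, and subsets carry the Zariski topology). An *algebraic family of $\mathbf A$-complexes* over $X$ is a bounded complex $\mathcal F_\bullet=(\mathcal F_n,d_n)$, $d_n:\mathcal F_n\to\mathcal F_{n-1}$, of flat coherent $\mathbf A\otimes_{\mathbf k}\mathcal O_X$-modules. It is an *$\mathbf I$-family* if $\operatorname{Im}d_n\subseteq\mathbf I\mathcal F_{n-1}$ for all $n$. Put $\mathcal F_n(x)=\mathcal F_{n,x}/\mathfrak m_x\mathcal F_{n,x}$; the family has *vector rank* $\mathbf r_\bullet=(\mathbf r_n)_{n\in\mathbb Z}$, where $\mathbf r_n\in\mathbb N^s$ is zero for almost all $n$,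 if $\mathcal F_n(x)\simeq\mathbf r_n\mathbf A$ for all $n$ and all $x\in X$. Let $\mathcal H=\bigoplus_n\operatorname{Hom}_{\mathbf A}(\mathbf r_n\mathbf A,\mathbf I\cdot\mathbf r_{n-1}\mathbf A)$ and let $\mathbb D=\mathbb D(\mathbf r_\bullet,\mathbf I)\subseteq\mathbb P(\mathcal H)$ be the closed subset of all $(h_n)$ with $h_{n-1}h_n=0$ for all $n$. The group $\mathbf G=\prod_n\operatorname{Aut}_{\mathbf A}(\mathbf r_n\mathbf A)$ acts on it by $(g_n)\cdot(h_n)=(g_{n-1}h_ng_n^{-1})$. If $\mathbb D\neq\varnothing$, set $$\mathbb D_i=\{z\in\mathbb D:\dim\mathbf Gz\le i\},\qquad \operatorname{par}(\mathbf r_\bullet,\mathbf I,\mathbf A)=\max_{i\ge0,\ \mathbb D_i\ne\varnothing}(\dim\mathbb D_i-i).$$ Let $\mathcal F_\bullet$ be an $\mathbf I$-family of vector rank $\mathbf r_\bullet$ over $X$. For $x\in X$ set $X_x=\{x'\in X:\mathcal F_\bullet(x')\simeq\mathcal F_\bullet(x)\}$ (isomorphism of complexes of $\mathbf A$-modules),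 and $$X_i=\{x\in X:\dim X_x\le i\}\quad(i\ge0),\qquad \operatorname{par}(\mathcal F_\bullet)=\max_{i\ge0,\ X_i\ne\varnothing}(\dim X_i-i).$$ Then all the subsets $X_x$ and $X_i$ are constructible, i.e. finite unions of locally closed subsets of $X$; the maximum defining $\operatorname{par}(\mathcal F_\bullet)$ exists; and if $\mathbb D(\mathbf r_\bullet,\mathbf I)\ne\varnothing$ (in particular, if for some $x\in X$ not all differentials $d_n(x)$ vanish), then the maximum defining $\operatorname{par}(\mathbf r_\bullet,\mathbf I,\mathbf A)$ exists as well and $$\operatorname{par}(\mathcal F_\bullet)\le\operatorname{par}(\mathbf r_\bullet,\mathbf I,\mathbf A).$$ -/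

import Mathlib

open AlgebraicGeometry CategoryTheory TensorProduct
open scoped LinearAlgebra.Projectivization

universe u v w

noncomputable section

namespace AComplex

section General

/-- A constructible subset: a finite union of locally closed subsets. -/
def IsConstructibleSet {T : Type*} [TopologicalSpace T] (S : Set T) : Prop :=
  ∃ C : Set (Set T), C.Finite ∧ (∀ Z ∈ C, IsLocallyClosed Z) ∧ ⋃₀ C = S

/-- The integers `dim S_i - i`, where `i` runs over the indices with `S_i` non-empty (and of finite
dimension). -/
def excesses {T : Type*} [TopologicalSpace T] (S : ℕ → Set T) : Set ℤ :=
  {z | ∃ i d : ℕ, topologicalKrullDim (S i) = d ∧ z = (d : ℤ) - i}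

/-- For a right `R`-module `N` and a left `R`-module `M`, the kernel of
`N ⊗_ℤ M → N ⊗_R M`. -/
def balancedRelations (R : Type*) [Ring R] (N M : Type*) [AddCommGroup N] [Module Rᵐᵒᵖ N]
    [AddCommGroup M] [Module R M] : AddSubgroup (N ⊗[ℤ] M) :=
  AddSubgroup.closure
    {t | ∃ (n : N) (r : R) (m : M), t = (MulOpposite.op r • n) ⊗ₜ m - n ⊗ₜ (r • m)}

/-- A left module `M` over a (not necessarily commutative) ring `R` is flat: for every injective
homomorphism `N → N'` of right `R`-modules, `N ⊗_R M → N' ⊗_R M` is injective. -/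
def IsFlatModule (R : Type w) [Ring R] (M : Type*) [AddCommGroup M] [Module R M] : Prop :=
  ∀ (N N' : Type w) [AddCommGroup N] [AddCommGroup N'] [Module Rᵐᵒᵖ N] [Module Rᵐᵒᵖ N']
    (j : N →ₗ[Rᵐᵒᵖ] N'), Function.Injective j →
    ∀ t : N ⊗[ℤ] M,
      TensorProduct.map j.toAddMonoidHom.toIntLinearMap LinearMap.id t ∈
        balancedRelations R N' M →
      t ∈ balancedRelations R N M

/-- Indecomposable modules. -/
def IsIndecomposableModule (A : Type*) [Ring A] (M : Type*) [AddCommGroup M] [Module A M] : Prop :=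
  Nontrivial M ∧ ∀ N N' : Submodule A M, IsCompl N N' → N = ⊥ ∨ N' = ⊥

/-- `P_1, …, P_s` is a set of representatives of the isomorphism classes of indecomposable
(finitely generated) projective `A`-modules. -/
structure IsCompleteIndecProj (A : Type v) [Ring A] {s : ℕ} (P : Fin s → Type v)
    [∀ i, AddCommGroup (P i)] [∀ i, Module A (P i)] : Prop where
  finite (i : Fin s) : Module.Finite A (P i)
  projective (i : Fin s) : Module.Projective A (P i)
  indecomposable (i : Fin s) : IsIndecomposableModule A (P i)
  eq_of_equiv (i j : Fin s) (e : P i ≃ₗ[A] P j) : i = j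
  complete (Q : Type v) [AddCommGroup Q] [Module A Q] [Module.Finite A Q]
    [Module.Projective A Q] (hQ : IsIndecomposableModule A Q) : ∃ i, Nonempty (Q ≃ₗ[A] P i)

/-- The module `r_1 P_1 ⊕ ⋯ ⊕ r_s P_s`. -/
abbrev ProjSum {s : ℕ} (P : Fin s → Type v) (r : Fin s → ℕ) : Type v := ∀ i, Fin (r i) → P i

/-- The Zariski topology on a projective space: the sets `{p | F(p) ≠ 0}` for `F` a homogeneous
polynomial function form a basis. Polynomial functions are written as polynomials in the linear
forms. -/
instance zariskiTopology (k : Type*) [Field k] (V : Type*) [AddCommGroup V] [Module k V] :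
    TopologicalSpace (ℙ k V) :=
  TopologicalSpace.generateFrom
    {U | ∃ (F : MvPolynomial (Module.Dual k V) k) (n : ℕ), F.IsHomogeneous n ∧
      U = {p | MvPolynomial.eval (fun φ : Module.Dual k V => φ p.rep) F ≠ 0}}

end General

section Canonical

variable {k : Type u} [Field k] {A : Type v} [Ring A] [Algebra k A] {s : ℕ}
  (P : Fin s → Type v) [∀ i, AddCommGroup (P i)] [∀ i, Module A (P i)]
  [∀ i, Module k (P i)] [∀ i, IsScalarTower k A (P i)]
  (r : ℤ →₀ (Fin s → ℕ)) (I : Ideal A)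

variable (k) in
/-- The space `⨁_n Hom_A(r_n A, I · r_{n-1} A)`. -/
def HomSpace : Submodule k (∀ n : ℤ, ProjSum P (r n) →ₗ[A] ProjSum P (r (n - 1))) where
  carrier := {h | ∀ n v, h n v ∈ (I • ⊤ : Submodule A (ProjSum P (r (n - 1))))}
  add_mem' h h' n v := Submodule.add_mem _ (h n v) (h' n v)
  zero_mem' _ _ := Submodule.zero_mem _
  smul_mem' c _ h n v := Submodule.smul_of_tower_mem _ c (h n v)

variable (A) in
/-- The group `∏_n Aut_A(r_n A)`. -/
abbrev AutGroup : Type v := ∀ n : ℤ, ProjSum P (r n) ≃ₗ[A] ProjSum P (r n)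

variable {r I} in
theorem map_mem_smul_top {M N : Type*} [AddCommGroup M] [AddCommGroup N] [Module A M] [Module A N]
    (g : M →ₗ[A] N) {v : M} (hv : v ∈ (I • ⊤ : Submodule A M)) :
    g v ∈ (I • ⊤ : Submodule A N) := by
  induction hv using Submodule.smul_induction_on' with
  | smul a ha w _ => rw [map_smul]; exact Submodule.smul_mem_smul ha trivial
  | add w _ w' _ hw hw' => rw [map_add]; exact Submodule.add_mem _ hw hw'

/-- The action `(g_n) · (h_n) = (g_{n-1} h_n g_n⁻¹)`. -/
instance : DistribMulAction (AutGroup A P r) (HomSpace k P r I) where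
  smul g h := ⟨fun n => (g (n - 1)).toLinearMap ∘ₗ h.1 n ∘ₗ (g n).symm.toLinearMap,
    fun n v => map_mem_smul_top (g (n - 1)).toLinearMap (h.2 n ((g n).symm v))⟩
  one_smul _ := rfl
  mul_smul _ _ _ := rfl
  smul_zero g := Subtype.ext <| funext fun n => LinearMap.ext fun _ => map_zero (g (n - 1))
  smul_add g _ _ := Subtype.ext <| funext fun n => LinearMap.ext fun _ => map_add (g (n - 1)) _ _

instance : SMulCommClass (AutGroup A P r) k (HomSpace k P r I) where
  smul_comm g c _ := Subtype.ext <| funext fun n => LinearMap.ext fun _ =>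
    ((g (n - 1)).toLinearMap.map_smul_of_tower c _)

variable (k) in
/-- The base `𝔻(r, I)` of the canonical family: the closed subset of
`ℙ(⨁_n Hom_A(r_n A, I r_{n-1} A))` of all `(h_n)` with `h_{n-1} h_n = 0`. -/
def canonicalBase : Set (ℙ k (HomSpace k P r I)) :=
  {p | ∀ n : ℤ, p.rep.1 (n - 1) ∘ₗ p.rep.1 n = 0}

variable (k) in
/-- The set `𝔻_i(r, I)` of points of `𝔻(r, I)` whose orbit has dimension at most `i`. -/
def canonicalStratum (i : ℕ) : Set (ℙ k (HomSpace k P r I)) :=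
  {p | p ∈ canonicalBase k P r I ∧ topologicalKrullDim (MulAction.orbit (AutGroup A P r) p) ≤ i}

variable (k) in
/-- The parameter number `par(r, I, A) = max_i (dim 𝔻_i - i)`. -/
def canonicalPar : ℤ := sSup (excesses (canonicalStratum k P r I))

end Canonical

section Stalks

variable {X : TopCat.{u}} {R : X.Presheaf CommRingCat.{u}}
  (M : PresheafOfModules.{u} (R ⋙ forget₂ CommRingCat RingCat)) (x : X)

/-- Mathlib's module structure on the stalk of a presheaf of modules. -/
abbrev stalkModule : Module (R.stalk x) (TopCat.Presheaf.stalk (C := Ab.{u}) M.presheaf x) :=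
  inferInstance

end Stalks

section Families

variable {k : Type u} [Field k] {X : Scheme.{u}}

/-- The ring homomorphism `k → Γ(X, U)` given by the structure morphism `f : X ⟶ Spec k`. -/
def scalar (f : X ⟶ Spec (.of k)) (U : X.Opens) : k →+* Γ(X, U) :=
  (X.presheaf.map (homOfLE le_top : U ⟶ ⊤).op).hom.comp
    (f.appTop.hom.comp (Scheme.ΓSpecIso (.of k)).inv.hom)

/-- The local ring of the `k`-scheme `X` at `x`, as a `k`-algebra. -/
def LocalRing (_ : X ⟶ Spec (.of k)) (x : X) : Type u := X.presheaf.stalk x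

variable (f : X ⟶ Spec (.of k)) (x : X)

instance : CommRing (LocalRing f x) := inferInstanceAs (CommRing (X.presheaf.stalk x))

instance : IsLocalRing (LocalRing f x) := inferInstanceAs (IsLocalRing (X.presheaf.stalk x))

/-- The germ of a function at `x`. -/
def germ (U : X.Opens) (hx : x ∈ U) : Γ(X, U) →+* LocalRing f x :=
  (X.presheaf.germ U x hx).hom

instance : Algebra k (LocalRing f x) :=
  RingHom.toAlgebra ((germ f x ⊤ trivial).comp (scalar f ⊤))

theorem germ_scalar (U : X.Opens) (hx : x ∈ U) (c : k) :
    germ f x U hx (scalar f U c) = algebraMap k (LocalRing f x) c := by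
  have h (V : X.Opens) (hV : x ∈ V) (r : Γ(X, ⊤)) :
      X.presheaf.germ V x hV (X.presheaf.map (homOfLE le_top : V ⟶ ⊤).op r) =
        X.presheaf.germ ⊤ x trivial r := X.presheaf.germ_res_apply _ _ _ _
  exact (h U hx _).trans (h ⊤ trivial _).symm

variable (A : Type v) [Ring A] [Algebra k A]

/-- A sheaf of `A ⊗_k 𝒪_X`-modules: an `𝒪_X`-module with an action of `A` by `𝒪_X`-linear
endomorphisms, under which `k ⊆ A` acts through the structure morphism `f`. -/
structure ASheaf where
  sheaf : X.Modules
  act : A →+* End sheaf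
  act_algebraMap (c : k) (U : X.Opens) (s : Γ(sheaf, U)) :
    (act (algebraMap k A c)).app U s = scalar f U c • s

namespace ASheaf

variable {f A} (F G : ASheaf f A)

/-- The stalk of the sheaf at `x`. -/
def Stalk : Type u := TopCat.Presheaf.stalk (C := Ab.{u}) F.sheaf.val.presheaf x

instance : AddCommGroup (F.Stalk x) :=
  inferInstanceAs (AddCommGroup (TopCat.Presheaf.stalk (C := Ab.{u}) F.sheaf.val.presheaf x))

instance : Module (LocalRing f x) (F.Stalk x) :=
  stalkModule (R := X.presheaf) F.sheaf.val x

/-- The germ of a section at `x`. -/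
def germ (U : X.Opens) (hx : x ∈ U) : Γ(F.sheaf, U) →+ F.Stalk x :=
  (F.sheaf.presheaf.germ U x hx).hom

theorem exists_germ_eq (t : F.Stalk x) :
    ∃ (U : X.Opens) (hx : x ∈ U) (s : Γ(F.sheaf, U)), F.germ x U hx s = t :=
  F.sheaf.presheaf.exists_germ_eq t

theorem germ_smul (U : X.Opens) (hx : x ∈ U) (r : Γ(X, U)) (s : Γ(F.sheaf, U)) :
    F.germ x U hx (r • s) = AComplex.germ f x U hx r • F.germ x U hx s :=
  PresheafOfModules.germ_smul (R := X.presheaf) F.sheaf.val x U hx r s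

theorem germ_res {U V : X.Opens} (i : V ⟶ U) (hx : x ∈ V) (s : Γ(F.sheaf, U)) :
    F.germ x V hx (F.sheaf.presheaf.map i.op s) = F.germ x U (i.le hx) s :=
  F.sheaf.presheaf.germ_res_apply i x hx s

variable {F G}

/-- The additive map on stalks induced by a morphism of sheaves. -/
def stalkHom (φ : F.sheaf ⟶ G.sheaf) : F.Stalk x →+ G.Stalk x :=
  ((TopCat.Presheaf.stalkFunctor Ab.{u} x).map φ.mapPresheaf).hom

theorem stalkHom_germ (φ : F.sheaf ⟶ G.sheaf) (U : X.Opens) (hx : x ∈ U) (s : Γ(F.sheaf, U)) :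
    stalkHom x φ (F.germ x U hx s) = G.germ x U hx (φ.app U s) :=
  TopCat.Presheaf.stalkFunctor_map_germ_apply (C := Ab.{u}) U x hx φ.mapPresheaf s

theorem smul_germ (r : LocalRing f x) (t : F.Stalk x) :
    ∃ (U : X.Opens) (hx : x ∈ U) (a : Γ(X, U)) (s : Γ(F.sheaf, U)),
      AComplex.germ f x U hx a = r ∧ F.germ x U hx s = t := by
  obtain ⟨U, hU, s, rfl⟩ := F.exists_germ_eq x t
  obtain ⟨V, hVU, hV, a, rfl⟩ := X.presheaf.exists_le_germ_eq r hU
  exact ⟨V, hV, a, F.sheaf.presheaf.map (homOfLE hVU).op s, rfl, F.germ_res x (homOfLE hVU) hV s⟩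

theorem stalkHom_smul (φ : F.sheaf ⟶ G.sheaf) (r : LocalRing f x) (t : F.Stalk x) :
    stalkHom x φ (r • t) = r • stalkHom x φ t := by
  obtain ⟨U, hx, a, s, rfl, rfl⟩ := smul_germ x r t
  rw [← F.germ_smul, stalkHom_germ, stalkHom_germ, Scheme.Modules.Hom.app_smul, G.germ_smul]

variable (F) in
/-- The action of `A` on the stalk. -/
def stalkAct : A →+* AddMonoid.End (F.Stalk x) where
  toFun a := stalkHom (F := F) (G := F) x (F.act a)
  map_one' := by
    refine AddMonoidHom.ext fun t => ?_
    obtain ⟨U, hx, s, rfl⟩ := F.exists_germ_eq x t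
    refine (stalkHom_germ x _ U hx s).trans ?_
    rw [map_one]; rfl
  map_zero' := by
    refine AddMonoidHom.ext fun t => ?_
    obtain ⟨U, hx, s, rfl⟩ := F.exists_germ_eq x t
    refine (stalkHom_germ x _ U hx s).trans ?_
    rw [map_zero]; exact map_zero (F.germ x U hx)
  map_add' a b := by
    refine AddMonoidHom.ext fun t => ?_
    obtain ⟨U, hx, s, rfl⟩ := F.exists_germ_eq x t
    refine (stalkHom_germ x _ U hx s).trans ?_
    rw [map_add]
    refine (map_add (F.germ x U hx) _ _).trans ?_
    exact (congrArg₂ _ (stalkHom_germ x (F.act a) U hx s) (stalkHom_germ x (F.act b) U hx s)).symm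
  map_mul' a b := by
    refine AddMonoidHom.ext fun t => ?_
    obtain ⟨U, hx, s, rfl⟩ := F.exists_germ_eq x t
    refine (stalkHom_germ x _ U hx s).trans ?_
    rw [map_mul]
    refine Eq.trans ?_ (congrArg (stalkHom x (F.act a)) (stalkHom_germ x (F.act b) U hx s)).symm
    exact (stalkHom_germ x (F.act a) U hx _).symm

instance : Module A (F.Stalk x) := Module.compHom _ (F.stalkAct x)

theorem smul_def (a : A) (t : F.Stalk x) : a • t = stalkHom (F := F) (G := F) x (F.act a) t := rfl

instance : Module k (F.Stalk x) := Module.compHom _ (algebraMap k (LocalRing f x))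

theorem base_smul_def (c : k) (t : F.Stalk x) : c • t = algebraMap k (LocalRing f x) c • t := rfl

instance : IsScalarTower k (LocalRing f x) (F.Stalk x) where
  smul_assoc c r t := by rw [Algebra.smul_def, mul_smul]; rfl

instance : SMulCommClass A (LocalRing f x) (F.Stalk x) where
  smul_comm _ r t := stalkHom_smul x _ r t

theorem algebraMap_smul (c : k) (t : F.Stalk x) : algebraMap k A c • t = c • t := by
  obtain ⟨U, hx, s, rfl⟩ := F.exists_germ_eq x t
  rw [smul_def, stalkHom_germ, F.act_algebraMap, F.germ_smul, germ_scalar]; rfl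

instance : IsScalarTower k A (F.Stalk x) where
  smul_assoc c _ t := by rw [Algebra.smul_def, mul_smul, algebraMap_smul]

instance : Module (A ⊗[k] LocalRing f x) (F.Stalk x) := TensorProduct.Algebra.module

variable (F) in
/-- The subspace `𝔪_x F_x` of the stalk, as an `A`-submodule. -/
def maximalSubmodule : Submodule A (F.Stalk x) where
  carrier := (IsLocalRing.maximalIdeal (LocalRing f x) • ⊤ :
    Submodule (LocalRing f x) (F.Stalk x))
  add_mem' := Submodule.add_mem _
  zero_mem' := Submodule.zero_mem _
  smul_mem' a t ht := by
    induction ht using Submodule.smul_induction_on' with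
    | smul r hr t _ =>
      rw [smul_comm]
      exact Submodule.smul_mem_smul hr trivial
    | add t _ t' _ ht ht' =>
      rw [smul_add]
      exact Submodule.add_mem _ ht ht'

variable (F) in
/-- The fibre `F(x) = F_x / 𝔪_x F_x`, an `A`-module. -/
abbrev Fibre : Type u := F.Stalk x ⧸ F.maximalSubmodule x

variable (F) in
/-- Coherence on a noetherian scheme: quasi-coherent, with finitely generated modules of sections
over affine open subsets. -/
def IsCoherent : Prop :=
  SheafOfModules.IsQuasicoherent (R := X.ringCatSheaf) F.sheaf ∧
    ∀ U : X.Opens, IsAffineOpen U → Module.Finite Γ(X, U) Γ(F.sheaf, U)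

variable (F) in
/-- Flatness of a sheaf of `A ⊗ 𝒪_X`-modules: all its stalks are flat `A ⊗ 𝒪_{X,x}`-modules. -/
def IsFlat : Prop := ∀ x : X, IsFlatModule (A ⊗[k] LocalRing f x) (F.Stalk x)

variable (F G) in
/-- A morphism of sheaves of `A ⊗ 𝒪_X`-modules. -/
structure Hom where
  hom : F.sheaf ⟶ G.sheaf
  comm (a : A) : F.act a ≫ hom = hom ≫ G.act a

/-- The map induced on stalks. -/
def Hom.stalkMap (φ : Hom F G) : F.Stalk x →ₗ[A] G.Stalk x where
  __ := stalkHom x φ.hom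
  map_smul' a t := by
    obtain ⟨U, hx, s, rfl⟩ := F.exists_germ_eq x t
    change stalkHom x φ.hom (stalkHom x (F.act a) _) = stalkHom x (G.act a) (stalkHom x φ.hom _)
    rw [stalkHom_germ, stalkHom_germ, stalkHom_germ, stalkHom_germ]
    exact congrArg (fun ψ : F.sheaf ⟶ G.sheaf => G.germ x U hx (ψ.app U s)) (φ.comm a)

theorem stalkHom_mem_maximalSubmodule (φ : F.sheaf ⟶ G.sheaf) {t : F.Stalk x}
    (ht : t ∈ (IsLocalRing.maximalIdeal (LocalRing f x) • ⊤ :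
      Submodule (LocalRing f x) (F.Stalk x))) :
    stalkHom x φ t ∈ (IsLocalRing.maximalIdeal (LocalRing f x) • ⊤ :
      Submodule (LocalRing f x) (G.Stalk x)) := by
  induction ht using Submodule.smul_induction_on' with
  | smul r hr t _ =>
    rw [stalkHom_smul]
    exact Submodule.smul_mem_smul hr trivial
  | add t _ t' _ ht ht' =>
    rw [map_add]
    exact Submodule.add_mem _ ht ht'

/-- The map induced on fibres. -/
def Hom.fibreMap (φ : Hom F G) : F.Fibre x →ₗ[A] G.Fibre x :=
  Submodule.mapQ _ _ (φ.stalkMap x) 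
    (fun _ ht => stalkHom_mem_maximalSubmodule x φ.hom ht)

end ASheaf

/-- An algebraic family of `A`-complexes over `X`: a bounded complex of flat coherent sheaves of
`A ⊗ 𝒪_X`-modules. -/
structure Family where
  obj : ℤ → ASheaf f A
  d (n : ℤ) : ASheaf.Hom (obj n) (obj (n - 1))
  d_comp_d (n : ℤ) : (d n).hom ≫ (d (n - 1)).hom = 0
  coherent (n : ℤ) : (obj n).IsCoherent
  flat (n : ℤ) : (obj n).IsFlat
  bounded : {n : ℤ | ¬ Limits.IsZero (obj n).sheaf}.Finite

namespace Family

variable {f A} (F : Family f A)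

/-- `F` is an `I`-family: `Im d_n ⊆ I F_{n-1}` for all `n`. -/
def IsIFamily (I : Ideal A) : Prop :=
  ∀ (n : ℤ) (x : X) (t : (F.obj n).Stalk x),
    (F.d n).stalkMap x t ∈ (I • ⊤ : Submodule A ((F.obj (n - 1)).Stalk x))

/-- `F` has vector rank `r`: at every closed point, `F_n(x) ≃ r_n A`. -/
def HasVectorRank {s : ℕ} (P : Fin s → Type v) [∀ i, AddCommGroup (P i)] [∀ i, Module A (P i)]
    (r : ℤ →₀ (Fin s → ℕ)) : Prop :=
  ∀ (n : ℤ), ∀ x ∈ closedPoints X, Nonempty ((F.obj n).Fibre x ≃ₗ[A] ProjSum P (r n))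

/-- The complexes of `A`-modules `F(x)` and `F(y)` are isomorphic. -/
def FibresIso (x y : X) : Prop :=
  ∃ e : ∀ n : ℤ, (F.obj n).Fibre x ≃ₗ[A] (F.obj n).Fibre y,
    ∀ (n : ℤ) (t : (F.obj n).Fibre x),
      e (n - 1) ((F.d n).fibreMap x t) = (F.d n).fibreMap y (e n t)

/-- The locus `X_x`, in the space of closed points of `X`. -/
def isoLocus (x : closedPoints X) : Set (closedPoints X) := {y | F.FibresIso y x}

/-- The set `X_i = {x | dim X_x ≤ i}`. -/
def stratum (i : ℕ) : Set (closedPoints X) := {x | topologicalKrullDim (F.isoLocus x) ≤ i}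

/-- The parameter number `par(F) = max_i (dim X_i - i)`. -/
def par : ℤ := sSup (excesses F.stratum)

end Family

end Families

end AComplex

end

/-! The theorem is a dimension count on a constructible set lying over both `X` and the space
`HomSpace` of differentials, so no morphism from `X` to the canonical base has to be constructed.

All dimensions are Krull dimensions of subsets of finite dimensional vector spaces with the Zariski
topology. For constructible sets they obey the fibre dimension theorem `hasFibreDimension`: a
constructible `S` in `V × W` has dimension at least `m` exactly when, for some `a + b = m`, the
points of `V` over which `S` has fibres of dimension at least `b` form a set of dimension at least
`a`. It is proved one coordinate at a time, from Chevalley's theorem and transcendence degrees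
(`dimGe_option`).

Over an affine open set, generators of the modules of sections turn the family into polynomial data.
Let `total` be the set of triples `(x, ψ, h)`, where `ψ` gives the images of the generators under
isomorphisms of the fibres at `x` with the modules `r_n A`, and `h` is the differential transported
along them. It is constructible, and its fibre over `x` is a copy of the group `G` (`torsor`).
Forgetting `ψ` leaves the pairs `(x, h)` with `h` in the orbit of the complex at `x`. Hence
isomorphism of fibres is a constructible relation, and the sets `X_x` and `X_i` are constructible.

For the inequality let `d` be the dimension of `X_i`. If `d ≤ i`, it suffices that the canonical
parameter number is non-negative (`zero_le_canonicalPar`). Otherwise restrict to a part of `X_i`,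
inside one chart, of dimension at least `d` where the orbits in `HomSpace` all have the same
dimension `m`. With `γ` the dimension of `G`, the triples over it have dimension at least `d + γ`.
In the projection to `h`, the choices of `ψ` for given `(x, h)` account for at most `γ - m`, by the
orbit-stabilizer inequality `dimGe_unitSet_of_torsor_fibre`, and the choices of `x` for at most `i`.
So the complexes that occur form a set of dimension at least `d + m - i`
(`OrbitChart.dimGe_image_graph`). This set is a cone; in the projective space it has dimension at
least `d + m - i - 1` and is a union of orbits of dimension `m - 1`. The excess is therefore at
least `d - i` (`sub_le_canonicalPar`). -/

noncomputable section

namespace AComplex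

/-! ### Transcendence degree and chains of primes in finitely generated algebras. -/

section TranscendenceDegree

variable {k : Type*} [Field k]

/-- The transcendence degree of a `k`-algebra, as a natural number. -/
def natTrdeg (k B : Type*) [Field k] [CommRing B] [Algebra k B] : ℕ :=
  Cardinal.toNat (Algebra.trdeg k B)

theorem exists_algebraicIndependent_natTrdeg (B : Type*) [CommRing B] [IsDomain B] [Algebra k B]
    [Algebra.FiniteType k B] :
    ∃ x : Fin (natTrdeg k B) → B, IsTranscendenceBasis k x := by
  obtain ⟨ι, x, hx⟩ := exists_isTranscendenceBasis' k B
  have h := hx.cardinalMk_eq_trdeg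
  have hfin : Cardinal.mk ι < Cardinal.aleph0 := h ▸ trdeg_lt_aleph0_of_finiteType
  have : Finite ι := Cardinal.lt_aleph0_iff_finite.1 hfin
  have hc : natTrdeg k B = Nat.card ι := by rw [natTrdeg, ← h]; rfl
  let e : Fin (natTrdeg k B) ≃ ι := (finCongr hc).trans (Finite.equivFin ι).symm
  exact ⟨x ∘ e, (isTranscendenceBasis_equiv e).2 hx⟩

theorem le_natTrdeg_of_algebraicIndependent {B : Type*} [CommRing B] [IsDomain B] [Algebra k B]
    [Algebra.FiniteType k B] {n : ℕ} {x : Fin n → B} (hx : AlgebraicIndependent k x) :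
    n ≤ natTrdeg k B := by
  have h := hx.lift_cardinalMk_le_trdeg
  have h2 := Cardinal.toNat_le_toNat h (by simpa using trdeg_lt_aleph0_of_finiteType)
  simpa [natTrdeg] using h2

theorem natTrdeg_congr {B C : Type*} [CommRing B] [CommRing C] [Algebra k B] [Algebra k C]
    (e : B ≃ₐ[k] C) : natTrdeg k B = natTrdeg k C := by
  have h := congrArg Cardinal.toNat e.lift_trdeg_eq
  simpa [natTrdeg] using h

theorem natTrdeg_add {S B : Type*} [CommRing S] [CommRing B] [IsDomain B] [Algebra k S]
    [Algebra k B] [Algebra S B] [IsScalarTower k S B] [FaithfulSMul S B]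
    [IsDomain S] [Algebra.FiniteType k S] [Algebra.FiniteType S B] :
    natTrdeg k B = natTrdeg k S + Cardinal.toNat (Algebra.trdeg S B) := by
  have h := congrArg Cardinal.toNat (lift_trdeg_add_eq k S B)
  rw [Cardinal.toNat_add] at h
  · simpa [natTrdeg] using h.symm
  · simpa using trdeg_lt_aleph0_of_finiteType
  · simpa using trdeg_lt_aleph0_of_finiteType

theorem natTrdeg_eq_of_isAlgebraic {S B : Type*} [CommRing S] [CommRing B] [IsDomain B]
    [Algebra k S] [Algebra k B] [Algebra S B] [IsScalarTower k S B] [FaithfulSMul S B]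
    [IsDomain S] [Algebra.FiniteType k S] [Algebra.FiniteType S B] [Algebra.IsAlgebraic S B] :
    natTrdeg k B = natTrdeg k S := by
  rw [natTrdeg_add (S := S), trdeg_eq_zero]; simp

theorem natTrdeg_polynomial {S : Type*} [CommRing S] [IsDomain S] [Algebra k S]
    [Algebra.FiniteType k S] :
    natTrdeg k (Polynomial S) = natTrdeg k S + 1 := by
  rw [natTrdeg_add (S := S), Polynomial.trdeg_of_isDomain]; simp

/-- A transcendence basis of `B ⧸ Q` lifts to an independent family `y` in `B`. If the degrees
agreed, `B` would be algebraic over `k[y]`, so the non-zero ideal `Q` would meet `k[y]` in a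
non-zero element, that is, in a polynomial relation between the images of the `y i` in `B ⧸ Q`. -/
theorem natTrdeg_quotient_lt {B : Type*} [CommRing B] [IsDomain B] [Algebra k B]
    [Algebra.FiniteType k B] (Q : Ideal B) [Q.IsPrime] (hQ : Q ≠ ⊥) :
    natTrdeg k (B ⧸ Q) < natTrdeg k B := by
  obtain ⟨x, hx⟩ := exists_algebraicIndependent_natTrdeg (k := k) (B ⧸ Q)
  obtain ⟨y, hy⟩ : ∃ y : Fin (natTrdeg k (B ⧸ Q)) → B, ∀ i, Ideal.Quotient.mkₐ k Q (y i) = x i :=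
    ⟨fun i => (Ideal.Quotient.mk_surjective (x i)).choose,
      fun i => (Ideal.Quotient.mk_surjective (x i)).choose_spec⟩
  have hxy : Ideal.Quotient.mkₐ k Q ∘ y = x := funext hy
  have hyi : AlgebraicIndependent k y :=
    AlgebraicIndependent.of_comp (Ideal.Quotient.mkₐ k Q) (by rw [hxy]; exact hx.1)
  refine lt_of_le_of_ne (le_natTrdeg_of_algebraicIndependent hyi) fun heq => ?_
  have hyb : IsTranscendenceBasis k y := by
    refine hyi.isTranscendenceBasis_of_lift_trdeg_le_of_finite ?_
    have hlt : Algebra.trdeg k B < Cardinal.aleph0 := trdeg_lt_aleph0_of_finiteType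
    rw [← Cardinal.cast_toNat_of_lt_aleph0 hlt]
    change Cardinal.lift ((natTrdeg k B : ℕ) : Cardinal) ≤ _
    rw [← heq]; simp
  obtain ⟨f, hfQ, hf0⟩ := Submodule.exists_mem_ne_zero_of_ne_bot hQ
  have halg := hyb.isAlgebraic
  have hne := Ideal.comap_ne_bot_of_algebraic_mem hf0 hfQ (halg.isAlgebraic f)
  obtain ⟨c, hcQ, hc0⟩ := Submodule.exists_mem_ne_zero_of_ne_bot hne
  obtain ⟨p, hp⟩ : ∃ p : MvPolynomial (Fin (natTrdeg k (B ⧸ Q))) k,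
      MvPolynomial.aeval y p = (c : B) := by
    have h : ∀ b ∈ Algebra.adjoin k (Set.range y),
        ∃ p : MvPolynomial (Fin (natTrdeg k (B ⧸ Q))) k, MvPolynomial.aeval y p = b := by
      rw [Algebra.adjoin_range_eq_range_aeval]; exact fun b hb => hb
    exact h c c.2
  have hxp : MvPolynomial.aeval x p = 0 := by
    rw [← hxy]
    have : MvPolynomial.aeval (Ideal.Quotient.mkₐ k Q ∘ y) p
        = Ideal.Quotient.mkₐ k Q (MvPolynomial.aeval y p) := by
      rw [← AlgHom.comp_apply, MvPolynomial.comp_aeval]; rfl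
    rw [this, hp]
    exact Ideal.Quotient.eq_zero_iff_mem.2 hcQ
  have := hx.1.eq_zero_of_aeval_eq_zero p hxp
  rw [this, map_zero] at hp
  exact hc0 (Subtype.ext hp.symm)

theorem natTrdeg_quotient_strictAnti {R : Type*} [CommRing R] [Algebra k R]
    [Algebra.FiniteType k R] {p q : PrimeSpectrum R} (h : p < q) :
    natTrdeg k (R ⧸ q.asIdeal) < natTrdeg k (R ⧸ p.asIdeal) := by
  have hle : p.asIdeal ≤ q.asIdeal := h.le
  have hprime : (q.asIdeal.map (Ideal.Quotient.mk p.asIdeal)).IsPrime :=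
    Ideal.map_isPrime_of_surjective Ideal.Quotient.mk_surjective (by simpa using hle)
  have hne : q.asIdeal.map (Ideal.Quotient.mk p.asIdeal) ≠ ⊥ := by
    intro h0
    rw [Ideal.map_eq_bot_iff_le_ker, Ideal.mk_ker] at h0
    exact h.not_ge h0
  have h1 := natTrdeg_quotient_lt (k := k) _ hne
  exact (natTrdeg_congr (DoubleQuot.quotQuotEquivQuotOfLEₐ k hle)) ▸ h1

theorem length_le_natTrdeg {R : Type*} [CommRing R] [Algebra k R]
    [Algebra.FiniteType k R] (l : LTSeries (PrimeSpectrum R)) (p : PrimeSpectrum R)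
    (hp : l.head = p) : l.length ≤ natTrdeg k (R ⧸ p.asIdeal) := by
  induction l using RelSeries.inductionOn generalizing p with
  | singleton q => exact Nat.zero_le _
  | cons l q hq ih =>
    obtain rfl : q = p := (RelSeries.head_cons _ _ _).symm.trans hp
    rw [RelSeries.cons_length]
    exact (Nat.succ_le_succ (ih _ rfl)).trans (natTrdeg_quotient_strictAnti (k := k) hq)

/-- Noether normalization makes `B` finite over a polynomial ring in `natTrdeg k B` variables; a
chain of that length exists there and is lifted by going up. -/
theorem exists_ltSeries_length_natTrdeg (B : Type*) [CommRing B] [IsDomain B] [Algebra k B]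
    [Algebra.FiniteType k B] :
    ∃ l : LTSeries (PrimeSpectrum B), l.length = natTrdeg k B := by
  obtain ⟨s, g, hg, hfin⟩ := exists_finite_inj_algHom_of_fg k B
  let _ : Algebra (MvPolynomial (Fin s) k) B := g.toRingHom.toAlgebra
  have : IsScalarTower k (MvPolynomial (Fin s) k) B :=
    IsScalarTower.of_algebraMap_eq fun c => (g.commutes c).symm
  have : Module.Finite (MvPolynomial (Fin s) k) B := hfin
  have : FaithfulSMul (MvPolynomial (Fin s) k) B :=
    (faithfulSMul_iff_algebraMap_injective _ _).2 hg
  have hs : natTrdeg k B = s := by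
    rw [natTrdeg_eq_of_isAlgebraic (S := MvPolynomial (Fin s) k), natTrdeg,
      MvPolynomial.trdeg_of_isDomain]
    simp
  have hdim : ((s : ℕ) : WithBot ℕ∞) ≤ ringKrullDim (MvPolynomial (Fin s) k) := by
    rw [MvPolynomial.ringKrullDim_of_isNoetherianRing, ringKrullDim_eq_zero_of_field]
    simp
  obtain ⟨l, hl⟩ := Order.le_krullDim_iff.1 hdim
  obtain ⟨Q, -, hQp, hQ⟩ := Ideal.exists_ideal_over_prime_of_isIntegral l.head.asIdeal (⊥ : Ideal B)
    (by
      rw [← RingHom.ker_eq_comap_bot, (RingHom.injective_iff_ker_eq_bot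
        (algebraMap (MvPolynomial (Fin s) k) B)).1 hg]; exact bot_le)
  have : Q.LiesOver l.head.asIdeal := ⟨hQ.symm⟩
  obtain ⟨L, hL, -⟩ := Ideal.exists_ltSeries_of_hasGoingUp l Q
  exact ⟨L, by rw [hL, hl, hs]⟩

/-- Inverting the image of `f` in `R ⧸ p` does not change the transcendence degree, and primes of
the localization contract to primes containing `p` but not `f`. Thus removing a hypersurface from an
irreducible variety does not lower its dimension. -/
theorem exists_ltSeries_avoiding {R : Type*} [CommRing R] [Algebra k R]
    [Algebra.FiniteType k R] (p : Ideal R) [p.IsPrime] {f : R} (hf : f ∉ p) :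
    ∃ l : LTSeries (PrimeSpectrum R), l.length = natTrdeg k (R ⧸ p) ∧
      ∀ i, p ≤ (l i).asIdeal ∧ f ∉ (l i).asIdeal := by
  let fb : R ⧸ p := Ideal.Quotient.mk p f
  have hfb : fb ≠ 0 := fun h => hf (Ideal.Quotient.eq_zero_iff_mem.1 h)
  let C := Localization.Away fb
  have hle : Submonoid.powers fb ≤ nonZeroDivisors (R ⧸ p) :=
    powers_le_nonZeroDivisors_of_noZeroDivisors hfb
  have : IsDomain C := IsLocalization.isDomain_of_le_nonZeroDivisors (R := R ⧸ p) C hle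
  have : FaithfulSMul (R ⧸ p) C :=
    (faithfulSMul_iff_algebraMap_injective _ _).2 (IsLocalization.injective C hle)
  have : Algebra.FiniteType (R ⧸ p) C := IsLocalization.finiteType_of_monoid_fg (.powers fb) C
  have : Algebra.FiniteType k C := Algebra.FiniteType.trans (S := R ⧸ p) inferInstance inferInstance
  have : Algebra.IsAlgebraic (R ⧸ p) C := IsLocalization.isAlgebraic C (.powers fb)
  have hC : natTrdeg k C = natTrdeg k (R ⧸ p) := natTrdeg_eq_of_isAlgebraic
  obtain ⟨l, hl⟩ := exists_ltSeries_length_natTrdeg (k := k) C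
  have hmono : StrictMono (PrimeSpectrum.comap (algebraMap (R ⧸ p) C)) := by
    intro a b hab
    refine lt_of_le_of_ne (Ideal.comap_mono hab.le) fun h => hab.ne ?_
    exact PrimeSpectrum.localization_comap_injective C (.powers fb) h
  have hmono2 : StrictMono (PrimeSpectrum.comap (Ideal.Quotient.mk p)) := by
    intro a b hab
    refine lt_of_le_of_ne (Ideal.comap_mono hab.le) fun h => hab.ne ?_
    exact PrimeSpectrum.comap_injective_of_surjective _ Ideal.Quotient.mk_surjective h
  refine ⟨(l.map _ hmono).map _ hmono2, by simpa [hC] using hl, fun i => ⟨?_, ?_⟩⟩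
  · intro a ha
    change a ∈ (PrimeSpectrum.comap (Ideal.Quotient.mk p)
      (PrimeSpectrum.comap (algebraMap (R ⧸ p) C) (l i))).asIdeal
    change algebraMap (R ⧸ p) C (Ideal.Quotient.mk p a) ∈ (l i).asIdeal
    rw [Ideal.Quotient.eq_zero_iff_mem.2 ha, map_zero]
    exact zero_mem _
  · intro hmem
    change f ∈ (PrimeSpectrum.comap (Ideal.Quotient.mk p)
      (PrimeSpectrum.comap (algebraMap (R ⧸ p) C) (l i))).asIdeal at hmem
    change algebraMap (R ⧸ p) C fb ∈ (l i).asIdeal at hmem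
    exact (l i).2.ne_top (Ideal.eq_top_of_isUnit_mem _ hmem
      (IsLocalization.Away.algebraMap_isUnit fb))

end TranscendenceDegree

/-! ### Constructible sets, polynomial maps and dimension in vector spaces. -/

section Constructible

variable (k : Type*) [Field k] (V : Type*) [AddCommGroup V] [Module k V]

/-- The algebra of polynomial functions on a vector space. -/
def polyFun : Subalgebra k (V → k) :=
  (MvPolynomial.aeval (fun φ : Module.Dual k V => (φ : V → k))).range

/-- The Zariski topology on a vector space. -/
@[reducible] def zariski : TopologicalSpace V :=
  TopologicalSpace.generateFrom {U | ∃ f ∈ polyFun k V, U = {v | f v ≠ 0}}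

variable {V}

/-- The boolean algebra of sets generated by the zero sets of polynomial functions. -/
inductive IsCons : Set V → Prop
  | zeros (f : V → k) (hf : f ∈ polyFun k V) : IsCons {v | f v = 0}
  | compl (S : Set V) (hS : IsCons S) : IsCons Sᶜ
  | inter (S T : Set V) (hS : IsCons S) (hT : IsCons T) : IsCons (S ∩ T)

/-- The dimension of `S`, in the Zariski topology, is at least `m`. -/
def DimGe (S : Set V) (m : ℕ) : Prop :=
  (m : WithBot ℕ∞) ≤ @topologicalKrullDim S (@instTopologicalSpaceSubtype V (· ∈ S) (zariski k V))

variable {W : Type*} [AddCommGroup W] [Module k W]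

/-- Polynomial maps between vector spaces. -/
def IsPolyMap (f : V → W) : Prop := ∀ φ : Module.Dual k W, (fun v => φ (f v)) ∈ polyFun k V

variable {k}

theorem dual_mem_polyFun (φ : Module.Dual k V) : (φ : V → k) ∈ polyFun k V :=
  ⟨MvPolynomial.X φ, by simp⟩

theorem polyFun_comp {f : V → W} (hf : IsPolyMap k f) {g : W → k} (hg : g ∈ polyFun k W) :
    (fun v => g (f v)) ∈ polyFun k V := by
  obtain ⟨p, rfl⟩ := hg
  change (fun v => MvPolynomial.aeval (fun φ : Module.Dual k W => (φ : W → k)) p (f v)) ∈ _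
  induction p using MvPolynomial.induction_on with
  | C c =>
    rw [MvPolynomial.algHom_C]
    exact (polyFun k V).algebraMap_mem c
  | add p q hp hq =>
    rw [map_add]
    exact (polyFun k V).add_mem hp hq
  | mul_X p φ hp =>
    rw [map_mul]
    refine (polyFun k V).mul_mem hp ?_
    rw [MvPolynomial.aeval_X]
    exact hf φ

theorem _root_.LinearMap.isPolyMap (f : V →ₗ[k] W) : IsPolyMap k f :=
  fun φ => dual_mem_polyFun (φ ∘ₗ f)

theorem IsPolyMap.comp {U : Type*} [AddCommGroup U] [Module k U] {g : W → U} {f : V → W}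
    (hg : IsPolyMap k g) (hf : IsPolyMap k f) : IsPolyMap k (fun v => g (f v)) :=
  fun φ => polyFun_comp hf (hg φ)

theorem IsPolyMap.sub {f g : V → W} (hf : IsPolyMap k f) (hg : IsPolyMap k g) :
    IsPolyMap k (fun v => f v - g v) := fun φ => by
  simp only [map_sub]; exact (polyFun k V).sub_mem (hf φ) (hg φ)

theorem IsPolyMap.sum {ι : Type*} (s : Finset ι) {f : ι → V → W} (hf : ∀ i, IsPolyMap k (f i)) :
    IsPolyMap k (fun v => ∑ i ∈ s, f i v) := fun φ => by
  have := (polyFun k V).sum_mem (t := s) fun i _ => hf i φ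
  convert this using 1
  ext v; simp

theorem IsPolyMap.smul {f : V → k} {g : V → W} (hf : f ∈ polyFun k V) (hg : IsPolyMap k g) :
    IsPolyMap k (fun v => f v • g v) := fun φ => by
  simp only [map_smul]; exact (polyFun k V).mul_mem hf (hg φ)

theorem IsPolyMap.const (w : W) : IsPolyMap k (fun _ : V => w) :=
  fun φ => (polyFun k V).algebraMap_mem (φ w)

/-- Expanding the first argument in a basis leaves a sum of products of a polynomial function and a
polynomial map. -/
theorem IsPolyMap.bilin {U : Type*} [AddCommGroup U] [Module k U] {X : Type*} [AddCommGroup X]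
    [Module k X] [FiniteDimensional k V] (B : V →ₗ[k] W →ₗ[k] U) {f : X → V} {g : X → W}
    (hf : IsPolyMap k f) (hg : IsPolyMap k g) : IsPolyMap k (fun x => B (f x) (g x)) := by
  let b := Module.finBasis k V
  have : (fun x => B (f x) (g x)) = fun x => ∑ i, b.coord i (f x) • B (b i) (g x) := by
    funext x
    conv_lhs => rw [← b.sum_repr (f x)]
    simp only [map_sum, map_smul, LinearMap.sum_apply, LinearMap.smul_apply,
      Module.Basis.coord_apply]
  rw [this]
  exact IsPolyMap.sum _ fun i => IsPolyMap.smul (hf _) ((B (b i)).isPolyMap.comp hg)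

theorem IsPolyMap.prodMk {U : Type*} [AddCommGroup U] [Module k U] {f : V → W} {g : V → U}
    (hf : IsPolyMap k f) (hg : IsPolyMap k g) : IsPolyMap k (fun v => (f v, g v)) := fun φ => by
  have := (polyFun k V).add_mem (hf (φ ∘ₗ LinearMap.inl k W U)) (hg (φ ∘ₗ LinearMap.inr k W U))
  convert this using 1
  ext v
  simp [← map_add]

theorem IsPolyMap.fst : IsPolyMap k (fun v : V × W => v.1) := (LinearMap.fst k V W).isPolyMap

theorem IsPolyMap.snd : IsPolyMap k (fun v : V × W => v.2) := (LinearMap.snd k V W).isPolyMap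

theorem IsPolyMap.id : IsPolyMap k (fun v : V => v) := (LinearMap.id (R := k) (M := V)).isPolyMap

theorem IsCons.preimage {f : V → W} (hf : IsPolyMap k f) {S : Set W} (hS : IsCons k S) :
    IsCons k (f ⁻¹' S) := by
  induction hS with
  | zeros g hg => exact .zeros _ (polyFun_comp hf hg)
  | compl S _ ih => exact .compl _ ih
  | inter S T _ _ ih ih' => exact .inter _ _ ih ih'

theorem IsCons.union {S T : Set V} (hS : IsCons k S) (hT : IsCons k T) : IsCons k (S ∪ T) := by
  rw [← compl_compl (S ∪ T), Set.compl_union]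
  exact (hS.compl.inter _ _ hT.compl).compl

theorem IsCons.empty : IsCons k (∅ : Set V) := by
  have := IsCons.zeros (1 : V → k) (polyFun k V).one_mem
  simpa using this

theorem IsCons.iUnion {ι : Type*} [Finite ι] {S : ι → Set V} (hS : ∀ i, IsCons k (S i)) :
    IsCons k (⋃ i, S i) := by
  have (s : Finset ι) : IsCons k (⋃ i ∈ s, S i) := by
    classical
    induction s using Finset.induction_on with
    | empty => simpa using IsCons.empty
    | insert i s hi ih => rw [Finset.set_biUnion_insert]; exact (hS i).union ih
  have _ := Fintype.ofFinite ι
  simpa using this Finset.univ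

theorem IsCons.iInter {ι : Type*} [Finite ι] {S : ι → Set V} (hS : ∀ i, IsCons k (S i)) :
    IsCons k (⋂ i, S i) := by
  rw [← compl_compl (⋂ i, S i), Set.compl_iInter]
  exact (IsCons.iUnion fun i => (hS i).compl).compl

theorem IsPolyMap.continuous {f : V → W} (hf : IsPolyMap k f) :
    @Continuous V W (zariski k V) (zariski k W) f := by
  let _ := zariski k V
  refine continuous_generateFrom_iff.2 ?_
  rintro _ ⟨g, hg, rfl⟩
  exact TopologicalSpace.isOpen_generateFrom_of_mem ⟨_, polyFun_comp hf hg, rfl⟩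

theorem isTopologicalBasis_zariski :
    @TopologicalSpace.IsTopologicalBasis V (zariski k V)
      {U | ∃ f ∈ polyFun k V, U = {v | f v ≠ 0}} := by
  let _ := zariski k V
  refine ⟨?_, ?_, rfl⟩
  · rintro _ ⟨f, hf, rfl⟩ _ ⟨g, hg, rfl⟩ x hx
    refine ⟨_, ⟨f * g, (polyFun k V).mul_mem hf hg, rfl⟩, mul_ne_zero hx.1 hx.2, ?_⟩
    exact fun y hy => ⟨left_ne_zero_of_mul hy, right_ne_zero_of_mul hy⟩
  · refine Set.eq_univ_of_forall fun x => ⟨_, ⟨1, (polyFun k V).one_mem, rfl⟩, ?_⟩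
    exact one_ne_zero

theorem isClosed_zeros {f : V → k} (hf : f ∈ polyFun k V) :
    @IsClosed V (zariski k V) {v | f v = 0} := by
  let _ := zariski k V
  rw [← isOpen_compl_iff]
  exact TopologicalSpace.isOpen_generateFrom_of_mem ⟨f, hf, rfl⟩

theorem exists_polyFun_of_notMem {C : Set V} (hC : @IsClosed V (zariski k V) C) {x : V}
    (hx : x ∉ C) : ∃ f ∈ polyFun k V, (∀ v ∈ C, f v = 0) ∧ f x ≠ 0 := by
  let _ := zariski k V
  obtain ⟨_, ⟨f, hf, rfl⟩, hfx, hfC⟩ :=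
    isTopologicalBasis_zariski.exists_subset_of_mem_open (show x ∈ Cᶜ from hx) hC.isOpen_compl
  exact ⟨f, hf, fun v hv => by_contra fun h => hfC h hv, hfx⟩

theorem DimGe.mono {S T : Set V} (h : S ⊆ T) {m : ℕ} (hm : DimGe k S m) : DimGe k T m := by
  let _ := zariski k V
  exact le_trans hm (Topology.IsInducing.topologicalKrullDim_le
    (Topology.IsEmbedding.inclusion h).isInducing)

theorem DimGe.of_le {S : Set V} {m n : ℕ} (h : n ≤ m) (hm : DimGe k S m) : DimGe k S n :=
  le_trans (by exact_mod_cast h) hm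

theorem dimGe_zero {S : Set V} : DimGe k S 0 ↔ S.Nonempty := by
  let _ := zariski k V
  rw [DimGe, Nat.cast_zero, topologicalKrullDim, Order.krullDim_nonneg_iff]
  constructor
  · rintro ⟨Z⟩
    obtain ⟨z, -⟩ := Z.isIrreducible.nonempty
    exact ⟨z.1, z.2⟩
  · rintro ⟨x, hx⟩
    exact ⟨⟨closure {⟨x, hx⟩}, isIrreducible_singleton.closure, isClosed_closure⟩⟩

theorem DimGe.nonempty {S : Set V} {m : ℕ} (h : DimGe k S m) : S.Nonempty :=
  dimGe_zero.1 (h.of_le (Nat.zero_le m))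

theorem DimGe.image_linearEquiv (e : V ≃ₗ[k] W) {S : Set V} {m : ℕ} (hm : DimGe k S m) :
    DimGe k (e '' S) m := by
  let _ := zariski k V
  let _ := zariski k W
  have hc : Continuous e := IsPolyMap.continuous e.toLinearMap.isPolyMap
  have hc' : Continuous e.symm := IsPolyMap.continuous e.symm.toLinearMap.isPolyMap
  let E : V ≃ₜ W := ⟨e.toEquiv, hc, hc'⟩
  exact le_trans hm (Topology.IsInducing.topologicalKrullDim_le (E.image S).isInducing)

theorem dimGe_preimage_linearEquiv (e : V ≃ₗ[k] W) (S : Set W) (m : ℕ) :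
    DimGe k (e ⁻¹' S) m ↔ DimGe k S m := by
  constructor
  · intro h
    simpa [Set.image_preimage_eq _ e.surjective] using h.image_linearEquiv e
  · intro h
    have := h.image_linearEquiv e.symm
    rwa [LinearEquiv.image_symm_eq_preimage] at this

end Constructible

/-! ### Constructible subsets of affine space and Chevalley's theorem. -/

section Coordinates

variable {k : Type u} [Field k] {σ : Type v} [Finite σ]

theorem mem_polyFun_pi_iff {f : (σ → k) → k} :
    f ∈ polyFun k (σ → k) ↔ ∃ p : MvPolynomial σ k, ∀ x, f x = MvPolynomial.eval x p := by
  have _ := Fintype.ofFinite σ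
  constructor
  · rintro ⟨p, rfl⟩
    change ∃ q : MvPolynomial σ k, ∀ x, MvPolynomial.aeval
      (fun φ : Module.Dual k (σ → k) => (φ : (σ → k) → k)) p x = MvPolynomial.eval x q
    induction p using MvPolynomial.induction_on with
    | C c => exact ⟨MvPolynomial.C c, fun x => by rw [MvPolynomial.algHom_C]; simp⟩
    | add p q hp hq =>
      obtain ⟨a, ha⟩ := hp
      obtain ⟨b, hb⟩ := hq
      exact ⟨a + b, fun x => by simp [ha, hb]⟩
    | mul_X p φ hp =>
      classical
      obtain ⟨a, ha⟩ := hp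
      refine ⟨a * ∑ i, MvPolynomial.C (φ (Pi.single i 1)) * MvPolynomial.X i, fun x => ?_⟩
      simp only [map_mul, Pi.mul_apply, ha, MvPolynomial.aeval_X, map_sum, MvPolynomial.eval_C,
        MvPolynomial.eval_X]
      congr 1
      conv_lhs => rw [← LinearMap.sum_single_apply (fun _ => k) x, map_sum]
      refine Finset.sum_congr rfl fun i _ => ?_
      have : (Pi.single i (x i) : σ → k) = x i • Pi.single i (1 : k) := by
        rw [← Pi.single_smul]; simp
      rw [this, map_smul, smul_eq_mul, mul_comm]
  · rintro ⟨p, hp⟩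
    obtain rfl : f = fun x => MvPolynomial.eval x p := funext hp
    clear hp
    induction p using MvPolynomial.induction_on with
    | C c =>
    simp only [MvPolynomial.eval_C]
    exact (polyFun k (σ → k)).algebraMap_mem c
    | add p q hp hq =>
      simp only [map_add]
      exact (polyFun k _).add_mem hp hq
    | mul_X p i hp =>
      simp only [map_mul, MvPolynomial.eval_X]
      exact (polyFun k _).mul_mem hp
        (dual_mem_polyFun (LinearMap.proj i : Module.Dual k (σ → k)))

theorem eval_mem_polyFun (p : MvPolynomial σ k) :
    (fun x => MvPolynomial.eval x p) ∈ polyFun k (σ → k) :=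
  mem_polyFun_pi_iff.2 ⟨p, fun _ => rfl⟩

/-- The points of the zero locus of `I` where `f` does not vanish. -/
def piece (I : Ideal (MvPolynomial σ k)) (f : MvPolynomial σ k) : Set (σ → k) :=
  {x | (∀ g ∈ I, MvPolynomial.eval x g = 0) ∧ MvPolynomial.eval x f ≠ 0}

/-- By Hilbert's basis theorem finitely many of the equations suffice. Conditions may thus be
imposed for all elements of a module or an algebra at once. -/
theorem isCons_forall_eval {ι : Type*} (f : ι → MvPolynomial σ k) :
    IsCons k {x : σ → k | ∀ i, MvPolynomial.eval x (f i) = 0} := by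
  obtain ⟨T, hT, hTs⟩ := (Submodule.fg_span_iff_fg_span_finset_subset (Set.range f)).1
    (IsNoetherian.noetherian (Ideal.span (Set.range f)))
  have : {x : σ → k | ∀ i, MvPolynomial.eval x (f i) = 0} =
      ⋂ g : T, {x | MvPolynomial.eval x g.1 = 0} := by
    ext x
    simp only [Set.mem_ofPred_eq, Set.mem_iInter]
    constructor
    · rintro h ⟨g, hg⟩
      obtain ⟨i, rfl⟩ := hT hg
      exact h i
    · intro h i
      have hle : Submodule.span (MvPolynomial σ k) (T : Set (MvPolynomial σ k)) ≤
          RingHom.ker (MvPolynomial.eval x) := Submodule.span_le.2 fun g hg => h ⟨g, hg⟩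
      rw [← hTs] at hle
      exact hle (Ideal.subset_span ⟨i, rfl⟩)
  rw [this]
  exact IsCons.iInter fun g => .zeros _ (eval_mem_polyFun g.1)

theorem isCons_piece (I : Ideal (MvPolynomial σ k)) (f : MvPolynomial σ k) :
    IsCons k (piece I f) := by
  have h := (isCons_forall_eval fun g : I => g.1).inter _ _ (.compl _ (.zeros _ (eval_mem_polyFun f)))
  convert h using 1
  ext x
  simp [piece]

theorem mem_pointToPoint_iff {τ : Type*} {x : τ → k} {g : MvPolynomial τ k} :
    g ∈ (MvPolynomial.pointToPoint (k := k) x).asIdeal ↔ MvPolynomial.eval x g = 0 := by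
  change g ∈ MvPolynomial.vanishingIdeal k {x} ↔ _
  rw [MvPolynomial.mem_vanishingIdeal_singleton_iff, MvPolynomial.aeval_eq_eval]

/-- One half of the dictionary between `IsCons` and constructible subsets of the prime spectrum,
through which the scheme-theoretic Chevalley theorem is applied to sets of points;
`isCons_of_isConstructible` is the other half. -/
theorem IsCons.exists_isConstructible {S : Set (σ → k)} (hS : IsCons k S) :
    ∃ C : Set (PrimeSpectrum (MvPolynomial σ k)), Topology.IsConstructible C ∧
      ∀ x, x ∈ S ↔ MvPolynomial.pointToPoint x ∈ C := by
  induction hS with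
  | zeros f hf =>
    obtain ⟨p, hp⟩ := mem_polyFun_pi_iff.1 hf
    refine ⟨_, (PrimeSpectrum.isConstructible_basicOpen (f := p)).compl, fun x => ?_⟩
    simp only [Set.mem_ofPred_eq, hp, Set.mem_compl_iff, SetLike.mem_coe,
      PrimeSpectrum.mem_basicOpen, not_not]
    exact mem_pointToPoint_iff.symm
  | compl S _ ih =>
    obtain ⟨C, hC, h⟩ := ih
    exact ⟨Cᶜ, hC.compl, fun x => not_congr (h x)⟩
  | inter S T _ _ ih ih' =>
    obtain ⟨C, hC, h⟩ := ih
    obtain ⟨D, hD, h'⟩ := ih'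
    exact ⟨C ∩ D, hC.inter hD, fun x => and_congr (h x) (h' x)⟩

/-- The zero locus in each basic constructible set is split by the finitely many minimal primes of
its ideal. A minimal prime containing `f` contributes no point and is discarded. -/
theorem exists_pieces_of_isConstructible {C : Set (PrimeSpectrum (MvPolynomial σ k))}
    (hC : Topology.IsConstructible C) :
    ∃ (ι : Type (max u v)) (_ : Finite ι) (p : ι → PrimeSpectrum (MvPolynomial σ k))
      (f : ι → MvPolynomial σ k), (∀ i, f i ∉ (p i).asIdeal) ∧
      {x : σ → k | MvPolynomial.pointToPoint x ∈ C} = ⋃ i, piece (p i).asIdeal (f i) := by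
  obtain ⟨T, rfl⟩ := PrimeSpectrum.exists_constructibleSetData_iff.2 hC
  let J (c : PrimeSpectrum.BasicConstructibleSetData (MvPolynomial σ k)) := Ideal.span (Set.range c.g)
  have hfin (c) : Finite (J c).minimalPrimes :=
    Ideal.finite_minimalPrimes_of_isNoetherianRing _ (J c)
  refine ⟨{d : Σ c : T, (J c).minimalPrimes // d.1.1.f ∉ d.2.1}, inferInstance,
    fun d => ⟨d.1.2.1, d.1.2.2.1.1⟩, fun d => d.1.1.1.f, fun d => d.2, ?_⟩
  ext x
  simp only [Set.mem_ofPred_eq, Set.mem_iUnion, PrimeSpectrum.ConstructibleSetData.toSet,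
    PrimeSpectrum.BasicConstructibleSetData.toSet]
  constructor
  · rintro ⟨c, hc, hx, hxf⟩
    have hle : J c ≤ (MvPolynomial.pointToPoint (k := k) x).asIdeal := Ideal.span_le.2 hx
    have hf : c.f ∉ (MvPolynomial.pointToPoint (k := k) x).asIdeal := fun h => hxf (by simpa using h)
    obtain ⟨p, hp, hpx⟩ := Ideal.exists_minimalPrimes_le hle
    exact ⟨⟨⟨⟨c, hc⟩, ⟨p, hp⟩⟩, fun h => hf (hpx h)⟩, fun g hg => mem_pointToPoint_iff.1 (hpx hg),
      fun h => hf (mem_pointToPoint_iff.2 h)⟩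
  · rintro ⟨⟨⟨⟨c, hc⟩, ⟨p, hp⟩⟩, hf⟩, hx, hxf⟩
    refine ⟨c, hc, ?_, ?_⟩
    · rintro _ ⟨i, rfl⟩
      exact mem_pointToPoint_iff.2 (hx _ (hp.1.2 (Ideal.subset_span ⟨i, rfl⟩)))
    · intro h
      exact hxf (mem_pointToPoint_iff.1 (by simpa using h))

theorem isCons_of_isConstructible {C : Set (PrimeSpectrum (MvPolynomial σ k))}
    (hC : Topology.IsConstructible C) :
    IsCons k {x : σ → k | MvPolynomial.pointToPoint x ∈ C} := by
  obtain ⟨ι, _, p, f, -, h⟩ := exists_pieces_of_isConstructible hC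
  rw [h]
  exact IsCons.iUnion fun i => isCons_piece _ _

/-- Reduces statements compatible with finite unions to non-empty open parts of irreducible
varieties, whose dimension is a transcendence degree. -/
theorem IsCons.piece_induction {motive : Set (σ → k) → Prop} {S : Set (σ → k)} (hS : IsCons k S)
    (empty : motive ∅)
    (piece : ∀ (p : Ideal (MvPolynomial σ k)) (f : MvPolynomial σ k), p.IsPrime → f ∉ p →
      motive (piece p f))
    (union : ∀ S T, IsCons k S → IsCons k T → motive S → motive T → motive (S ∪ T)) :
    motive S := by
  classical
  obtain ⟨C, hC, h⟩ := hS.exists_isConstructible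
  obtain ⟨ι, _, p, f, hpf, h'⟩ := exists_pieces_of_isConstructible hC
  obtain rfl : S = ⋃ i, AComplex.piece (p i).asIdeal (f i) := h' ▸ Set.ext h
  have _ := Fintype.ofFinite ι
  have (s : Finset ι) : motive (⋃ i ∈ s, AComplex.piece (p i).asIdeal (f i)) ∧
      IsCons k (⋃ i ∈ s, AComplex.piece (p i).asIdeal (f i)) := by
    induction s using Finset.induction_on with
    | empty => simpa using ⟨empty, IsCons.empty⟩
    | insert i s hi ih =>
      rw [Finset.set_biUnion_insert]
      exact ⟨union _ _ (isCons_piece _ _) ih.2 (piece _ _ (p i).2 (hpf i)) ih.1,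
        (isCons_piece _ _).union ih.2⟩
  simpa using (this Finset.univ).1

variable [IsAlgClosed k]

/-- The product `h * f` vanishes on the whole zero locus of `p`, so it lies in `p` by the
Nullstellensatz, and `f` does not. -/
theorem mem_of_vanish_piece {p : Ideal (MvPolynomial σ k)} [p.IsPrime] {f h : MvPolynomial σ k}
    (hf : f ∉ p) (hh : ∀ x ∈ piece p f, MvPolynomial.eval x h = 0) : h ∈ p := by
  have : h * f ∈ p := by
    rw [← MvPolynomial.IsPrime.vanishingIdeal_zeroLocus (K := k) p]
    intro x hx
    simp only [MvPolynomial.mem_zeroLocus_iff, MvPolynomial.aeval_eq_eval] at hx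
    by_cases hxf : MvPolynomial.eval x f = 0
    · simp [MvPolynomial.aeval_eq_eval, hxf]
    · have := hh x ⟨fun g hg => by simpa using hx g hg, hxf⟩
      simp [MvPolynomial.aeval_eq_eval, this]
  exact (Ideal.IsPrime.mem_or_mem ‹_› this).resolve_right hf

theorem exists_pointToPoint_of_isMaximal {P : PrimeSpectrum (MvPolynomial σ k)}
    (hP : P.asIdeal.IsMaximal) : ∃ x : σ → k, MvPolynomial.pointToPoint x = P := by
  obtain ⟨x, hx⟩ := MvPolynomial.isMaximal_iff_eq_vanishingIdeal_singleton.1 hP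
  exact ⟨x, PrimeSpectrum.ext hx.symm⟩

/-- Chevalley's theorem for a coordinate projection. -/
theorem IsCons.image_comp {τ : Type*} [Finite τ] (g : σ → τ) {S : Set (τ → k)} (hS : IsCons k S) :
    IsCons k ((fun x : τ → k => x ∘ g) '' S) := by
  obtain ⟨C, hC, h⟩ := hS.exists_isConstructible
  let φ : MvPolynomial σ k →+* MvPolynomial τ k := (MvPolynomial.rename g).toRingHom
  have hφ : φ.FinitePresentation := by
    refine RingHom.FinitePresentation.of_finiteType.1 ?_
    have h1 : (algebraMap k (MvPolynomial τ k)).FiniteType :=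
      RingHom.finiteType_algebraMap.2 inferInstance
    have h2 : algebraMap k (MvPolynomial τ k) = φ.comp (algebraMap k (MvPolynomial σ k)) := by
      ext c; simp [φ]
    rw [h2] at h1
    exact h1.of_comp_finiteType
  have hφe (x : τ → k) : PrimeSpectrum.comap φ (MvPolynomial.pointToPoint x) =
      MvPolynomial.pointToPoint (x ∘ g) := by
    refine PrimeSpectrum.ext (Ideal.ext fun p => ?_)
    rw [mem_pointToPoint_iff, PrimeSpectrum.comap_asIdeal, Ideal.mem_comap, mem_pointToPoint_iff]
    simp [φ, MvPolynomial.eval_rename]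
  have := isCons_of_isConstructible (PrimeSpectrum.isConstructible_comap_image hφ hC)
  convert this using 1
  ext t
  constructor
  · rintro ⟨x, hx, rfl⟩
    exact ⟨_, (h x).1 hx, hφe x⟩
  · rintro ⟨P, hPC, hPt⟩
    -- The point `P` need not be closed. The fibre over the closed point of `t` is closed, so its
    -- intersection with a locally closed part of `C` contains a closed point of the spectrum, which
    -- is a point of affine space by the Nullstellensatz.
    have hclosed : IsClosed (PrimeSpectrum.comap φ ⁻¹' {MvPolynomial.pointToPoint t}) := by
      refine IsClosed.preimage (PrimeSpectrum.continuous_comap φ) ?_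
      rw [PrimeSpectrum.isClosed_singleton_iff_isMaximal]
      exact inferInstanceAs (MvPolynomial.vanishingIdeal k {t}).IsMaximal
    obtain ⟨D, rfl⟩ := PrimeSpectrum.exists_constructibleSetData_iff.2 hC
    simp only [PrimeSpectrum.ConstructibleSetData.toSet, Set.mem_iUnion] at hPC
    obtain ⟨c, hc, hPc⟩ := hPC
    have hloc : IsLocallyClosed (c.toSet ∩ PrimeSpectrum.comap φ ⁻¹' {MvPolynomial.pointToPoint t}) :=
      IsLocallyClosed.inter ((PrimeSpectrum.isClosed_zeroLocus _).isLocallyClosed.inter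
        (PrimeSpectrum.isClosed_zeroLocus _).isOpen_compl.isLocallyClosed) hclosed.isLocallyClosed
    obtain ⟨Q, ⟨hQc, hQt⟩, hQ⟩ := nonempty_inter_closedPoints (Z := c.toSet ∩ _)
      ⟨P, hPc, hPt⟩ hloc
    obtain ⟨x, rfl⟩ := exists_pointToPoint_of_isMaximal
      ((PrimeSpectrum.isClosed_singleton_iff_isMaximal _).1 hQ)
    refine ⟨x, (h x).2 ?_, ?_⟩
    · simp only [PrimeSpectrum.ConstructibleSetData.toSet, Set.mem_iUnion]
      exact ⟨c, hc, hQc⟩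
    · have h3 : MvPolynomial.pointToPoint (k := k) (x ∘ g) = MvPolynomial.pointToPoint t := by
        rw [← hφe]; exact hQt
      funext i
      have h4 : (MvPolynomial.X i - MvPolynomial.C (t i) : MvPolynomial σ k) ∈
          (MvPolynomial.pointToPoint (k := k) t).asIdeal := by
        rw [mem_pointToPoint_iff]; simp
      rw [← h3, mem_pointToPoint_iff] at h4
      simpa [sub_eq_zero] using h4

end Coordinates

/-! ### Krull dimension of constructible sets as a transcendence degree. -/

section Dimension

variable {k : Type u} [Field k] {σ : Type v} [Finite σ]

theorem isPrime_vanishingIdeal_of_isIrreducible {Z : Set (σ → k)}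
    (hZ : @IsIrreducible _ (zariski k (σ → k)) Z) :
    (MvPolynomial.vanishingIdeal k Z).IsPrime := by
  let _ := zariski k (σ → k)
  obtain ⟨z, hz⟩ := hZ.nonempty
  refine ⟨fun h => ?_, fun {a b} hab => ?_⟩
  · have : (1 : MvPolynomial σ k) ∈ MvPolynomial.vanishingIdeal k Z := h ▸ Submodule.mem_top
    simpa using this z hz
  · have h := isPreirreducible_iff_isClosed_union_isClosed.1 hZ.isPreirreducible _ _
      (isClosed_zeros (eval_mem_polyFun a)) (isClosed_zeros (eval_mem_polyFun b)) (fun x hx => by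
        have := hab x hx
        rw [map_mul, mul_eq_zero] at this
        simpa [MvPolynomial.aeval_eq_eval] using this)
    refine h.imp (fun h x hx => ?_) (fun h x hx => ?_) <;>
    simpa [MvPolynomial.aeval_eq_eval] using h hx

theorem vanishingIdeal_lt_of_closed {S Z Z' : Set (σ → k)} (hZ' : Z' ⊆ S) (h : Z ⊆ Z') (hne : Z ≠ Z')
    (hZ : ∃ C, @IsClosed _ (zariski k (σ → k)) C ∧ Z = S ∩ C) :
    MvPolynomial.vanishingIdeal k Z' < MvPolynomial.vanishingIdeal k Z := by
  obtain ⟨C, hC, rfl⟩ := hZ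
  refine lt_of_le_of_ne (MvPolynomial.vanishingIdeal_anti_mono h) fun heq => hne (h.antisymm ?_)
  intro x hx
  refine ⟨hZ' hx, by_contra fun hxC => ?_⟩
  obtain ⟨f, hf, hfC, hfx⟩ := exists_polyFun_of_notMem hC hxC
  obtain ⟨p, hp⟩ := mem_polyFun_pi_iff.1 hf
  have : p ∈ MvPolynomial.vanishingIdeal k (S ∩ C) := fun y hy => by
    simpa [MvPolynomial.aeval_eq_eval, ← hp] using hfC y hy.2
  rw [← heq] at this
  exact hfx (by simpa [MvPolynomial.aeval_eq_eval, ← hp] using this x hx)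

/-- Vanishing ideals turn a chain of irreducible closed subsets of `S` into a reversed strict chain
of primes. The smallest prime, which comes from the largest member, has a residue ring of
transcendence degree at least the length. -/
theorem exists_prime_of_dimGe {S : Set (σ → k)} {m : ℕ} (h : DimGe k S m) :
    ∃ p : PrimeSpectrum (MvPolynomial σ k), MvPolynomial.vanishingIdeal k S ≤ p.asIdeal ∧
      m ≤ natTrdeg k (MvPolynomial σ k ⧸ p.asIdeal) := by
  let _ := zariski k (σ → k)
  obtain ⟨l, hl⟩ := Order.le_krullDim_iff.1 h
  let P (Z : TopologicalSpace.IrreducibleCloseds S) : PrimeSpectrum (MvPolynomial σ k) :=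
    ⟨MvPolynomial.vanishingIdeal k (Subtype.val '' (Z : Set S)),
      isPrime_vanishingIdeal_of_isIrreducible
        (Z.isIrreducible.image _ continuous_subtype_val.continuousOn)⟩
  have hP {Z Z' : TopologicalSpace.IrreducibleCloseds S} (hZ : Z < Z') : P Z' < P Z := by
    refine vanishingIdeal_lt_of_closed (S := S) (by simp) (Set.image_mono hZ.le) (fun heq => hZ.ne ?_) ?_
    · exact SetLike.coe_injective (Subtype.val_injective.image_injective heq)
    · obtain ⟨C, hC, hCZ⟩ := isClosed_induced_iff.1 Z.isClosed
      exact ⟨C, hC, by rw [← hCZ]; exact Subtype.image_preimage_coe S C⟩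
  let L : LTSeries (PrimeSpectrum (MvPolynomial σ k)) :=
    { length := l.length
      toFun := fun i => P (l i.rev)
      step := fun i => by
        refine hP (l.strictMono ?_)
        rw [Fin.rev_lt_rev]; exact Fin.castSucc_lt_succ }
  have h1 := length_le_natTrdeg (k := k) L _ rfl
  refine ⟨L.head, ?_, hl ▸ h1⟩
  exact MvPolynomial.vanishingIdeal_anti_mono (by simp)

theorem natTrdeg_quotient_anti {R : Type*} [CommRing R] [Algebra k R] [Algebra.FiniteType k R]
    {p q : Ideal R} [hp : p.IsPrime] [hq : q.IsPrime] (h : p ≤ q) :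
    natTrdeg k (R ⧸ q) ≤ natTrdeg k (R ⧸ p) := by
  rcases eq_or_lt_of_le h with rfl | h
  · exact le_rfl
  · exact (natTrdeg_quotient_strictAnti (p := ⟨p, hp⟩) (q := ⟨q, hq⟩) h).le

variable [IsAlgClosed k]

/-- A chain of primes above `p` avoiding `f` gives a chain of irreducible closed subsets of the
piece. It stays strict because each of these primes is recovered from its points in the piece by
`mem_of_vanish_piece`. -/
theorem dimGe_piece_of_le {p : Ideal (MvPolynomial σ k)} [p.IsPrime] {f : MvPolynomial σ k}
    (hf : f ∉ p) {m : ℕ} (hm : m ≤ natTrdeg k (MvPolynomial σ k ⧸ p)) : DimGe k (piece p f) m := by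
  let _ := zariski k (σ → k)
  obtain ⟨l, hl, hlp⟩ := exists_ltSeries_avoiding (k := k) p hf
  let A := {q : PrimeSpectrum (MvPolynomial σ k) // p ≤ q.asIdeal ∧ f ∉ q.asIdeal}
  let Z (q : A) : Set (piece p f) := {x | ∀ g ∈ q.1.asIdeal, MvPolynomial.eval x.1 g = 0}
  have hmem (q : A) {h : MvPolynomial σ k} (hh : ∀ x ∈ Z q, MvPolynomial.eval x.1 h = 0) :
      h ∈ q.1.asIdeal :=
    mem_of_vanish_piece q.2.2 fun x hx => hh ⟨x, fun g hg => hx.1 g (q.2.1 hg), hx.2⟩ hx.1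
  have hclosed (q : A) : IsClosed (Z q) := by
    have : Z q = ⋂ g : q.1.asIdeal, Subtype.val ⁻¹' {x | MvPolynomial.eval x g.1 = 0} := by
      ext x; simp [Z]
    rw [this]
    exact isClosed_iInter fun g => (isClosed_zeros (eval_mem_polyFun _)).preimage
      continuous_subtype_val
  have hirr (q : A) : IsIrreducible (Z q) := by
    constructor
    · by_contra hne
      rw [Set.not_nonempty_iff_eq_empty] at hne
      exact q.1.2.ne_top ((Ideal.eq_top_iff_one _).2 (hmem q (by simp [hne])))
    · rw [isPreirreducible_iff_isClosed_union_isClosed]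
      intro C D hC hD hCD
      obtain ⟨C', hC', rfl⟩ := isClosed_induced_iff.1 hC
      obtain ⟨D', hD', rfl⟩ := isClosed_induced_iff.1 hD
      by_contra! hcon
      obtain ⟨⟨x, hxZ, hx⟩, ⟨y, hyZ, hy⟩⟩ := And.imp Set.not_subset.1 Set.not_subset.1 hcon
      obtain ⟨a, ha, haC, hax⟩ := exists_polyFun_of_notMem hC' hx
      obtain ⟨b, hb, hbD, hby⟩ := exists_polyFun_of_notMem hD' hy
      obtain ⟨a', ha'⟩ := mem_polyFun_pi_iff.1 ha
      obtain ⟨b', hb'⟩ := mem_polyFun_pi_iff.1 hb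
      have hab : a' * b' ∈ q.1.asIdeal := hmem q fun z hz => by
        rw [map_mul, ← ha', ← hb']
        rcases hCD hz with h | h
        · rw [haC _ h, zero_mul]
        · rw [hbD _ h, mul_zero]
      rcases q.1.2.mem_or_mem hab with h | h
      · exact hax ((ha' _).trans (hxZ _ h))
      · exact hby ((hb' _).trans (hyZ _ h))
  let ZZ (q : A) : TopologicalSpace.IrreducibleCloseds (piece p f) := ⟨Z q, hirr q, hclosed q⟩
  have hZZ {q q' : A} (h : q.1 < q'.1) : ZZ q' < ZZ q := by
    refine lt_of_le_of_ne (fun x hx g hg => hx g (h.le hg)) fun heq => h.not_ge ?_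
    intro g hg
    refine hmem q fun x hx => ?_
    have : x ∈ ZZ q' := by rw [heq]; exact hx
    exact this g hg
  let L : LTSeries (TopologicalSpace.IrreducibleCloseds (piece p f)) :=
    { length := l.length
      toFun := fun i => ZZ ⟨l i.rev, hlp _⟩
      step := fun i => by
        refine hZZ (l.strictMono ?_)
        rw [Fin.rev_lt_rev]; exact Fin.castSucc_lt_succ }
  refine DimGe.of_le (hm.trans hl.ge) ?_
  exact Order.le_krullDim_iff.2 ⟨L, rfl⟩

theorem dimGe_piece_iff {p : Ideal (MvPolynomial σ k)} [p.IsPrime] {f : MvPolynomial σ k}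
    (hf : f ∉ p) {m : ℕ} : DimGe k (piece p f) m ↔ m ≤ natTrdeg k (MvPolynomial σ k ⧸ p) := by
  refine ⟨fun h => ?_, dimGe_piece_of_le hf⟩
  obtain ⟨q, hq, hm⟩ := exists_prime_of_dimGe h
  refine hm.trans (natTrdeg_quotient_anti fun g hg => hq fun x hx => ?_)
  simpa [MvPolynomial.aeval_eq_eval] using hx.1 g hg

theorem vanishingIdeal_inf_le (S T : Set (σ → k)) :
    MvPolynomial.vanishingIdeal k S ⊓ MvPolynomial.vanishingIdeal k T ≤
      MvPolynomial.vanishingIdeal k (S ∪ T) :=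
  fun _ hg x hx => hx.elim (hg.1 x) (hg.2 x)

/-- A constructible set has the dimension of its closure. Constructibility serves the reverse
implication: it reduces to pieces, since a prime containing an intersection of two ideals contains
one of them. -/
theorem dimGe_iff_exists_prime {S : Set (σ → k)} (hS : IsCons k S) {m : ℕ} :
    DimGe k S m ↔ ∃ p : PrimeSpectrum (MvPolynomial σ k),
      MvPolynomial.vanishingIdeal k S ≤ p.asIdeal ∧
        m ≤ natTrdeg k (MvPolynomial σ k ⧸ p.asIdeal) := by
  refine ⟨exists_prime_of_dimGe, ?_⟩
  rintro ⟨q, hq, hm⟩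
  revert q
  refine IsCons.piece_induction (motive := fun S => ∀ q : PrimeSpectrum (MvPolynomial σ k),
    MvPolynomial.vanishingIdeal k S ≤ q.asIdeal → m ≤ natTrdeg k (MvPolynomial σ k ⧸ q.asIdeal) →
      DimGe k S m) hS ?_ ?_ ?_
  · intro q hq
    rw [MvPolynomial.vanishingIdeal_empty] at hq
    exact absurd (top_le_iff.1 hq) q.2.ne_top
  · intro p f hp hf q hq hm
    refine dimGe_piece_of_le hf (hm.trans (natTrdeg_quotient_anti fun g hg => hq fun x hx => ?_))
    simpa [MvPolynomial.aeval_eq_eval] using hx.1 g hg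
  · intro S T _ _ ihS ihT q hq hm
    rcases q.2.inf_le.1 ((vanishingIdeal_inf_le S T).trans hq) with h | h
    · exact (ihS q h hm).mono Set.subset_union_left
    · exact (ihT q h hm).mono Set.subset_union_right

theorem dimGe_union_pi {S T : Set (σ → k)} (hS : IsCons k S) (hT : IsCons k T) {m : ℕ} :
    DimGe k (S ∪ T) m ↔ DimGe k S m ∨ DimGe k T m := by
  refine ⟨fun h => ?_, fun h => h.elim (fun h => h.mono Set.subset_union_left)
    (fun h => h.mono Set.subset_union_right)⟩
  obtain ⟨q, hq, hm⟩ := exists_prime_of_dimGe h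
  exact (q.2.inf_le.1 ((vanishingIdeal_inf_le S T).trans hq)).imp (fun h => (dimGe_iff_exists_prime hS).2 ⟨q, h, hm⟩)
    (fun h => (dimGe_iff_exists_prime hT).2 ⟨q, h, hm⟩)

theorem DimGe.le_card {S : Set (σ → k)} {m : ℕ} (h : DimGe k S m) : m ≤ Nat.card σ := by
  obtain ⟨q, -, hm⟩ := exists_prime_of_dimGe h
  refine hm.trans ((natTrdeg_quotient_anti (p := ⊥) bot_le).trans (le_of_eq ?_))
  rw [natTrdeg_congr (AlgEquiv.quotientBot k (MvPolynomial σ k)), natTrdeg,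
    MvPolynomial.trdeg_of_isDomain]
  simp
  rfl

theorem dimGe_iff_of_vanishingIdeal_eq {S : Set (σ → k)} (hS : IsCons k S)
    {q : Ideal (MvPolynomial σ k)} [hq : q.IsPrime] (h : MvPolynomial.vanishingIdeal k S = q)
    {m : ℕ} : DimGe k S m ↔ m ≤ natTrdeg k (MvPolynomial σ k ⧸ q) := by
  rw [dimGe_iff_exists_prime hS, h]
  exact ⟨fun ⟨p, hp, hm⟩ => hm.trans (natTrdeg_quotient_anti hp), fun hm => ⟨⟨q, hq⟩, le_rfl, hm⟩⟩

end Dimension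

/-! ### The effect of one extra coordinate on dimension. -/

section OneVariable

variable {k : Type u} [Field k] {σ : Type v}

/-- The parameters over which a set has infinitely many points. -/
def infFibre (S : Set (Option σ → k)) : Set (σ → k) :=
  {t | {c : k | (fun o : Option σ => o.elim c t) ∈ S}.Infinite}

theorem _root_.MvPolynomial.optionEquivLeft_rename_some (a : MvPolynomial σ k) :
    MvPolynomial.optionEquivLeft k σ (MvPolynomial.rename some a) = Polynomial.C a := by
  induction a using MvPolynomial.induction_on with
  | C c => simp [MvPolynomial.optionEquivLeft_C]
  | add a b ha hb => simp [ha, hb]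
  | mul_X a i ha => simp [ha, MvPolynomial.optionEquivLeft_X_some]

theorem _root_.MvPolynomial.optionEquivLeft_symm_C (a : MvPolynomial σ k) :
    (MvPolynomial.optionEquivLeft k σ).symm (Polynomial.C a) = MvPolynomial.rename some a := by
  rw [← MvPolynomial.optionEquivLeft_rename_some, AlgEquiv.symm_apply_apply]

theorem infFibre_union (S T : Set (Option σ → k)) :
    infFibre (S ∪ T) = infFibre S ∪ infFibre T := by
  ext t
  exact Set.infinite_union

/-- A polynomial in one variable has infinitely many roots only if it is zero, so infinitude of the
fibre is a condition on the coefficients in the extra variable. This makes `infFibre` constructible.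
-/
theorem infFibre_piece [Infinite k] (p : Ideal (MvPolynomial (Option σ) k))
    (f : MvPolynomial (Option σ) k) (t : σ → k) :
    t ∈ infFibre (piece p f) ↔
      (∀ g ∈ p, ∀ n, MvPolynomial.eval t ((MvPolynomial.optionEquivLeft k σ g).coeff n) = 0) ∧
        ∃ n, MvPolynomial.eval t ((MvPolynomial.optionEquivLeft k σ f).coeff n) ≠ 0 := by
  have hpoly (g : MvPolynomial (Option σ) k) :
      (∀ n, MvPolynomial.eval t ((MvPolynomial.optionEquivLeft k σ g).coeff n) = 0) ↔
        (MvPolynomial.optionEquivLeft k σ g).map (MvPolynomial.eval t) = 0 := by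
    simp [Polynomial.ext_iff]
  simp only [infFibre, piece, Set.mem_ofPred_eq, MvPolynomial.optionEquivLeft_elim_eval]
  rw [← not_forall (p := fun n => _ = _), hpoly]
  simp only [hpoly]
  constructor
  · intro h
    refine ⟨fun g hg => ?_, fun h0 => ?_⟩
    · refine Polynomial.eq_zero_of_infinite_isRoot _ (h.mono fun c hc => hc.1 g hg)
    · refine h ?_
      convert Set.finite_empty
      ext c; simp [h0]
  · rintro ⟨h, h0⟩
    have : {c : k | (∀ g ∈ p, Polynomial.eval c
        ((MvPolynomial.optionEquivLeft k σ g).map (MvPolynomial.eval t)) = 0) ∧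
        Polynomial.eval c ((MvPolynomial.optionEquivLeft k σ f).map (MvPolynomial.eval t)) ≠ 0} =
        {c | Polynomial.IsRoot
          ((MvPolynomial.optionEquivLeft k σ f).map (MvPolynomial.eval t)) c}ᶜ := by
      ext c
      simp only [Set.mem_ofPred_eq, Set.mem_compl_iff, Polynomial.IsRoot.def]
      exact ⟨fun h => h.2, fun hc => ⟨fun g hg => by rw [h g hg, Polynomial.eval_zero], hc⟩⟩
    rw [this]
    exact (Polynomial.finite_setOfPred_isRoot h0).infinite_compl

variable [Finite σ]

theorem isCons_infFibre [IsAlgClosed k] {S : Set (Option σ → k)} (hS : IsCons k S) :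
    IsCons k (infFibre S) := by
  have _ : Infinite k := IsAlgClosed.instInfinite
  refine IsCons.piece_induction (motive := fun S => IsCons k (infFibre S)) hS ?_ ?_ ?_
  · convert IsCons.empty (k := k) (V := σ → k)
    ext t; simp [infFibre]
  · intro p f _ _
    have h1 := isCons_forall_eval (k := k) (σ := σ)
      (fun x : p × ℕ => (MvPolynomial.optionEquivLeft k σ x.1.1).coeff x.2)
    have h2 := isCons_forall_eval (k := k) (σ := σ)
      (fun n : ℕ => (MvPolynomial.optionEquivLeft k σ f).coeff n)
    convert h1.inter _ _ h2.compl using 1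
    ext t
    rw [infFibre_piece]
    simp
  · intro S T _ _ hS hT
    rw [infFibre_union]
    exact hS.union hT

/-- Under this hypothesis `p` is the extension of `q`, and the quotient by `p` is a polynomial ring
in one variable over the quotient by `q`. -/
theorem natTrdeg_quotient_of_coeff_mem {p : Ideal (MvPolynomial (Option σ) k)} [p.IsPrime]
    {q : Ideal (MvPolynomial σ k)} [q.IsPrime]
    (hq : q = p.comap (MvPolynomial.rename some : _ →ₐ[k] MvPolynomial (Option σ) k))
    (h : ∀ g ∈ p, ∀ n, (MvPolynomial.optionEquivLeft k σ g).coeff n ∈ q) :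
    natTrdeg k (MvPolynomial (Option σ) k ⧸ p) = natTrdeg k (MvPolynomial σ k ⧸ q) + 1 := by
  let φ : MvPolynomial (Option σ) k →ₐ[k] Polynomial (MvPolynomial σ k ⧸ q) :=
    (Polynomial.mapAlgHom (Ideal.Quotient.mkₐ k q)).comp
      (MvPolynomial.optionEquivLeft k σ).toAlgHom
  have hφ : Function.Surjective φ := by
    refine Function.Surjective.comp (g := Polynomial.mapAlgHom (Ideal.Quotient.mkₐ k q)) ?_
      (MvPolynomial.optionEquivLeft k σ).surjective
    exact Polynomial.map_surjective _ Ideal.Quotient.mk_surjective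
  have hmem (g) : g ∈ RingHom.ker φ ↔ ∀ n, (MvPolynomial.optionEquivLeft k σ g).coeff n ∈ q := by
    rw [RingHom.mem_ker]
    change Polynomial.map (Ideal.Quotient.mk q) (MvPolynomial.optionEquivLeft k σ g) = 0 ↔ _
    simp [Polynomial.ext_iff, Ideal.Quotient.eq_zero_iff_mem]
  have hker : RingHom.ker φ = p := by
    ext g
    rw [hmem]
    refine ⟨fun hg => ?_, h g⟩
    rw [← (MvPolynomial.optionEquivLeft k σ).symm_apply_apply g]
    generalize MvPolynomial.optionEquivLeft k σ g = G at hg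
    rw [G.as_sum_range_C_mul_X_pow, map_sum]
    refine p.sum_mem fun n _ => ?_
    rw [map_mul]
    refine p.mul_mem_right _ ?_
    have := hg n
    rw [hq, Ideal.mem_comap] at this
    rwa [MvPolynomial.optionEquivLeft_symm_C]
  rw [← natTrdeg_polynomial]
  exact natTrdeg_congr ((Ideal.quotientEquivAlgOfEq k hker.symm).trans
    (Ideal.quotientKerAlgEquivOfSurjective hφ))

/-- Reduced modulo `q`, the polynomial `g` is a non-zero equation for the extra coordinate, so the
quotient by `p` is algebraic over the quotient by `q`. -/
theorem natTrdeg_quotient_of_coeff_notMem {p : Ideal (MvPolynomial (Option σ) k)} [p.IsPrime]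
    {q : Ideal (MvPolynomial σ k)} [q.IsPrime]
    (hq : q = p.comap (MvPolynomial.rename some : _ →ₐ[k] MvPolynomial (Option σ) k))
    {g : MvPolynomial (Option σ) k} (hg : g ∈ p) {n : ℕ}
    (hn : (MvPolynomial.optionEquivLeft k σ g).coeff n ∉ q) :
    natTrdeg k (MvPolynomial (Option σ) k ⧸ p) = natTrdeg k (MvPolynomial σ k ⧸ q) := by
  let ψ : (MvPolynomial σ k ⧸ q) →ₐ[k] (MvPolynomial (Option σ) k ⧸ p) :=
    Ideal.quotientMapₐ p (MvPolynomial.rename some) hq.le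
  have hψ : Function.Injective ψ :=
    Ideal.quotientMap_injective' (J := q) (I := p) (f := (MvPolynomial.rename some :
      _ →ₐ[k] MvPolynomial (Option σ) k).toRingHom) (H := hq.le) hq.ge
  let _ : Algebra (MvPolynomial σ k ⧸ q) (MvPolynomial (Option σ) k ⧸ p) := ψ.toRingHom.toAlgebra
  have _ : IsScalarTower k (MvPolynomial σ k ⧸ q) (MvPolynomial (Option σ) k ⧸ p) :=
    IsScalarTower.of_algebraMap_eq fun c => (ψ.commutes c).symm
  have _ : FaithfulSMul (MvPolynomial σ k ⧸ q) (MvPolynomial (Option σ) k ⧸ p) :=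
    (faithfulSMul_iff_algebraMap_injective _ _).2 hψ
  have hX : IsAlgebraic (MvPolynomial σ k ⧸ q)
      (Ideal.Quotient.mk p (MvPolynomial.X none)) := by
    refine ⟨(MvPolynomial.optionEquivLeft k σ g).map (Ideal.Quotient.mk q), fun h0 => hn ?_, ?_⟩
    · have := congrArg (fun F => F.coeff n) h0
      simpa [Ideal.Quotient.eq_zero_iff_mem] using this
    · have (G : Polynomial (MvPolynomial σ k)) : Polynomial.aeval
          (Ideal.Quotient.mk p (MvPolynomial.X none)) (G.map (Ideal.Quotient.mk q)) =
          Ideal.Quotient.mk p ((MvPolynomial.optionEquivLeft k σ).symm G) := by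
        induction G using Polynomial.induction_on' with
        | add a b ha hb => rw [Polynomial.map_add, map_add, ha, hb, map_add, map_add]
        | monomial n a =>
          rw [← Polynomial.C_mul_X_pow_eq_monomial]
          simp only [Polynomial.map_mul, Polynomial.map_pow, Polynomial.map_X, Polynomial.map_C,
            map_mul, map_pow, Polynomial.aeval_X, Polynomial.aeval_C,
            MvPolynomial.optionEquivLeft_symm_C, MvPolynomial.optionEquivLeft_symm_X]
          rfl
      rw [this, AlgEquiv.symm_apply_apply, Ideal.Quotient.eq_zero_iff_mem]
      exact hg
  have hR (r) : IsAlgebraic (MvPolynomial σ k ⧸ q) (Ideal.Quotient.mk p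
      (MvPolynomial.rename some r)) :=
    isAlgebraic_algebraMap (A := MvPolynomial (Option σ) k ⧸ p) (Ideal.Quotient.mk q r)
  have _ : Algebra.IsAlgebraic (MvPolynomial σ k ⧸ q) (MvPolynomial (Option σ) k ⧸ p) := by
    refine ⟨fun z => ?_⟩
    obtain ⟨z, rfl⟩ := Ideal.Quotient.mk_surjective z
    induction z using MvPolynomial.induction_on with
    | C c => simpa using hR (MvPolynomial.C c)
    | add a b ha hb => rw [map_add]; exact ha.add hb
    | mul_X a i ha =>
      rw [map_mul]
      refine ha.mul ?_
      cases i with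
      | none => exact hX
      | some i => simpa using hR (MvPolynomial.X i)
  have _ : Algebra.FiniteType (MvPolynomial σ k ⧸ q) (MvPolynomial (Option σ) k ⧸ p) :=
    Algebra.FiniteType.of_restrictScalars_finiteType k _ _
  exact natTrdeg_eq_of_isAlgebraic

/-- Let `q` be the contraction of `p`, which is the vanishing ideal of the image. If all
coefficients of elements of `p` lie in `q`, the piece is dense in a cylinder over the zero locus of
`q`, the infinite fibres also have vanishing ideal `q`, and the dimension is one more than that of
the image. Otherwise the dimension is that of the image, and the infinite fibres lie over a proper
closed subset, so that the second alternative yields nothing larger. -/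
theorem dimGe_option_piece [IsAlgClosed k] {p : Ideal (MvPolynomial (Option σ) k)} [p.IsPrime]
    {f : MvPolynomial (Option σ) k} (hf : f ∉ p) {m : ℕ} :
    DimGe k (piece p f) m ↔ DimGe k ((fun x : Option σ → k => x ∘ some) '' piece p f) m ∨
      ∃ m', m = m' + 1 ∧ DimGe k (infFibre (piece p f)) m' := by
  have _ : Infinite k := IsAlgClosed.instInfinite
  set q : Ideal (MvPolynomial σ k) :=
    p.comap (MvPolynomial.rename some : _ →ₐ[k] MvPolynomial (Option σ) k) with hq
  have _ : q.IsPrime := inferInstanceAs (Ideal.comap _ p).IsPrime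
  have himage : MvPolynomial.vanishingIdeal k ((fun x : Option σ → k => x ∘ some) '' piece p f)
      = q := by
    ext h
    rw [hq, Ideal.mem_comap]
    constructor
    · intro hh
      refine mem_of_vanish_piece hf fun x hx => ?_
      simpa [MvPolynomial.eval_rename, MvPolynomial.aeval_eq_eval] using hh _ ⟨x, hx, rfl⟩
    · rintro hh _ ⟨x, hx, rfl⟩
      simpa [MvPolynomial.eval_rename, MvPolynomial.aeval_eq_eval] using hx.1 _ hh
  rw [dimGe_piece_iff hf, dimGe_iff_of_vanishingIdeal_eq ((isCons_piece p f).image_comp some)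
    himage]
  by_cases hA : ∀ g ∈ p, ∀ n, (MvPolynomial.optionEquivLeft k σ g).coeff n ∈ q
  · have hinf : MvPolynomial.vanishingIdeal k (infFibre (piece p f)) = q := by
      obtain ⟨n, hn⟩ : ∃ n, (MvPolynomial.optionEquivLeft k σ f).coeff n ∉ q := by
        by_contra! hcon
        refine hf ?_
        rw [← (MvPolynomial.optionEquivLeft k σ).symm_apply_apply f,
          (MvPolynomial.optionEquivLeft k σ f).as_sum_range_C_mul_X_pow, map_sum]
        refine p.sum_mem fun n _ => ?_
        rw [map_mul, MvPolynomial.optionEquivLeft_symm_C]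
        exact p.mul_mem_right _ (hcon n)
      ext h
      constructor
      · intro hh
        refine mem_of_vanish_piece hn fun x hx => ?_
        simpa [MvPolynomial.aeval_eq_eval] using hh x
          ((infFibre_piece _ _ _).2 ⟨fun g hg n => hx.1 _ (hA g hg n), n, hx.2⟩)
      · intro hh x hx
        have := ((infFibre_piece _ _ _).1 hx).1 _ hh 0
        simpa [MvPolynomial.aeval_eq_eval, MvPolynomial.optionEquivLeft_rename_some] using this
    simp only [dimGe_iff_of_vanishingIdeal_eq (isCons_infFibre (isCons_piece p f)) hinf,
      natTrdeg_quotient_of_coeff_mem hq hA]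
    constructor
    · intro h
      cases m with
      | zero => exact .inl (Nat.zero_le _)
      | succ m => exact .inr ⟨m, rfl, by omega⟩
    · rintro (h | ⟨m', rfl, h⟩) <;> omega
  · push Not at hA
    obtain ⟨g, hg, n, hn⟩ := hA
    rw [natTrdeg_quotient_of_coeff_notMem hq hg hn]
    refine ⟨.inl, ?_⟩
    rintro (h | ⟨m', rfl, h⟩)
    · exact h
    · obtain ⟨q', hq', hm⟩ := exists_prime_of_dimGe h
      have hlt : (⟨q, ‹_›⟩ : PrimeSpectrum (MvPolynomial σ k)) < q' := by
        refine lt_of_le_not_ge (fun a ha => hq' fun x hx => ?_) fun hle => hn (hle (hq' ?_))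
        · have := ((infFibre_piece _ _ _).1 hx).1 _ ha 0
          simpa [MvPolynomial.aeval_eq_eval, MvPolynomial.optionEquivLeft_rename_some] using this
        · intro x hx
          have := ((infFibre_piece _ _ _).1 hx).1 _ hg n
          simpa [MvPolynomial.aeval_eq_eval] using this
      have hlt' := natTrdeg_quotient_strictAnti (k := k) hlt
      exact lt_of_le_of_lt hm hlt'

theorem dimGe_option [IsAlgClosed k] {S : Set (Option σ → k)} (hS : IsCons k S) {m : ℕ} :
    DimGe k S m ↔ DimGe k ((fun x : Option σ → k => x ∘ some) '' S) m ∨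
      ∃ m', m = m' + 1 ∧ DimGe k (infFibre S) m' := by
  refine IsCons.piece_induction (motive := fun S => DimGe k S m ↔
    DimGe k ((fun x : Option σ → k => x ∘ some) '' S) m ∨
      ∃ m', m = m' + 1 ∧ DimGe k (infFibre S) m') hS ?_ ?_ ?_
  · have h (τ : Type v) (m : ℕ) : ¬ DimGe k (∅ : Set (τ → k)) m := fun h =>
      Set.not_nonempty_empty h.nonempty
    have : infFibre (∅ : Set (Option σ → k)) = ∅ := by ext t; simp [infFibre]
    simp [h, this]
  · intro p f _ hf
    exact dimGe_option_piece hf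
  · intro S T hS hT ihS ihT
    rw [dimGe_union_pi hS hT, ihS, ihT, Set.image_union, infFibre_union,
      dimGe_union_pi (hS.image_comp some) (hT.image_comp some), or_or_or_comm,
      ← exists_or]
    refine or_congr Iff.rfl (exists_congr fun m' => ?_)
    rw [dimGe_union_pi (isCons_infFibre hS) (isCons_infFibre hT), and_or_left]

end OneVariable

/-! ### The fibre dimension theorem for constructible sets. -/

section FibreDimension

set_option linter.unusedSectionVars false

variable {k : Type*} [Field k] {V : Type*} [AddCommGroup V] [Module k V]
  {W : Type*} [AddCommGroup W] [Module k W]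

theorem _root_.LinearEquiv.isPolyMap (e : V ≃ₗ[k] W) : IsPolyMap k e :=
  e.toLinearMap.isPolyMap

theorem DimGe.image_of_leftInvOn {f : V → W} {g : W → V} (hf : IsPolyMap k f)
    (hg : IsPolyMap k g) {S : Set V} (h : Set.LeftInvOn g f S) {m : ℕ} (hm : DimGe k S m) :
    DimGe k (f '' S) m := by
  let _ := zariski k V
  let _ := zariski k W
  let E : S ≃ₜ f '' S :=
    { toFun := fun x => ⟨f x, x, x.2, rfl⟩
      invFun := fun y => ⟨g y, by obtain ⟨_, x, hx, rfl⟩ := y; rw [h hx]; exact hx⟩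
      left_inv := fun x => Subtype.ext (h x.2)
      right_inv := by rintro ⟨_, x, hx, rfl⟩; exact Subtype.ext (congrArg f (h hx))
      continuous_toFun := (hf.continuous.comp continuous_subtype_val).subtype_mk _
      continuous_invFun := (hg.continuous.comp continuous_subtype_val).subtype_mk fun y => by
        obtain ⟨_, x, hx, rfl⟩ := y
        change g (f x) ∈ S
        rwa [h hx] }
  exact le_trans hm (Topology.IsInducing.topologicalKrullDim_le E.isInducing)

theorem dimGe_image_injective {f : V →ₗ[k] W} (hf : Function.Injective f) {S : Set V} {m : ℕ} :
    DimGe k (f '' S) m ↔ DimGe k S m := by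
  obtain ⟨g, hg⟩ := f.exists_leftInverse_of_injective (LinearMap.ker_eq_bot.2 hf)
  have hgf (x : V) : g (f x) = x := LinearMap.congr_fun hg x
  constructor
  · intro h
    have h2 := h.image_of_leftInvOn g.isPolyMap f.isPolyMap
      (by rintro _ ⟨x, -, rfl⟩; exact congrArg f (hgf x))
    rw [Set.image_image] at h2
    simpa [hgf] using h2
  · exact DimGe.image_of_leftInvOn f.isPolyMap g.isPolyMap fun x _ => hgf x

theorem not_dimGe_of_subsingleton {S : Set V} (hS : S.Subsingleton) {m : ℕ} :
    ¬ DimGe k S (m + 1) := by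
  let _ := zariski k V
  intro h
  have _ : Subsingleton S := hS.coe_sort
  have h2 : topologicalKrullDim S ≤ 0 := topologicalKrullDim_zero_of_discreteTopology S
  have h3 := h.trans h2
  norm_cast at h3

theorem IsCons.forall_zeros [FiniteDimensional k V] {ι : Type*} (f : ι → V → k)
    (hf : ∀ i, f i ∈ polyFun k V) : IsCons k {v | ∀ i, f i v = 0} := by
  let e := (Module.finBasis k V).equivFun
  have h (i) : (fun x => f i (e.symm x)) ∈ polyFun k (Fin (Module.finrank k V) → k) :=
    polyFun_comp e.symm.isPolyMap (hf i)
  choose p hp using fun i => mem_polyFun_pi_iff.1 (h i)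
  convert (isCons_forall_eval p).preimage e.isPolyMap using 1
  ext v
  simp [← hp]

theorem IsCons.eq_zero [FiniteDimensional k V] {f : V → W} (hf : IsPolyMap k f) :
    IsCons k {v | f v = 0} := by
  convert IsCons.forall_zeros (fun (φ : Module.Dual k W) v => φ (f v)) hf using 1
  ext v
  exact (Module.forall_dual_apply_eq_zero_iff k (f v)).symm

theorem IsCons.eq [FiniteDimensional k V] {f g : V → W} (hf : IsPolyMap k f)
    (hg : IsPolyMap k g) : IsCons k {v | f v = g v} := by
  convert IsCons.eq_zero (hf.sub hg) using 1
  ext v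
  exact sub_eq_zero.symm

theorem IsCons.forall_eq [FiniteDimensional k V] {ι : Type*} {W : ι → Type*}
    [∀ i, AddCommGroup (W i)] [∀ i, Module k (W i)] {f g : ∀ i, V → W i}
    (hf : ∀ i, IsPolyMap k (f i)) (hg : ∀ i, IsPolyMap k (g i)) :
    IsCons k {v | ∀ i, f i v = g i v} := by
  convert IsCons.forall_zeros (fun (x : Σ i, Module.Dual k (W i)) v => x.2 (f x.1 v - g x.1 v))
    (fun x => ((hf x.1).sub (hg x.1)) x.2) using 1
  ext v
  simp only [Set.mem_ofPred_eq, Sigma.forall]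
  exact forall_congr' fun i =>
    (sub_eq_zero.symm.trans (Module.forall_dual_apply_eq_zero_iff k _).symm)

variable [IsAlgClosed k]

theorem dimGe_union [FiniteDimensional k V] {S T : Set V} (hS : IsCons k S) (hT : IsCons k T)
    {m : ℕ} : DimGe k (S ∪ T) m ↔ DimGe k S m ∨ DimGe k T m := by
  let e := (Module.finBasis k V).equivFun.symm
  rw [← dimGe_preimage_linearEquiv e, Set.preimage_union,
    dimGe_union_pi (hS.preimage e.isPolyMap) (hT.preimage e.isPolyMap),
    dimGe_preimage_linearEquiv, dimGe_preimage_linearEquiv]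

theorem DimGe.le_finrank [FiniteDimensional k V] {S : Set V} {m : ℕ} (h : DimGe k S m) :
    m ≤ Module.finrank k V := by
  have h2 := (h.image_linearEquiv (Module.finBasis k V).equivFun).le_card
  simpa using h2

theorem exists_dim [FiniteDimensional k V] {S : Set V} (hS : S.Nonempty) :
    ∃ d, DimGe k S d ∧ ¬ DimGe k S (d + 1) := by
  by_contra! h
  have (m : ℕ) : DimGe k S m := by
    induction m with
    | zero => exact dimGe_zero.2 hS
    | succ m ih => exact h m ih
  exact absurd (this (Module.finrank k V + 1)).le_finrank (by omega)

/-- The coordinate-free form of Chevalley's theorem for one variable, of `isCons_infFibre` and of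
`dimGe_option`. -/
theorem prod_field_aux [FiniteDimensional k V] {S : Set (V × k)} (hS : IsCons k S) :
    IsCons k (Prod.fst '' S) ∧ IsCons k {v | {c | (v, c) ∈ S}.Infinite} ∧
    ∀ m, DimGe k S m ↔ DimGe k (Prod.fst '' S) m ∨
      ∃ m', m = m' + 1 ∧ DimGe k {v | {c | (v, c) ∈ S}.Infinite} m' := by
  let e := (Module.finBasis k V).equivFun
  let E : (Option (Fin (Module.finrank k V)) → k) ≃ₗ[k] V × k :=
    (LinearEquiv.piOptionEquivProd k).trans
      ((LinearEquiv.prodComm k _ _).trans (e.symm.prodCongr (LinearEquiv.refl k k)))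
  have hE (x) : E x = (e.symm (x ∘ some), x none) := rfl
  have hS' := hS.preimage E.isPolyMap
  have h1 : (fun x => x ∘ some) '' (E ⁻¹' S) = e.symm ⁻¹' (Prod.fst '' S) := by
    ext t
    constructor
    · rintro ⟨x, hx, rfl⟩
      exact ⟨_, hx, rfl⟩
    · rintro ⟨⟨v, c⟩, hx, hv⟩
      change v = e.symm t at hv
      exact ⟨fun o => o.elim c t, by rw [Set.mem_preimage, hE]; exact hv ▸ hx, rfl⟩
  have h2 : infFibre (E ⁻¹' S) = e.symm ⁻¹' {v | {c | (v, c) ∈ S}.Infinite} := rfl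
  have hback {B : Set V} (h : IsCons k (e.symm ⁻¹' B)) : IsCons k B := by
    convert h.preimage e.isPolyMap
    ext v
    simp
  have hc1 : IsCons k (e.symm ⁻¹' (Prod.fst '' S)) := h1 ▸ hS'.image_comp some
  refine ⟨hback hc1, hback (h2 ▸ isCons_infFibre hS'), fun m => ?_⟩
  rw [← dimGe_preimage_linearEquiv E, dimGe_option hS']
  erw [h1, h2]
  simp only [dimGe_preimage_linearEquiv]

variable (k V W) in
/-- The dimension theorem for the fibres of constructible sets under the projection `V × W → V`. -/
def HasFibreDimension : Prop :=
  ∀ S : Set (V × W), IsCons k S → (∀ b, IsCons k {v | DimGe k {w | (v, w) ∈ S} b}) ∧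
    ∀ m, DimGe k S m ↔ ∃ a b, a + b = m ∧ DimGe k {v | DimGe k {w | (v, w) ∈ S} b} a

theorem HasFibreDimension.of_equiv {U : Type*} [AddCommGroup U] [Module k U] (e : U ≃ₗ[k] W)
    (h : HasFibreDimension k V U) : HasFibreDimension k V W := by
  intro S hS
  let E : (V × U) ≃ₗ[k] V × W := (LinearEquiv.refl k V).prodCongr e
  have h1 (b) (v : V) : DimGe k {w | (v, w) ∈ E ⁻¹' S} b ↔ DimGe k {w | (v, w) ∈ S} b :=
    dimGe_preimage_linearEquiv e {w | (v, w) ∈ S} b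
  have h2 := h (E ⁻¹' S) (hS.preimage E.isPolyMap)
  simpa only [h1, dimGe_preimage_linearEquiv] using h2

theorem hasFibreDimension_of_subsingleton [Subsingleton W] : HasFibreDimension k V W := by
  intro S hS
  have h1 (b) : {v | DimGe k {w | (v, w) ∈ S} b} = {v | b = 0 ∧ (v, (0 : W)) ∈ S} := by
    ext v
    cases b with
    | zero =>
      simp only [Set.mem_ofPred_eq, dimGe_zero, true_and]
      exact ⟨fun ⟨w, hw⟩ => Subsingleton.elim w 0 ▸ hw, fun h => ⟨0, h⟩⟩
    | succ b => simp [not_dimGe_of_subsingleton Set.subsingleton_of_subsingleton]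
  have hp : IsPolyMap k (fun v : V => (v, (0 : W))) := (LinearMap.inl k V W).isPolyMap
  constructor
  · intro b
    rw [h1]
    rcases eq_or_ne b 0 with rfl | hb
    · convert hS.preimage hp using 1
      ext v
      simp
    · simpa [hb] using IsCons.empty
  · intro m
    have h2 : S = (fun v : V => (v, (0 : W))) '' {v | (v, (0 : W)) ∈ S} := by
      ext ⟨v, w⟩
      obtain rfl := Subsingleton.elim w 0
      simp
    have h3 : DimGe k S m ↔ DimGe k {v | (v, (0 : W)) ∈ S} m := by
      conv_lhs => rw [h2]
      exact dimGe_image_injective (f := LinearMap.inl k V W) LinearMap.inl_injective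
    rw [h3]
    simp only [h1]
    constructor
    · intro h
      exact ⟨m, 0, rfl, by simpa using h⟩
    · rintro ⟨a, b, rfl, h⟩
      obtain ⟨v, rfl, -⟩ := h.nonempty
      simpa using h

/-- The projection `S1` of `S` along the last coordinate and the set `S2` of its infinite fibres
satisfy the theorem by hypothesis. A fibre of `S` over `V` has dimension at least `b` if the fibre
of `S1` has, or if that of `S2` has dimension at least `b - 1`; the same alternative holds for `S`
as a whole. -/
theorem HasFibreDimension.prod_field [FiniteDimensional k V] [FiniteDimensional k W]
    (h : HasFibreDimension k V W) : HasFibreDimension k V (W × k) := by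
  intro S hS
  let E : ((V × W) × k) ≃ₗ[k] V × (W × k) := LinearEquiv.prodAssoc k V W k
  have hS' : IsCons k (E ⁻¹' S) := hS.preimage E.isPolyMap
  obtain ⟨c1, c2, hdim⟩ := prod_field_aux hS'
  set S1 := Prod.fst '' (E ⁻¹' S)
  set S2 := {v | {c | (v, c) ∈ E ⁻¹' S}.Infinite}
  obtain ⟨i1, d1⟩ := h S1 c1
  obtain ⟨i2, d2⟩ := h S2 c2
  have hfib (v : V) (b : ℕ) : DimGe k {w | (v, w) ∈ S} b ↔ DimGe k {w | (v, w) ∈ S1} b ∨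
      ∃ b', b = b' + 1 ∧ DimGe k {w | (v, w) ∈ S2} b' := by
    have hp : IsPolyMap k (fun w : W × k => (v, w)) := (IsPolyMap.const v).prodMk IsPolyMap.id
    have h3 := (prod_field_aux (hS.preimage hp)).2.2 b
    have h4 : Prod.fst '' ((fun w : W × k => (v, w)) ⁻¹' S) = {w | (v, w) ∈ S1} := by
      ext w
      constructor
      · rintro ⟨⟨w, c⟩, hw, rfl⟩
        exact ⟨((v, w), c), hw, rfl⟩
      · rintro ⟨⟨⟨v', w'⟩, c⟩, hw, h⟩
        cases h
        exact ⟨(w, c), hw, rfl⟩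
    rw [h4] at h3
    exact h3
  have hset (b : ℕ) : {v | DimGe k {w | (v, w) ∈ S} b} = {v | DimGe k {w | (v, w) ∈ S1} b} ∪
      {v | ∃ b', b = b' + 1 ∧ DimGe k {w | (v, w) ∈ S2} b'} := by
    ext v; exact hfib v b
  have hc (b : ℕ) : IsCons k {v | ∃ b', b = b' + 1 ∧ DimGe k {w | (v, w) ∈ S2} b'} := by
    cases b with
    | zero => simpa using IsCons.empty
    | succ b => simpa using i2 b
  refine ⟨fun b => hset b ▸ (i1 b).union (hc b), fun m => ?_⟩
  rw [← dimGe_preimage_linearEquiv E, hdim, d1]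
  simp only [d2]
  constructor
  · rintro (⟨a, b, hab, h⟩ | ⟨m', rfl, a, b, hab, h⟩)
    · exact ⟨a, b, hab, by rw [hset]; exact h.mono Set.subset_union_left⟩
    · refine ⟨a, b + 1, by omega, ?_⟩
      rw [hset]
      exact h.mono fun v hv => .inr ⟨b, rfl, hv⟩
  · rintro ⟨a, b, rfl, h⟩
    rw [hset, dimGe_union (i1 b) (hc b)] at h
    rcases h with h | h
    · exact .inl ⟨a, b, rfl, h⟩
    · cases b with
      | zero =>
        obtain ⟨v, b', hb, -⟩ := h.nonempty
        omega
      | succ b => exact .inr ⟨a + b, by omega, a, b, rfl, by simpa using h⟩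

theorem hasFibreDimension [FiniteDimensional k V] [FiniteDimensional k W] :
    HasFibreDimension k V W := by
  have (n : ℕ) : HasFibreDimension k V (Fin n → k) := by
    induction n with
    | zero => exact hasFibreDimension_of_subsingleton
    | succ n ih =>
      exact ih.prod_field.of_equiv
        ((LinearEquiv.prodComm k _ _).trans (Fin.consLinearEquiv k fun _ : Fin (n + 1) => k))
  exact (this _).of_equiv (Module.finBasis k W).equivFun.symm

variable [FiniteDimensional k V] [FiniteDimensional k W] {S : Set (V × W)}

theorem IsCons.dimGe_fibre (hS : IsCons k S) (b : ℕ) :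
    IsCons k {v | DimGe k {w | (v, w) ∈ S} b} :=
  (hasFibreDimension S hS).1 b

theorem IsCons.exists_snd (hS : IsCons k S) : IsCons k {v | ∃ w, (v, w) ∈ S} := by
  convert hS.dimGe_fibre 0 using 1
  ext v
  exact dimGe_zero.symm

theorem IsCons.fibre (hS : IsCons k S) (v : V) : IsCons k {w | (v, w) ∈ S} :=
  hS.preimage ((IsPolyMap.const v).prodMk IsPolyMap.id)

theorem IsCons.swap (hS : IsCons k S) : IsCons k {x : W × V | (x.2, x.1) ∈ S} :=
  hS.preimage (IsPolyMap.snd.prodMk IsPolyMap.fst)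

theorem IsCons.exists_fst (hS : IsCons k S) : IsCons k {w | ∃ v, (v, w) ∈ S} :=
  hS.swap.exists_snd

theorem dimGe_swap {m : ℕ} : DimGe k {x : W × V | (x.2, x.1) ∈ S} m ↔ DimGe k S m :=
  dimGe_preimage_linearEquiv (LinearEquiv.prodComm k W V) S m

theorem DimGe.of_fibres (hS : IsCons k S) {B : Set V} {a b : ℕ} (hB : DimGe k B a)
    (h : ∀ v ∈ B, DimGe k {w | (v, w) ∈ S} b) : DimGe k S (a + b) :=
  ((hasFibreDimension S hS).2 _).2 ⟨a, b, rfl, hB.mono h⟩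

theorem DimGe.image_of_fibres (hS : IsCons k S) {a b : ℕ} (hm : DimGe k S (a + b))
    (h : ∀ v, ¬ DimGe k {w | (v, w) ∈ S} (b + 1)) : DimGe k {v | ∃ w, (v, w) ∈ S} a := by
  obtain ⟨a', b', hab, h'⟩ := ((hasFibreDimension S hS).2 _).1 hm
  obtain ⟨v, hv⟩ := h'.nonempty
  have : b' ≤ b := by
    by_contra! hlt
    exact h v (DimGe.of_le hlt hv)
  refine DimGe.of_le (by omega) (h'.mono fun v hv => ?_)
  obtain ⟨w, hw⟩ := DimGe.nonempty hv
  exact ⟨w, hw⟩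

theorem dimGe_exists_snd_of_injOn (hS : IsCons k S)
    (h : ∀ v w w', (v, w) ∈ S → (v, w') ∈ S → w = w') {m : ℕ} :
    DimGe k {v | ∃ w, (v, w) ∈ S} m ↔ DimGe k S m := by
  constructor
  · intro hm
    exact hm.of_fibres hS (b := 0) fun v hv => dimGe_zero.2 hv
  · intro hm
    exact DimGe.image_of_fibres (a := m) (b := 0) hS hm fun v =>
      not_dimGe_of_subsingleton fun w hw w' hw' => h v w w' hw hw'

/-- A constructible bijection preserves dimension, even if it is polynomial in neither direction:
both sides have the dimension of its graph. -/
theorem DimGe.of_correspondence (hS : IsCons k S)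
    (h : ∀ v w w', (v, w) ∈ S → (v, w') ∈ S → w = w')
    (h' : ∀ w v v', (v, w) ∈ S → (v', w) ∈ S → v = v') {m : ℕ} :
    DimGe k {v | ∃ w, (v, w) ∈ S} m ↔ DimGe k {w | ∃ v, (v, w) ∈ S} m := by
  rw [dimGe_exists_snd_of_injOn hS h, ← dimGe_swap, ← dimGe_exists_snd_of_injOn hS.swap h']
  rfl

end FibreDimension

/-! ### Dimension and constructibility through charts; attained suprema of excesses. -/

section Charts

variable {T : Type*} [TopologicalSpace T]

/-- An open set containing a point of the smallest member of a chain meets all its members, and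
irreducible closed sets meeting an open set correspond bijectively to those of the open set. -/
theorem exists_le_topologicalKrullDim_of_iUnion {ι : Type*} {O : ι → Set T}
    (hO : ∀ i, IsOpen (O i)) (hcov : ∀ x, ∃ i, x ∈ O i) {S : Set T} {m : ℕ} :
    (m : WithBot ℕ∞) ≤ topologicalKrullDim S ↔
      ∃ i, (m : WithBot ℕ∞) ≤ topologicalKrullDim (S ∩ O i : Set T) := by
  constructor
  · intro h
    obtain ⟨l, hl⟩ := Order.le_krullDim_iff.1 h
    obtain ⟨x, hx⟩ := l.head.isIrreducible.nonempty
    obtain ⟨i, hi⟩ := hcov x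
    let f : (S ∩ O i : Set T) → S := Set.inclusion Set.inter_subset_left
    have hf : Topology.IsOpenEmbedding f := by
      refine ⟨Topology.IsEmbedding.inclusion _, ?_⟩
      convert (hO i).preimage (continuous_subtype_val (p := (· ∈ S))) using 1
      ext y
      rw [Set.range_inclusion]
      exact ⟨fun h => h.2, fun h => ⟨y.2, h⟩⟩
    let e := TopologicalSpace.IrreducibleCloseds.orderIsoOfIsOpenEmbedding f hf
    refine ⟨i, Order.le_krullDim_iff.2 ⟨⟨l.length, fun j => e.symm ⟨l j, ?_⟩, fun j => ?_⟩, hl⟩⟩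
    · exact ⟨⟨x, x.2, hi⟩, (l.head_le j) hx⟩
    · exact e.symm.strictMono (l.strictMono Fin.castSucc_lt_succ)
  · rintro ⟨i, h⟩
    exact h.trans (Topology.IsInducing.topologicalKrullDim_le
      (Topology.IsEmbedding.inclusion Set.inter_subset_left).isInducing)

theorem topologicalKrullDim_mono {S S' : Set T} (h : S ⊆ S') :
    topologicalKrullDim S ≤ topologicalKrullDim S' :=
  (Topology.IsEmbedding.inclusion h).isInducing.topologicalKrullDim_le

theorem withBot_le_iff_not_succ_le (d : WithBot ℕ∞) (i : ℕ) :
    d ≤ i ↔ ¬ ((i + 1 : ℕ) : WithBot ℕ∞) ≤ d := by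
  rw [not_le]
  cases d with
  | bot => simp
  | coe d =>
    norm_cast
    rw [Nat.cast_add_one]
    exact (ENat.lt_add_one_iff (ENat.natCast_ne_top i)).symm

theorem withBot_eq_iff (d : WithBot ℕ∞) (i : ℕ) :
    d = i ↔ (i : WithBot ℕ∞) ≤ d ∧ ¬ ((i + 1 : ℕ) : WithBot ℕ∞) ≤ d := by
  rw [← withBot_le_iff_not_succ_le, le_antisymm_iff, and_comm]

theorem exists_topologicalKrullDim_eq {N : ℕ}
    (hN : ∀ m : ℕ, (m : WithBot ℕ∞) ≤ topologicalKrullDim T → m ≤ N) {S : Set T}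
    (hS : S.Nonempty) : ∃ d : ℕ, topologicalKrullDim S = d := by
  by_contra! h
  have (m : ℕ) : (m : WithBot ℕ∞) ≤ topologicalKrullDim S := by
    induction m with
    | zero =>
      obtain ⟨x, hx⟩ := hS
      rw [Nat.cast_zero, topologicalKrullDim, Order.krullDim_nonneg_iff]
      exact ⟨⟨closure {⟨x, hx⟩}, isIrreducible_singleton.closure, isClosed_closure⟩⟩
    | succ m ih => by_contra hcon; exact h m ((withBot_eq_iff _ m).2 ⟨ih, hcon⟩)
  exact absurd (hN (N + 1) ((this _).trans (topologicalKrullDim_subspace_le T S))) (by omega)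

theorem bddAbove_excesses {N : ℕ}
    (hN : ∀ m : ℕ, (m : WithBot ℕ∞) ≤ topologicalKrullDim T → m ≤ N) (S : ℕ → Set T) :
    BddAbove (excesses S) := by
  refine ⟨N, ?_⟩
  rintro _ ⟨i, d, hd, rfl⟩
  have := hN d (hd.ge.trans (topologicalKrullDim_subspace_le T _))
  omega

/-- A bound on the dimension of the space makes the dimension of each non-empty stratum a natural
number and bounds the excesses. A non-empty set of integers bounded above contains its supremum, so
`sSup` is not a default value here. -/
theorem isGreatest_sSup_excesses {N : ℕ}
    (hN : ∀ m : ℕ, (m : WithBot ℕ∞) ≤ topologicalKrullDim T → m ≤ N) (S : ℕ → Set T)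
    (hS : ∃ i, (S i).Nonempty) : IsGreatest (excesses S) (sSup (excesses S)) := by
  obtain ⟨i, hi⟩ := hS
  obtain ⟨d, hd⟩ := exists_topologicalKrullDim_eq hN hi
  exact ⟨Int.csSup_mem ⟨_, i, d, hd, rfl⟩ (bddAbove_excesses hN S),
    fun z hz => le_csSup (bddAbove_excesses hN S) hz⟩

theorem le_sSup_excesses {N : ℕ}
    (hN : ∀ m : ℕ, (m : WithBot ℕ∞) ≤ topologicalKrullDim T → m ≤ N) {S : ℕ → Set T}
    {i d : ℕ} (h : (d : WithBot ℕ∞) ≤ topologicalKrullDim (S i)) :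
    (d : ℤ) - i ≤ sSup (excesses S) := by
  have hne : (S i).Nonempty := by
    by_contra hne
    rw [Set.not_nonempty_iff_eq_empty] at hne
    have h0 : topologicalKrullDim (S i) = ⊥ := by
      rw [hne]
      refine Order.krullDim_eq_bot_iff.2 ⟨fun Z => ?_⟩
      obtain ⟨x, -⟩ := Z.isIrreducible.nonempty
      exact x.2
    rw [h0] at h
    exact absurd h (by simp)
  obtain ⟨d', hd'⟩ := exists_topologicalKrullDim_eq hN hne
  rw [hd'] at h
  have h' : d ≤ d' := by exact_mod_cast h
  have := le_csSup (bddAbove_excesses hN S) ⟨i, d', hd', rfl⟩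
  omega

theorem IsConstructibleSet.union {S S' : Set T} (h : IsConstructibleSet S)
    (h' : IsConstructibleSet S') : IsConstructibleSet (S ∪ S') := by
  obtain ⟨C, hC, hCl, rfl⟩ := h
  obtain ⟨C', hC', hCl', rfl⟩ := h'
  exact ⟨C ∪ C', hC.union hC', fun Z hZ => hZ.elim (hCl Z) (hCl' Z), Set.sUnion_union _ _⟩

theorem _root_.IsLocallyClosed.isConstructibleSet {S : Set T} (h : IsLocallyClosed S) :
    IsConstructibleSet S := ⟨{S}, Set.finite_singleton S, by simpa using h, by simp⟩

theorem IsConstructibleSet.iUnion {ι : Type*} [Finite ι] {S : ι → Set T}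
    (h : ∀ i, IsConstructibleSet (S i)) : IsConstructibleSet (⋃ i, S i) := by
  have (s : Finset ι) : IsConstructibleSet (⋃ i ∈ s, S i) := by
    classical
    induction s using Finset.induction_on with
    | empty => simpa using (isOpen_empty (X := T)).isLocallyClosed.isConstructibleSet
    | insert i s hi ih => rw [Finset.set_biUnion_insert]; exact (h i).union ih
  have _ := Fintype.ofFinite ι
  simpa using this Finset.univ

theorem IsConstructibleSet.preimage {T' : Type*} [TopologicalSpace T'] {f : T' → T}
    (hf : Continuous f) {S : Set T} (h : IsConstructibleSet S) :
    IsConstructibleSet (f ⁻¹' S) := by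
  obtain ⟨C, hC, hCl, rfl⟩ := h
  refine ⟨(f ⁻¹' ·) '' C, hC.image _, ?_, ?_⟩
  · rintro _ ⟨Z, hZ, rfl⟩
    exact (hCl Z hZ).preimage hf
  · rw [Set.sUnion_image, Set.preimage_sUnion]

theorem IsConstructibleSet.image {T' : Type*} [TopologicalSpace T'] {f : T → T'}
    (hf : Topology.IsInducing f) (hr : IsLocallyClosed (Set.range f)) {S : Set T}
    (h : IsConstructibleSet S) : IsConstructibleSet (f '' S) := by
  obtain ⟨C, hC, hCl, rfl⟩ := h
  refine ⟨(f '' ·) '' C, hC.image _, ?_, ?_⟩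
  · rintro _ ⟨Z, hZ, rfl⟩
    exact (hCl Z hZ).image hf hr
  · rw [Set.sUnion_image, Set.sUnion_eq_biUnion, Set.image_iUnion₂]

variable {k : Type*} [Field k] {W : Type*} [AddCommGroup W] [Module k W]

variable (k) in
/-- On the open set `O` the map `c` is a homeomorphism onto a subset of a vector space with its
Zariski topology. -/
structure IsChart (O : Set T) (c : T → W) : Prop where
  isOpen : IsOpen O
  isEmbedding : @Topology.IsEmbedding O W _ (zariski k W) (fun x => c x)

theorem IsChart.le_dim_iff {O : Set T} {c : T → W} (hc : IsChart k O c) {S : Set T} (hS : S ⊆ O)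
    {m : ℕ} : (m : WithBot ℕ∞) ≤ topologicalKrullDim S ↔ DimGe k (c '' S) m := by
  let _ := zariski k W
  have h : Topology.IsEmbedding (fun x : S => c x) :=
    hc.isEmbedding.comp (Topology.IsEmbedding.inclusion hS)
  have heq := IsHomeomorph.topologicalKrullDim_eq _ h.toHomeomorph.isHomeomorph
  rw [heq, Set.image_eq_range]
  rfl

theorem IsChart.injOn {O : Set T} {c : T → W} (hc : IsChart k O c) : Set.InjOn c O := by
  intro x hx y hy h
  let _ := zariski k W
  exact congrArg Subtype.val (hc.isEmbedding.injective (a₁ := ⟨x, hx⟩) (a₂ := ⟨y, hy⟩) h)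

theorem IsCons.isConstructibleSet [IsAlgClosed k] [FiniteDimensional k W] {S : Set W}
    (hS : IsCons k S) : @IsConstructibleSet W (zariski k W) S := by
  let _ := zariski k W
  let e := (Module.finBasis k W).equivFun
  let _ := zariski k (Fin (Module.finrank k W) → k)
  have h : IsConstructibleSet (e.symm ⁻¹' S) := by
    refine IsCons.piece_induction (motive := fun S => IsConstructibleSet S)
      (hS.preimage e.symm.isPolyMap) ?_ ?_ ?_
    · exact (isOpen_empty).isLocallyClosed.isConstructibleSet
    · intro p f _ _
      refine IsLocallyClosed.isConstructibleSet
        (IsLocallyClosed.inter (IsClosed.isLocallyClosed ?_) (IsOpen.isLocallyClosed ?_))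
      · change IsClosed {x | ∀ g ∈ p, MvPolynomial.eval x g = 0}
        simp only [Set.ofPred_forall]
        exact isClosed_biInter fun g _ => isClosed_zeros (eval_mem_polyFun g)
      · exact (isClosed_zeros (eval_mem_polyFun f)).isOpen_compl
    · intro S T _ _ hS hT
      exact hS.union hT
  convert h.preimage e.isPolyMap.continuous
  ext v
  simp

theorem IsChart.isConstructibleSet [IsAlgClosed k] [FiniteDimensional k W] {O : Set T}
    {c : T → W} (hc : IsChart k O c) {S : Set T} (hS : S ⊆ O) (h : IsCons k (c '' S)) :
    IsConstructibleSet S := by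
  let _ := zariski k W
  have h1 := (h.isConstructibleSet.preimage hc.isEmbedding.continuous).image
    Topology.IsInducing.subtypeVal (by simpa using hc.isOpen.isLocallyClosed)
  convert h1
  ext x
  constructor
  · exact fun hx => ⟨⟨x, hS hx⟩, ⟨x, hx, rfl⟩, rfl⟩
  · rintro ⟨⟨x, hxO⟩, ⟨y, hy, hxy⟩, rfl⟩
    exact hc.injOn (hS hy) hxO hxy ▸ hy

end Charts

/-! ### Charts of projective space and the dimension of cones. -/

section Projective

variable {k : Type*} [Field k] {V : Type*} [AddCommGroup V] [Module k V]

theorem _root_.MvPolynomial.IsHomogeneous.eval_smul_eq {σ : Type*} {F : MvPolynomial σ k} {n : ℕ}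
    (hF : F.IsHomogeneous n) (c : k) (x : σ → k) :
    MvPolynomial.eval (c • x) F = c ^ n * MvPolynomial.eval x F := by
  rw [MvPolynomial.eval_eq, MvPolynomial.eval_eq, Finset.mul_sum]
  refine Finset.sum_congr rfl fun d hd => ?_
  have h : ∑ i ∈ d.support, d i = n := by
    rw [← hF (MvPolynomial.mem_support_iff.1 hd), Finsupp.weight_apply, Finsupp.sum]
    simp
  simp only [Pi.smul_apply, smul_eq_mul, mul_pow, Finset.prod_mul_distrib,
    Finset.prod_pow_eq_pow_sum, h]
  ring

/-- Homogenization, with the linear form `φ` as the homogenizing variable. -/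
theorem exists_isHomogeneous_eval (φ : Module.Dual k V) {g : V → k} (hg : g ∈ polyFun k V) :
    ∃ (F : MvPolynomial (Module.Dual k V) k) (n : ℕ), F.IsHomogeneous n ∧
      ∀ v, φ v ≠ 0 → MvPolynomial.eval (fun ψ => ψ v) F = φ v ^ n * g ((φ v)⁻¹ • v) := by
  obtain ⟨p, rfl⟩ := hg
  refine ⟨∑ i ∈ Finset.range (p.totalDegree + 1),
    MvPolynomial.X φ ^ (p.totalDegree - i) * MvPolynomial.homogeneousComponent i p,
    p.totalDegree, MvPolynomial.IsHomogeneous.sum _ _ _ fun i hi => ?_, fun v hv => ?_⟩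
  · have h1 := ((MvPolynomial.isHomogeneous_X k φ).pow (p.totalDegree - i)).mul
      (MvPolynomial.homogeneousComponent_isHomogeneous i p)
    convert h1 using 1
    have := Finset.mem_range.1 hi
    omega
  · have hp (q : MvPolynomial (Module.Dual k V) k) (w : V) :
        MvPolynomial.aeval (fun φ : Module.Dual k V => (φ : V → k)) q w =
          MvPolynomial.eval (fun ψ => ψ w) q := by
      induction q using MvPolynomial.induction_on with
      | C c => rw [MvPolynomial.algHom_C]; simp
      | add a b ha hb => simp [ha, hb]
      | mul_X a i ha => simp [ha]
    change _ = _ * MvPolynomial.aeval (fun φ : Module.Dual k V => (φ : V → k)) p _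
    rw [hp]
    conv_rhs => arg 2; rw [← MvPolynomial.sum_homogeneousComponent p]
    rw [map_sum, map_sum, Finset.mul_sum]
    refine Finset.sum_congr rfl fun i hi => ?_
    have hi' : i ≤ p.totalDegree := Nat.lt_succ_iff.1 (Finset.mem_range.1 hi)
    have hh : (fun ψ : Module.Dual k V => ψ ((φ v)⁻¹ • v)) = (φ v)⁻¹ • fun ψ => ψ v := by
      funext ψ; simp
    rw [map_mul, map_pow, MvPolynomial.eval_X, hh,
      MvPolynomial.IsHomogeneous.eval_smul_eq
        (MvPolynomial.homogeneousComponent_isHomogeneous i p)]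
    rw [← mul_assoc]
    congr 1
    rw [inv_pow, ← div_eq_mul_inv, eq_div_iff (pow_ne_zero _ hv), ← pow_add,
      Nat.sub_add_cancel hi']

/-- The chart sends a line to its vector with `φ = 1`. Homogenizing and dehomogenizing match the
basic open sets on the two sides. -/
theorem isChart_projectivization (φ : Module.Dual k V) :
    IsChart k {p : ℙ k V | φ p.rep ≠ 0} (fun p => (φ p.rep)⁻¹ • p.rep) where
  isOpen := TopologicalSpace.isOpen_generateFrom_of_mem
    ⟨MvPolynomial.X φ, 1, MvPolynomial.isHomogeneous_X k φ, by simp⟩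
  isEmbedding := by
    let _ := zariski k V
    refine ⟨⟨le_antisymm ?_ ?_⟩, ?_⟩
    · rw [← continuous_iff_le_induced]
      refine continuous_generateFrom_iff.2 ?_
      rintro _ ⟨g, hg, rfl⟩
      obtain ⟨F, n, hF, h⟩ := exists_isHomogeneous_eval φ hg
      refine isOpen_induced_iff.2 ⟨_, TopologicalSpace.isOpen_generateFrom_of_mem ⟨F, n, hF, rfl⟩, ?_⟩
      ext ⟨p, hp⟩
      simp only [Set.mem_preimage, Set.mem_ofPred_eq, h _ hp]
      simp [show φ p.rep ≠ 0 from hp]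
    · let t : TopologicalSpace {p : ℙ k V | φ p.rep ≠ 0} :=
        TopologicalSpace.induced (fun p => (φ p.1.rep)⁻¹ • p.1.rep) (zariski k V)
      change t ≤ _
      rw [instTopologicalSpaceSubtype, ← continuous_iff_le_induced]
      refine continuous_generateFrom_iff.2 ?_
      rintro _ ⟨F, n, hF, rfl⟩
      refine isOpen_induced_iff.2 ⟨{v | MvPolynomial.eval (fun ψ : Module.Dual k V => ψ v) F ≠ 0},
        TopologicalSpace.isOpen_generateFrom_of_mem ⟨_, ⟨F, rfl⟩, ?_⟩, ?_⟩
      · ext v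
        have : MvPolynomial.aeval (fun φ : Module.Dual k V => (φ : V → k)) F v =
            MvPolynomial.eval (fun ψ => ψ v) F := by
          clear hF
          induction F using MvPolynomial.induction_on with
          | C c => rw [MvPolynomial.algHom_C]; simp
          | add a b ha hb => simp [ha, hb]
          | mul_X a i ha => simp [ha]
        exact not_congr (by rw [← this]; rfl)
      · ext ⟨p, hp⟩
        have hh : (fun ψ : Module.Dual k V => ψ ((φ p.rep)⁻¹ • p.rep)) =
            (φ p.rep)⁻¹ • fun ψ => ψ p.rep := by
          funext ψ; simp
        simp only [Set.mem_preimage, Set.mem_ofPred_eq, hh, MvPolynomial.IsHomogeneous.eval_smul_eq hF]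
        simp [show φ p.rep ≠ 0 from hp]
    · rintro ⟨p, hp⟩ ⟨q, hq⟩ h
      refine Subtype.ext ?_
      change p = q
      rw [← p.mk_rep, ← q.mk_rep, Projectivization.mk_eq_mk_iff']
      refine ⟨φ p.rep * (φ q.rep)⁻¹, ?_⟩
      have h' : (φ p.rep)⁻¹ • p.rep = (φ q.rep)⁻¹ • q.rep := h
      rw [mul_smul, ← h', smul_smul, mul_inv_cancel₀ hp, one_smul]

variable (k) in
theorem exists_dual_rep_ne_zero (p : ℙ k V) : ∃ φ : Module.Dual k V, φ p.rep ≠ 0 := by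
  by_contra! h
  exact p.rep_nonzero ((Module.forall_dual_apply_eq_zero_iff k _).1 h)

theorem le_dim_projectivization_iff {S : Set (ℙ k V)} {m : ℕ} :
    (m : WithBot ℕ∞) ≤ topologicalKrullDim S ↔ ∃ φ : Module.Dual k V,
      DimGe k ((fun p : ℙ k V => (φ p.rep)⁻¹ • p.rep) '' (S ∩ {p | φ p.rep ≠ 0})) m := by
  rw [exists_le_topologicalKrullDim_of_iUnion (fun φ => (isChart_projectivization φ).isOpen)
    (exists_dual_rep_ne_zero k)]
  exact exists_congr fun φ => (isChart_projectivization φ).le_dim_iff Set.inter_subset_right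

variable [IsAlgClosed k]

theorem dimGe_ne_zero : DimGe k {c : k | c ≠ 0} 1 := by
  have _ : Infinite k := IsAlgClosed.instInfinite
  have hS : IsCons k {x : PUnit × k | x.2 ≠ 0} :=
    (IsCons.eq_zero (f := fun x : PUnit × k => x.2) IsPolyMap.snd).compl
  have h := ((prod_field_aux hS).2.2 1).2 (.inr ⟨0, rfl, dimGe_zero.2 ⟨0, ?_⟩⟩)
  · exact (dimGe_preimage_linearEquiv (LinearEquiv.uniqueProd (R := k) (M := k) (M₂ := PUnit))
      {c : k | c ≠ 0} 1).1 h
  · exact (Set.finite_singleton (0 : k)).infinite_compl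

theorem dimGe_one_of_smul_mem {S : Set V} {v : V} (hv : v ≠ 0)
    (h : ∀ c : k, c ≠ 0 → c • v ∈ S) : DimGe k S 1 := by
  have h1 := (dimGe_image_injective (f := LinearMap.toSpanSingleton k V v)
    (fun a b hab => smul_left_injective k hv hab)).2 (dimGe_ne_zero (k := k))
  refine h1.mono ?_
  rintro _ ⟨c, hc, rfl⟩
  exact h c hc

variable [FiniteDimensional k V]

theorem dimGe_iUnion {ι : Type*} [Finite ι] [Nonempty ι] {S : ι → Set V}
    (hS : ∀ i, IsCons k (S i)) {m : ℕ} : DimGe k (⋃ i, S i) m ↔ ∃ i, DimGe k (S i) m := by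
  refine ⟨fun h => ?_, fun ⟨i, h⟩ => h.mono (Set.subset_iUnion S i)⟩
  have (s : Finset ι) : IsCons k (⋃ i ∈ s, S i) ∧
      (DimGe k (⋃ i ∈ s, S i) m → ∃ i, DimGe k (S i) m) := by
    classical
    induction s using Finset.induction_on with
    | empty => exact ⟨by simpa using IsCons.empty, fun h => by simpa using h.nonempty⟩
    | insert i s hi ih =>
      rw [Finset.set_biUnion_insert]
      refine ⟨(hS i).union ih.1, fun h => ?_⟩
      rcases (dimGe_union (hS i) ih.1).1 h with h | h
      · exact ⟨i, h⟩
      · exact ih.2 h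
  have _ := Fintype.ofFinite ι
  exact (this Finset.univ).2 (by simpa using h)

/-- The map `(v, c) ↦ c • v` is a bijection from pairs with `φ v = 1` and `c ≠ 0` onto the part of
the cone where `φ ≠ 0`, and the punctured line has dimension one. -/
theorem dimGe_cone_chart {C : Set V} (hC : IsCons k C)
    (hcone : ∀ c : k, c ≠ 0 → ∀ v ∈ C, c • v ∈ C) (φ : Module.Dual k V) (m : ℕ) :
    DimGe k (C ∩ {v | φ v ≠ 0}) (m + 1) ↔ DimGe k (C ∩ {v | φ v = 1}) m := by
  have hφ : IsPolyMap k φ := LinearMap.isPolyMap φ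
  have h1 : IsCons k (C ∩ {v | φ v = 1}) :=
    hC.inter _ _ (IsCons.eq hφ (IsPolyMap.const 1))
  let B : Set (V × k) := {x | x.1 ∈ C ∩ {v | φ v = 1} ∧ x.2 ≠ 0}
  have hB : IsCons k B := (h1.preimage IsPolyMap.fst).inter _ _
    (IsCons.eq_zero (f := fun x : V × k => x.2) IsPolyMap.snd).compl
  let R : Set ((V × k) × V) := {x | x.1 ∈ B ∧ x.2 = x.1.2 • x.1.1}
  have hR : IsCons k R := (hB.preimage IsPolyMap.fst).inter _ _
    (IsCons.eq IsPolyMap.snd (IsPolyMap.smul (polyFun_comp IsPolyMap.fst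
      (dual_mem_polyFun (LinearMap.snd k V k))) (IsPolyMap.fst.comp IsPolyMap.fst)))
  have h2 := DimGe.of_correspondence hR (m := m + 1) (fun x w w' h h' => h.2.trans h'.2.symm) <| by
    rintro w ⟨v, c⟩ ⟨v', c'⟩ ⟨⟨⟨-, hv⟩, hc⟩, hw⟩ ⟨⟨⟨-, hv'⟩, hc'⟩, h⟩
    simp only [Set.mem_ofPred_eq] at hv hv' hc hc' h hw
    rw [hw] at h
    have h3 := congrArg φ h
    simp only [map_smul, hv, hv', smul_eq_mul, mul_one] at h3
    subst h3
    rw [smul_right_injective V hc h]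
  have h3 : {x | ∃ w, (x, w) ∈ R} = B := by
    ext x
    exact ⟨fun ⟨w, hw⟩ => hw.1, fun hx => ⟨x.2 • x.1, hx, rfl⟩⟩
  have h4 : {w | ∃ x, (x, w) ∈ R} = C ∩ {v | φ v ≠ 0} := by
    ext w
    constructor
    · rintro ⟨⟨v, c⟩, ⟨⟨hv, hv1⟩, hc⟩, hw⟩
      simp only [Set.mem_ofPred_eq] at hv1 hc hv hw
      subst hw
      refine ⟨hcone c hc v hv, ?_⟩
      simpa [hv1] using hc
    · rintro ⟨hw, hφw⟩
      refine ⟨((φ w)⁻¹ • w, φ w), ⟨⟨hcone _ (inv_ne_zero hφw) w hw, ?_⟩, hφw⟩, ?_⟩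
      · simp [show φ w ≠ 0 from hφw]
      · simp [smul_smul, show φ w ≠ 0 from hφw]
  rw [h3, h4] at h2
  rw [← h2]
  constructor
  · intro h
    refine (DimGe.image_of_fibres (a := m) (b := 1) hB h fun v h5 => ?_).mono ?_
    · have := h5.le_finrank
      rw [Module.finrank_self] at this
      omega
    · rintro v ⟨c, hv, -⟩
      exact hv
  · intro h
    refine h.of_fibres hB fun v hv => ?_
    exact (dimGe_ne_zero (k := k)).mono fun c (hc : c ≠ 0) => show (v, c) ∈ B from ⟨hv, hc⟩

theorem le_dim_projectivization_cone {C : Set V} (hC : IsCons k C)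
    (hcone : ∀ c : k, c ≠ 0 → ∀ v ∈ C, c • v ∈ C) {m : ℕ} :
    (m : WithBot ℕ∞) ≤ topologicalKrullDim {p : ℙ k V | p.rep ∈ C} ↔ DimGe k C (m + 1) := by
  have himage (φ : Module.Dual k V) : (fun p : ℙ k V => (φ p.rep)⁻¹ • p.rep) ''
      ({p : ℙ k V | p.rep ∈ C} ∩ {p | φ p.rep ≠ 0}) = C ∩ {v | φ v = 1} := by
    ext v
    constructor
    · rintro ⟨p, ⟨hp, hφ⟩, rfl⟩
      exact ⟨hcone _ (inv_ne_zero hφ) _ hp, by simp [show φ p.rep ≠ 0 from hφ]⟩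
    · rintro ⟨hv, hφv⟩
      have hv0 : v ≠ 0 := by rintro rfl; simp at hφv
      obtain ⟨a, ha⟩ := Projectivization.exists_smul_eq_mk_rep k v hv0
      have hrep : (Projectivization.mk k v hv0).rep = (a : k) • v := ha.symm
      refine ⟨Projectivization.mk k v hv0, ⟨?_, ?_⟩, ?_⟩
      · rw [Set.mem_ofPred_eq, hrep]
        exact hcone _ a.ne_zero _ hv
      · rw [Set.mem_ofPred_eq, hrep]
        simp [show φ v = 1 from hφv]
      · simp [hrep, show φ v = 1 from hφv, smul_smul]
  simp only [le_dim_projectivization_iff, himage, ← dimGe_cone_chart hC hcone]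
  refine ⟨fun ⟨φ, h⟩ => h.mono Set.inter_subset_left, fun h => ?_⟩
  let b := Module.finBasis k V
  -- The vertex lies in no chart, but a single point cannot have dimension `m + 1`; the rest of the
  -- cone is covered by the charts of finitely many coordinates.
  have hcov : C ⊆ {0} ∪ ⋃ i, C ∩ {v | b.coord i v ≠ 0} := by
    intro v hv
    by_cases h0 : ∀ i, b.coord i v = 0
    · exact .inl (b.forall_coord_eq_zero_iff.1 h0)
    · push Not at h0
      obtain ⟨i, hi⟩ := h0
      exact .inr (Set.mem_iUnion.2 ⟨i, hv, hi⟩)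
  have hc (i) : IsCons k (C ∩ {v | b.coord i v ≠ 0}) :=
    hC.inter _ _ (IsCons.eq_zero (f := fun v => b.coord i v) (LinearMap.isPolyMap _)).compl
  rcases (dimGe_union (IsCons.eq IsPolyMap.id (IsPolyMap.const 0)) (IsCons.iUnion hc)).1
    (h.mono hcov) with h | h
  · exact absurd h (not_dimGe_of_subsingleton (Set.subsingleton_singleton))
  · have : Nonempty (Fin (Module.finrank k V)) := by
      obtain ⟨v, hv⟩ := h.nonempty
      exact ⟨(Set.mem_iUnion.1 hv).choose⟩
    obtain ⟨i, hi⟩ := (dimGe_iUnion hc).1 h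
    exact ⟨_, hi⟩

theorem le_finrank_of_le_dim_projectivization {m : ℕ}
    (h : (m : WithBot ℕ∞) ≤ topologicalKrullDim (ℙ k V)) : m ≤ Module.finrank k V := by
  have h1 : (m : WithBot ℕ∞) ≤ topologicalKrullDim (Set.univ : Set (ℙ k V)) :=
    h.trans (Homeomorph.Set.univ (ℙ k V)).symm.isInducing.topologicalKrullDim_le
  obtain ⟨φ, h2⟩ := le_dim_projectivization_iff.1 h1
  exact h2.le_finrank

end Projective

/-! ### The group of automorphisms, its orbits and its torsors. -/

section GroupAction

set_option linter.unusedSectionVars false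

theorem finiteDimensional_pi_of_subsingleton {k : Type*} [Field k] {ι : Type*} {M : ι → Type*}
    [∀ i, AddCommGroup (M i)] [∀ i, Module k (M i)] [∀ i, FiniteDimensional k (M i)]
    (s : Finset ι) (h : ∀ i ∉ s, Subsingleton (M i)) : FiniteDimensional k (∀ i, M i) := by
  let f : (∀ i, M i) →ₗ[k] ∀ i : s, M i := LinearMap.pi fun i => LinearMap.proj i.1
  refine Module.Finite.of_injective f fun x y hxy => funext fun i => ?_
  by_cases hi : i ∈ s
  · exact congrFun hxy ⟨i, hi⟩
  · have := h i hi
    exact Subsingleton.elim _ _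

variable {k : Type u} [Field k] {A : Type v} [Ring A] [Algebra k A]

section Hom

variable {M N : Type*} [AddCommGroup M] [AddCommGroup N] [Module A M] [Module A N] [Module k M]
  [Module k N] [IsScalarTower k A M] [IsScalarTower k A N]

instance finiteDimensional_hom [FiniteDimensional k M] [FiniteDimensional k N] :
    FiniteDimensional k (M →ₗ[A] N) :=
  Module.Finite.of_injective (LinearMap.restrictScalarsₗ k A M N k)
    (LinearMap.restrictScalars_injective k)

theorem IsPolyMap.apply {X : Type*} [AddCommGroup X] [Module k X] [FiniteDimensional k M]
    [FiniteDimensional k N] {f : X → (M →ₗ[A] N)} {g : X → M} (hf : IsPolyMap k f)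
    (hg : IsPolyMap k g) : IsPolyMap k (fun x => f x (g x)) :=
  IsPolyMap.bilin (LinearMap.restrictScalarsₗ k A M N k) hf hg

end Hom

theorem IsPolyMap.pi_apply {X : Type*} [AddCommGroup X] [Module k X] {ι : Type*} {M : ι → Type*}
    [∀ i, AddCommGroup (M i)] [∀ i, Module k (M i)] {f : X → ∀ i, M i} (hf : IsPolyMap k f)
    (i : ι) : IsPolyMap k (fun x => f x i) :=
  (LinearMap.proj (R := k) (φ := M) i).isPolyMap.comp hf

variable {s : ℕ} (P : Fin s → Type v) [∀ i, AddCommGroup (P i)] [∀ i, Module A (P i)]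
  [∀ i, Module k (P i)] [∀ i, IsScalarTower k A (P i)]
  (r : ℤ →₀ (Fin s → ℕ)) (I : Ideal A)

theorem subsingleton_projSum {n : ℤ} (hn : n ∉ r.support) : Subsingleton (ProjSum P (r n)) := by
  rw [Finsupp.notMem_support_iff] at hn
  rw [hn]
  exact inferInstanceAs (Subsingleton (∀ i, Fin 0 → P i))

variable [∀ i, FiniteDimensional k (P i)]

instance : FiniteDimensional k (HomSpace k P r I) := by
  have : FiniteDimensional k (∀ n : ℤ, ProjSum P (r n) →ₗ[A] ProjSum P (r (n - 1))) :=
    finiteDimensional_pi_of_subsingleton r.support fun n hn => by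
      have := subsingleton_projSum P r hn
      infer_instance
  infer_instance

variable (A) in
/-- The space `∏_n End_A(r_n A)`. -/
abbrev EndSpace : Type v := ∀ n : ℤ, ProjSum P (r n) →ₗ[A] ProjSum P (r n)

instance : FiniteDimensional k (EndSpace A P r) :=
  finiteDimensional_pi_of_subsingleton r.support fun n hn => by
    have := subsingleton_projSum P r hn
    infer_instance

/-- The space of sequences of families of vectors in the modules `r_n A`. -/
abbrev VectorSpace (N : ℤ → ℕ) : Type v := ∀ n : ℤ, Fin (N n) → ProjSum P (r n)

instance (N : ℤ → ℕ) : FiniteDimensional k (VectorSpace P r N) :=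
  finiteDimensional_pi_of_subsingleton r.support fun n hn => by
    have := subsingleton_projSum P r hn
    infer_instance

variable (A) in
/-- The set of invertible elements of `∏_n End_A(r_n A)`. -/
def unitSet : Set (EndSpace A P r) := Set.range fun (g : AutGroup A P r) n => (g n).toLinearMap

variable {P r I}

theorem isPolyMap_val (n : ℤ) : IsPolyMap k (fun h : HomSpace k P r I => h.1 n) := by
  let f : HomSpace k P r I →ₗ[k] (ProjSum P (r n) →ₗ[A] ProjSum P (r (n - 1))) :=
    { toFun := fun h => h.1 n
      map_add' := fun _ _ => rfl
      map_smul' := fun _ _ => rfl }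
  have hf := LinearMap.isPolyMap (k := k) (V := HomSpace k P r I)
    (W := ProjSum P (r n) →ₗ[A] ProjSum P (r (n - 1))) f
  exact hf

theorem smul_val (g : AutGroup A P r) (h : HomSpace k P r I) (n : ℤ) (v : ProjSum P (r n)) :
    (g • h).1 n v = g (n - 1) (h.1 n ((g n).symm v)) := rfl

theorem smul_eq_iff (g : AutGroup A P r) (h h' : HomSpace k P r I) :
    g • h = h' ↔ ∀ n v, h'.1 n (g n v) = g (n - 1) (h.1 n v) := by
  constructor
  · rintro rfl n v
    rw [smul_val, LinearEquiv.symm_apply_apply]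
  · intro H
    refine Subtype.ext (funext fun n => LinearMap.ext fun v => ?_)
    rw [smul_val, ← H, LinearEquiv.apply_symm_apply]

theorem mem_unitSet_iff {a : EndSpace A P r} :
    a ∈ unitSet A P r ↔ ∃ b : EndSpace A P r, (∀ n v, a n (b n v) = v) ∧ ∀ n v, b n (a n v) = v := by
  constructor
  · rintro ⟨g, rfl⟩
    exact ⟨fun n => (g n).symm.toLinearMap, fun n v => (g n).apply_symm_apply v,
      fun n v => (g n).symm_apply_apply v⟩
  · rintro ⟨b, h1, h2⟩
    exact ⟨fun n => LinearEquiv.ofLinearMap (a n) (b n) (LinearMap.ext (h1 n)) (LinearMap.ext (h2 n)),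
      rfl⟩

variable [IsAlgClosed k]

/-- The invertible elements are the projection of the set of mutually inverse pairs, which is given
by polynomial equations. -/
theorem isCons_unitSet : IsCons k (unitSet A P r) := by
  have hf {X : Type v} [AddCommGroup X] [Module k X] {f : X → EndSpace A P r} (hf : IsPolyMap k f)
      (n : ℤ) {g : X → ProjSum P (r n)} (hg : IsPolyMap k g) :
      IsPolyMap k (fun x => f x n (g x)) := (hf.pi_apply n).apply hg
  have h1 : IsCons k {x : EndSpace A P r × EndSpace A P r |
      ∀ i : (Σ n, ProjSum P (r n)), x.1 i.1 (x.2 i.1 i.2) = i.2} :=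
    IsCons.forall_eq (fun i => hf IsPolyMap.fst _ (hf IsPolyMap.snd _ (IsPolyMap.const _)))
      (fun i => IsPolyMap.const _)
  have h2 : IsCons k {x : EndSpace A P r × EndSpace A P r |
      ∀ i : (Σ n, ProjSum P (r n)), x.2 i.1 (x.1 i.1 i.2) = i.2} :=
    IsCons.forall_eq (fun i => hf IsPolyMap.snd _ (hf IsPolyMap.fst _ (IsPolyMap.const _)))
      (fun i => IsPolyMap.const _)
  convert (h1.inter _ _ h2).exists_snd using 1
  ext a
  simp only [mem_unitSet_iff, Set.mem_inter_iff, Set.mem_ofPred_eq, Sigma.forall]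

/-- Written as `h' g = g h`, the relation is polynomial and involves no inverse; `g` is then
projected away. -/
theorem isCons_orbitRel :
    IsCons k {x : HomSpace k P r I × HomSpace k P r I | ∃ g : AutGroup A P r, g • x.1 = x.2} := by
  have h1 : IsCons k {x : (HomSpace k P r I × HomSpace k P r I) × EndSpace A P r |
      ∀ i : (Σ n, ProjSum P (r n)), x.1.2.1 i.1 (x.2 i.1 i.2) =
        x.2 (i.1 - 1) (x.1.1.1 i.1 i.2)} := by
    refine IsCons.forall_eq (fun i => ?_) (fun i => ?_)
    · refine IsPolyMap.apply ?_ (IsPolyMap.apply (IsPolyMap.snd.pi_apply _) (IsPolyMap.const _))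
      exact (isPolyMap_val (k := k) i.1).comp (IsPolyMap.snd.comp IsPolyMap.fst)
    · refine IsPolyMap.apply (IsPolyMap.snd.pi_apply _) (IsPolyMap.apply ?_ (IsPolyMap.const _))
      exact (isPolyMap_val (k := k) i.1).comp (IsPolyMap.fst.comp IsPolyMap.fst)
  have h2 := (isCons_unitSet (k := k) (A := A) (P := P) (r := r)).preimage
    (IsPolyMap.snd (V := HomSpace k P r I × HomSpace k P r I))
  convert (h2.inter _ _ h1).exists_snd using 1
  ext ⟨h, h'⟩
  simp only [smul_eq_iff, Set.mem_inter_iff, Set.mem_ofPred_eq, Set.mem_preimage, unitSet,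
    Set.mem_range, Sigma.forall]
  constructor
  · rintro ⟨g, hg⟩
    exact ⟨_, ⟨g, rfl⟩, hg⟩
  · rintro ⟨_, ⟨g, rfl⟩, hg⟩
    exact ⟨g, hg⟩

theorem isCons_orbit (h : HomSpace k P r I) : IsCons k (MulAction.orbit (AutGroup A P r) h) :=
  isCons_orbitRel.fibre h

/-- Acting by `c ^ (-n)` in degree `n` multiplies every differential by `c ^ (-(n - 1)) * c ^ n =
c`. Hence orbits are stable under non-zero scalars. -/
theorem smul_mem_orbit (h : HomSpace k P r I) {c : k} (hc : c ≠ 0) :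
    c • h ∈ MulAction.orbit (AutGroup A P r) h := by
  refine ⟨fun n => DistribMulAction.toLinearEquiv A _ (Units.mk0 c hc ^ (-n)), ?_⟩
  refine (smul_eq_iff _ _ _).2 fun n v => ?_
  have h1 : (Units.mk0 c hc ^ (-(n - 1)) : kˣ) = Units.mk0 c hc * Units.mk0 c hc ^ (-n) := by
    rw [neg_sub, sub_eq_add_neg, zpow_add, zpow_one]
  change c • h.1 n ((Units.mk0 c hc ^ (-n) : kˣ) • v) =
    (Units.mk0 c hc ^ (-(n - 1)) : kˣ) • h.1 n v
  rw [h1, mul_smul, Units.smul_def, Units.smul_def, Units.smul_def, Units.val_mk0,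
    LinearMap.map_smul_of_tower]

variable (I) in
/-- The set of pairs `(g φ, g h)`, for `g` in the group `∏_n Aut_A(r_n A)`. -/
def torsor {N : ℤ → ℕ} (φ : VectorSpace P r N) (h : HomSpace k P r I) :
    Set (VectorSpace P r N × HomSpace k P r I) :=
  {x | ∃ g : AutGroup A P r, (∀ n j, x.1 n j = g n (φ n j)) ∧ x.2 = g • h}

section Torsor

variable {N : ℤ → ℕ} {φ : VectorSpace P r N} {h : HomSpace k P r I}

/-- Since `φ` generates, `g` is determined by `g φ`, and so is `g h`. The torsor thus projects
injectively onto the image of the group under the injective linear map `a ↦ a φ`. -/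
theorem dimGe_torsor (hφ : ∀ n, Submodule.span A (Set.range (φ n)) = ⊤)
    (hT : IsCons k (torsor I φ h)) {m : ℕ} :
    DimGe k (torsor I φ h) m ↔ DimGe k (unitSet A P r) m := by
  let f : EndSpace A P r →ₗ[k] VectorSpace P r N :=
    { toFun := fun a n j => a n (φ n j)
      map_add' := fun _ _ => rfl
      map_smul' := fun _ _ => rfl }
  have hf : Function.Injective f := by
    intro a b hab
    refine funext fun n => LinearMap.ext_on_range (hφ n) fun j => ?_
    exact congrFun (congrFun hab n) j
  rw [← dimGe_exists_snd_of_injOn hT, ← dimGe_image_injective hf]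
  · refine iff_of_eq (congrArg (DimGe k · m) ?_)
    ext ψ
    constructor
    · rintro ⟨h', g, hg, rfl⟩
      exact ⟨_, ⟨g, rfl⟩, funext fun n => funext fun j => (hg n j).symm⟩
    · rintro ⟨_, ⟨g, rfl⟩, rfl⟩
      exact ⟨g • h, g, fun _ _ => rfl, rfl⟩
  · rintro ψ h1 h2 ⟨g, hg, rfl⟩ ⟨g', hg', h2'⟩
    have h3 : (fun n => (g n).toLinearMap) = fun n => (g' n).toLinearMap :=
      hf (funext fun n => funext fun j => (hg n j).symm.trans (hg' n j))
    have : g = g' := funext fun n => LinearEquiv.toLinearMap_injective (congrFun h3 n)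
    rw [this]
    exact h2'.symm

/-- The orbit-stabilizer inequality. Fibres of the torsor over the orbit are cosets of a stabilizer,
and `g * g'⁻¹` carries the fibre over `g' • h` into the fibre over `g • h`; so one fibre of
dimension at least `b` makes all of them so. -/
theorem dimGe_unitSet_of_torsor_fibre (hφ : ∀ n, Submodule.span A (Set.range (φ n)) = ⊤)
    (hT : IsCons k (torsor I φ h)) {h' : HomSpace k P r I}
    {a b : ℕ} (ha : DimGe k (MulAction.orbit (AutGroup A P r) h) a)
    (hb : DimGe k {ψ | (ψ, h') ∈ torsor I φ h} b) : DimGe k (unitSet A P r) (a + b) := by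
  rw [← dimGe_torsor hφ hT, ← dimGe_swap]
  refine ha.of_fibres hT.swap ?_
  rintro _ ⟨g, rfl⟩
  obtain ⟨ψ, g', -, rfl⟩ := hb.nonempty
  let e : VectorSpace P r N ≃ₗ[k] VectorSpace P r N :=
    LinearEquiv.piCongrRight fun n => LinearEquiv.piCongrRight fun _ =>
      ((g * g'⁻¹) n).restrictScalars k
  refine (hb.image_linearEquiv e).mono ?_
  rintro _ ⟨ψ, ⟨g'', hg'', hh⟩, rfl⟩
  refine ⟨g * g'⁻¹ * g'', fun n j => ?_, ?_⟩
  · exact congrArg ((g * g'⁻¹) n) (hg'' n j)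
  · change g • h = (g * g'⁻¹ * g'') • h
    change g' • h = g'' • h at hh
    rw [mul_smul, ← hh, mul_smul, inv_smul_smul]

end Torsor

end GroupAction

/-! ### Isomorphism loci and strata in orbit charts. -/

section OrbitCharts

set_option linter.unusedSectionVars false

variable {k : Type u} [Field k] {A : Type v} [Ring A] [Algebra k A] {s : ℕ}
  {P : Fin s → Type v} [∀ i, AddCommGroup (P i)] [∀ i, Module A (P i)]
  [∀ i, Module k (P i)] [∀ i, IsScalarTower k A (P i)]
  {r : ℤ →₀ (Fin s → ℕ)} {I : Ideal A}
  {T : Type*} [TopologicalSpace T]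

/-- The points whose complex lies in the orbit of the complex at `x`. -/
def orbitLocus (cls : T → HomSpace k P r I) (x : T) : Set T :=
  {y | cls y ∈ MulAction.orbit (AutGroup A P r) (cls x)}

/-- The points whose orbit locus has dimension at most `i`. -/
def orbitStratum (cls : T → HomSpace k P r I) (i : ℕ) : Set T :=
  {x | topologicalKrullDim (orbitLocus cls x) ≤ i}

/-- A chart of a space parametrizing complexes `cls x`, with a constructible family of torsors of
trivializations of these complexes. -/
structure OrbitChart (cls : T → HomSpace k P r I) (O : Set T) where
  dim : ℕ
  chart : T → Fin dim → k
  isChart : IsChart k O chart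
  gens : ℤ → ℕ
  total : Set ((Fin dim → k) × (VectorSpace P r gens × HomSpace k P r I))
  isCons : IsCons k total
  fibre : ∀ x ∈ O, ∃ φ : VectorSpace P r gens, (∀ n, Submodule.span A (Set.range (φ n)) = ⊤) ∧
    {y | (chart x, y) ∈ total} = torsor I φ (cls x)
  mem_image : ∀ b y, (b, y) ∈ total → ∃ x ∈ O, chart x = b

variable [∀ i, FiniteDimensional k (P i)] [IsAlgClosed k]

namespace OrbitChart

variable {cls : T → HomSpace k P r I} {O O' : Set T} (C : OrbitChart cls O)
  (C' : OrbitChart cls O')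

/-- The pairs consisting of a point and a complex isomorphic to the one at that point. -/
def graph : Set ((Fin C.dim → k) × HomSpace k P r I) := {x | ∃ ψ, (x.1, (ψ, x.2)) ∈ C.total}

theorem isCons_graph : IsCons k C.graph := by
  have h : IsCons k {x : ((Fin C.dim → k) × HomSpace k P r I) × VectorSpace P r C.gens |
      (x.1.1, (x.2, x.1.2)) ∈ C.total} :=
    C.isCons.preimage ((IsPolyMap.fst.comp IsPolyMap.fst).prodMk
      (IsPolyMap.snd.prodMk (IsPolyMap.snd.comp IsPolyMap.fst)))
  exact h.exists_snd

theorem mem_graph_iff {x : T} (hx : x ∈ O) {h : HomSpace k P r I} :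
    (C.chart x, h) ∈ C.graph ↔ h ∈ MulAction.orbit (AutGroup A P r) (cls x) := by
  obtain ⟨φ, -, hφ⟩ := C.fibre x hx
  constructor
  · rintro ⟨ψ, hψ⟩
    have : (ψ, h) ∈ torsor I φ (cls x) := hφ ▸ hψ
    obtain ⟨g, -, rfl⟩ := this
    exact ⟨g, rfl⟩
  · rintro ⟨g, rfl⟩
    have : ((fun n j => g n (φ n j) : VectorSpace P r C.gens), g • cls x) ∈ torsor I φ (cls x) :=
      ⟨g, fun _ _ => rfl, rfl⟩
    rw [← hφ] at this
    exact ⟨_, this⟩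

theorem exists_of_mem_graph {b : Fin C.dim → k} {h : HomSpace k P r I} (hb : (b, h) ∈ C.graph) :
    ∃ x ∈ O, C.chart x = b ∧ h ∈ MulAction.orbit (AutGroup A P r) (cls x) := by
  obtain ⟨x, hx, rfl⟩ := C.mem_image _ _ hb.choose_spec
  exact ⟨x, hx, rfl, (C.mem_graph_iff hx).1 hb⟩

theorem mem_image_iff {b : Fin C.dim → k} : b ∈ C.chart '' O ↔ ∃ h, (b, h) ∈ C.graph := by
  constructor
  · rintro ⟨x, hx, rfl⟩
    exact ⟨_, (C.mem_graph_iff hx).2 (MulAction.mem_orbit_self _)⟩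
  · rintro ⟨h, hb⟩
    obtain ⟨x, hx, hxb, -⟩ := C.exists_of_mem_graph hb
    exact ⟨x, hx, hxb⟩

/-- The pairs of points, in two charts, with isomorphic complexes. -/
def isoRel : Set ((Fin C.dim → k) × (Fin C'.dim → k)) :=
  {x | ∃ h, (x.1, h) ∈ C.graph ∧ (x.2, h) ∈ C'.graph}

theorem isCons_isoRel : IsCons k (C.isoRel C') := by
  have h : IsCons k {x : ((Fin C.dim → k) × (Fin C'.dim → k)) × HomSpace k P r I |
      (x.1.1, x.2) ∈ C.graph ∧ (x.1.2, x.2) ∈ C'.graph} := by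
    refine IsCons.inter (k := k) _ _ (?_ : IsCons k {x : ((Fin C.dim → k) × (Fin C'.dim → k)) ×
      HomSpace k P r I | (x.1.1, x.2) ∈ C.graph}) (?_ : IsCons k {x : ((Fin C.dim → k) ×
      (Fin C'.dim → k)) × HomSpace k P r I | (x.1.2, x.2) ∈ C'.graph})
    · exact C.isCons_graph.preimage ((IsPolyMap.fst.comp IsPolyMap.fst).prodMk IsPolyMap.snd)
    · exact C'.isCons_graph.preimage ((IsPolyMap.snd.comp IsPolyMap.fst).prodMk IsPolyMap.snd)
  exact h.exists_snd

/-- Two orbits sharing an element coincide, so the relation over `x` picks out the part of its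
isomorphism locus that lies in the other chart. -/
theorem isoRel_fibre {x : T} (hx : x ∈ O) :
    {b | (C.chart x, b) ∈ C.isoRel C'} = C'.chart '' (orbitLocus cls x ∩ O') := by
  ext b
  constructor
  · rintro ⟨h, h1, h2⟩
    obtain ⟨y, hy, rfl, h3⟩ := C'.exists_of_mem_graph h2
    refine ⟨y, ⟨?_, hy⟩, rfl⟩
    change cls y ∈ MulAction.orbit (AutGroup A P r) (cls x)
    rw [← MulAction.orbit_eq_iff.2 ((C.mem_graph_iff hx).1 h1)]
    exact MulAction.mem_orbit_symm.1 h3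
  · rintro ⟨y, ⟨hy, hyO⟩, rfl⟩
    exact ⟨cls y, (C.mem_graph_iff hx).2 hy, (C'.mem_graph_iff hyO).2 (MulAction.mem_orbit_self _)⟩

theorem le_dim_iff {S : Set T} {m : ℕ} :
    (m : WithBot ℕ∞) ≤ topologicalKrullDim (S ∩ O : Set T) ↔ DimGe k (C.chart '' (S ∩ O)) m :=
  C.isChart.le_dim_iff Set.inter_subset_right

end OrbitChart

variable {cls : T → HomSpace k P r I} {J : Type*} {O : J → Set T}
  (C : ∀ j, OrbitChart cls (O j)) (hO : ∀ x, ∃ j, x ∈ O j)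

theorem isConstructibleSet_of_charts [Finite J] (hO : ∀ x, ∃ j, x ∈ O j)
    (C : ∀ j, OrbitChart cls (O j)) {S : Set T}
    (h : ∀ j, IsCons k ((C j).chart '' (S ∩ O j))) : IsConstructibleSet S := by
  have : S = ⋃ j, S ∩ O j := by
    rw [← Set.inter_iUnion, Set.iUnion_eq_univ_iff.2 hO, Set.inter_univ]
  rw [this]
  exact IsConstructibleSet.iUnion fun j =>
    (C j).isChart.isConstructibleSet Set.inter_subset_right (h j)

theorem le_dim_iff_of_charts (hO : ∀ x, ∃ j, x ∈ O j) (C : ∀ j, OrbitChart cls (O j)) {S : Set T}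
    {m : ℕ} : (m : WithBot ℕ∞) ≤ topologicalKrullDim S ↔
      ∃ j, DimGe k ((C j).chart '' (S ∩ O j)) m := by
  rw [exists_le_topologicalKrullDim_of_iUnion (fun j => (C j).isChart.isOpen) hO]
  exact exists_congr fun j => (C j).le_dim_iff

theorem isConstructibleSet_orbitLocus [Finite J] (hO : ∀ x, ∃ j, x ∈ O j)
    (C : ∀ j, OrbitChart cls (O j)) (x : T) : IsConstructibleSet (orbitLocus cls x) := by
  obtain ⟨i, hi⟩ := hO x
  refine isConstructibleSet_of_charts hO C fun j => ?_
  rw [← (C i).isoRel_fibre (C j) hi]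
  exact ((C i).isCons_isoRel (C j)).fibre _

/-- A locus has dimension at most `i` when its part in each of the finitely many charts has. These
parts are fibres of constructible relations, whose dimension varies constructibly. -/
theorem isCons_image_orbitStratum [Finite J] (hO : ∀ x, ∃ j, x ∈ O j)
    (C : ∀ j, OrbitChart cls (O j)) (i : ℕ) (j : J) :
    IsCons k ((C j).chart '' (orbitStratum cls i ∩ O j)) := by
  have h : IsCons k ({b | ∃ h, (b, h) ∈ (C j).graph} ∩
      ⋂ j', {b | DimGe k {b' | (b, b') ∈ (C j).isoRel (C j')} (i + 1)}ᶜ) :=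
    (C j).isCons_graph.exists_snd.inter _ _ (IsCons.iInter fun j' =>
      (((C j).isCons_isoRel (C j')).dimGe_fibre _).compl)
  have hiff {x : T} (hx : x ∈ O j) : x ∈ orbitStratum cls i ↔
      ∀ j', ¬ DimGe k {b' | ((C j).chart x, b') ∈ (C j).isoRel (C j')} (i + 1) := by
    change topologicalKrullDim (orbitLocus cls x) ≤ i ↔ _
    rw [withBot_le_iff_not_succ_le, le_dim_iff_of_charts hO C, not_exists]
    exact forall_congr' fun j' => by rw [(C j).isoRel_fibre (C j') hx]
  convert h using 1
  ext b
  simp only [Set.mem_inter_iff, Set.mem_iInter, Set.mem_compl_iff, Set.mem_ofPred_eq]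
  constructor
  · rintro ⟨x, ⟨hx, hxO⟩, rfl⟩
    exact ⟨(C j).mem_image_iff.1 ⟨x, hxO, rfl⟩, (hiff hxO).1 hx⟩
  · rintro ⟨hb, hb'⟩
    obtain ⟨x, hxO, rfl⟩ := (C j).mem_image_iff.2 hb
    exact ⟨x, ⟨(hiff hxO).2 hb', hxO⟩, rfl⟩

theorem exists_bound_of_charts [Finite J] (hO : ∀ x, ∃ j, x ∈ O j)
    (C : ∀ j, OrbitChart cls (O j)) :
    ∃ N : ℕ, ∀ m : ℕ, (m : WithBot ℕ∞) ≤ topologicalKrullDim T → m ≤ N := by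
  have _ := Fintype.ofFinite J
  refine ⟨∑ j, (C j).dim, fun m hm => ?_⟩
  obtain ⟨j, hj⟩ := (le_dim_iff_of_charts hO C (S := Set.univ)).1
    (hm.trans (Homeomorph.Set.univ T).symm.isInducing.topologicalKrullDim_le)
  have h1 := hj.le_finrank
  rw [Module.finrank_fin_fun] at h1
  exact h1.trans (Finset.single_le_sum (f := fun j => (C j).dim) (fun _ _ => Nat.zero_le _)
    (Finset.mem_univ j))

theorem isGreatest_excesses_orbitStratum [Finite J] [Nonempty T] (hO : ∀ x, ∃ j, x ∈ O j)
    (C : ∀ j, OrbitChart cls (O j)) :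
    IsGreatest (excesses (orbitStratum cls)) (sSup (excesses (orbitStratum cls))) := by
  obtain ⟨N, hN⟩ := exists_bound_of_charts hO C
  obtain ⟨x⟩ := ‹Nonempty T›
  -- As `N` bounds all dimensions, the stratum of index `N` contains every point.
  refine isGreatest_sSup_excesses hN _ ⟨N, x, ?_⟩
  change topologicalKrullDim (orbitLocus cls x) ≤ N
  rw [withBot_le_iff_not_succ_le]
  intro h
  exact absurd (hN _ (h.trans (topologicalKrullDim_subspace_le T _))) (by omega)

end OrbitCharts

/-! ### Orbits in projective space and the canonical parameter number. -/

section CanonicalPar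

set_option linter.unusedSectionVars false

variable {k : Type u} [Field k] [IsAlgClosed k] {A : Type v} [Ring A] [Algebra k A] {s : ℕ}
  {P : Fin s → Type v} [∀ i, AddCommGroup (P i)] [∀ i, Module A (P i)]
  [∀ i, Module k (P i)] [∀ i, IsScalarTower k A (P i)] [∀ i, FiniteDimensional k (P i)]
  {r : ℤ →₀ (Fin s → ℕ)} {I : Ideal A}

/-- Scalars can be absorbed into the group by `smul_mem_orbit`, so the orbit of a line consists of
the lines through the orbit of any of its non-zero vectors. -/
theorem orbit_projectivization (p : ℙ k (HomSpace k P r I)) :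
    MulAction.orbit (AutGroup A P r) p =
      {q | q.rep ∈ MulAction.orbit (AutGroup A P r) p.rep} := by
  ext q
  constructor
  · rintro ⟨g, rfl⟩
    have h0 : g • p.rep ≠ 0 := (smul_ne_zero_iff_ne g).2 p.rep_nonzero
    have h1 : g • p = Projectivization.mk k (g • p.rep) h0 := by
      conv_lhs => rw [← p.mk_rep]
      rfl
    obtain ⟨a, ha⟩ := Projectivization.exists_smul_eq_mk_rep k (g • p.rep) h0
    have h2 := smul_mem_orbit (g • p.rep) a.ne_zero
    rw [MulAction.orbit_smul] at h2
    rw [Set.mem_ofPred_eq]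
    change (g • p).rep ∈ _
    rw [h1, ← ha]
    exact h2
  · rintro ⟨g, hg⟩
    refine ⟨g, ?_⟩
    change g • p = q
    have h0 : g • p.rep ≠ 0 := (smul_ne_zero_iff_ne g).2 p.rep_nonzero
    have h1 : g • p = Projectivization.mk k (g • p.rep) h0 := by
      conv_lhs => rw [← p.mk_rep]
      rfl
    rw [h1, ← q.mk_rep, Projectivization.mk_eq_mk_iff']
    exact ⟨1, by rw [one_smul]; exact hg.symm⟩

theorem le_dim_orbit_iff (p : ℙ k (HomSpace k P r I)) {m : ℕ} :
    (m : WithBot ℕ∞) ≤ topologicalKrullDim (MulAction.orbit (AutGroup A P r) p) ↔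
      DimGe k (MulAction.orbit (AutGroup A P r) p.rep) (m + 1) := by
  rw [orbit_projectivization]
  refine le_dim_projectivization_cone (isCons_orbit _) ?_
  rintro c hc _ ⟨g, rfl⟩
  have := smul_mem_orbit (g • p.rep) hc
  rwa [MulAction.orbit_smul] at this

theorem isComplex_of_mem_orbit {h h' : HomSpace k P r I}
    (hh : h' ∈ MulAction.orbit (AutGroup A P r) h)
    (h0 : ∀ n : ℤ, h.1 (n - 1) ∘ₗ h.1 n = 0) (n : ℤ) : h'.1 (n - 1) ∘ₗ h'.1 n = 0 := by
  obtain ⟨g, rfl⟩ := hh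
  refine LinearMap.ext fun v => ?_
  rw [LinearMap.comp_apply, smul_val, smul_val, LinearEquiv.symm_apply_apply, ← LinearMap.comp_apply,
    h0, LinearMap.zero_apply, map_zero, LinearMap.zero_apply]

theorem bound_dim_projectivization (k : Type*) [Field k] [IsAlgClosed k] (V : Type*)
    [AddCommGroup V] [Module k V] [FiniteDimensional k V] (m : ℕ)
    (h : (m : WithBot ℕ∞) ≤ topologicalKrullDim (ℙ k V)) : m ≤ Module.finrank k V :=
  le_finrank_of_le_dim_projectivization h

theorem isGreatest_excesses_canonicalStratum (h : (canonicalBase k P r I).Nonempty) :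
    IsGreatest (excesses (canonicalStratum k P r I)) (canonicalPar k P r I) := by
  obtain ⟨p, hp⟩ := h
  -- The dimension of `HomSpace` bounds all orbit dimensions, so `p` lies in the stratum of that
  -- index.
  refine isGreatest_sSup_excesses (bound_dim_projectivization k _) _
    ⟨Module.finrank k (HomSpace k P r I), p, hp, ?_⟩
  rw [withBot_le_iff_not_succ_le]
  intro h
  exact absurd (bound_dim_projectivization k (HomSpace k P r I) _
    (h.trans (topologicalKrullDim_subspace_le _ _))) (by omega)

/-- The orbit of a point, of dimension `d`, lies in the stratum of index `d`, which therefore has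
dimension at least `d`. -/
theorem zero_le_canonicalPar (h : (canonicalBase k P r I).Nonempty) :
    0 ≤ canonicalPar k P r I := by
  obtain ⟨p, hp⟩ := h
  obtain ⟨d, hd⟩ := exists_topologicalKrullDim_eq (bound_dim_projectivization k (HomSpace k P r I))
    (MulAction.nonempty_orbit (M := AutGroup A P r) p)
  have hsub : MulAction.orbit (AutGroup A P r) p ⊆ canonicalStratum k P r I d := by
    intro q hq
    refine ⟨isComplex_of_mem_orbit (h := p.rep) ?_ hp, ?_⟩
    · rw [orbit_projectivization] at hq
      exact hq
    · rw [MulAction.orbit_eq_iff.2 hq, hd]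
  have := le_sSup_excesses (bound_dim_projectivization k (HomSpace k P r I))
    (S := canonicalStratum k P r I) (i := d) (d := d) (hd.ge.trans (topologicalKrullDim_mono hsub))
  rw [sub_self] at this
  exact this

end CanonicalPar

/-! ### Projecting a set of triples to its last component. -/

section TripleProjection

variable {k : Type*} [Field k] [IsAlgClosed k] {B : Type*} [AddCommGroup B] [Module k B]
  [FiniteDimensional k B] {Φ : Type*} [AddCommGroup Φ] [Module k Φ] [FiniteDimensional k Φ]
  {H : Type*} [AddCommGroup H] [Module k H] [FiniteDimensional k H]

/-- For fixed `h` the pairs `(x, ψ)` form a set of dimension at most `b + c`: at most `b` for `x`,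
and at most `c` for `ψ` once `x` is fixed. -/
theorem DimGe.image_of_two_fibres {R : Set (B × (Φ × H))} (hR : IsCons k R) {a b c : ℕ}
    (hm : DimGe k R (a + (b + c)))
    (hc : ∀ x h, ¬ DimGe k {ψ | (x, (ψ, h)) ∈ R} (c + 1))
    (hb : ∀ h, ¬ DimGe k {x | ∃ ψ, (x, (ψ, h)) ∈ R} (b + 1)) :
    DimGe k {h | ∃ x ψ, (x, (ψ, h)) ∈ R} a := by
  let e : (H × (B × Φ)) ≃ₗ[k] B × (Φ × H) :=
    (LinearEquiv.prodComm k _ _).trans (LinearEquiv.prodAssoc k _ _ _)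
  have hS : IsCons k (e ⁻¹' R) := hR.preimage e.isPolyMap
  have hSdim : DimGe k (e ⁻¹' R) (a + (b + c)) := by
    rwa [dimGe_preimage_linearEquiv]
  refine (DimGe.image_of_fibres hS hSdim fun h hh => ?_).mono ?_
  · have hF : IsCons k {y : B × Φ | (h, y) ∈ e ⁻¹' R} := hS.fibre h
    exact hb h (DimGe.image_of_fibres (a := b + 1) (b := c) hF (hh.of_le (by omega))
      fun x hx => hc x h hx)
  · rintro h ⟨⟨x, ψ⟩, hx⟩
    exact ⟨x, ψ, hx⟩

end TripleProjection

/-! ### The inequality between the parameter numbers. -/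

section ParInequality

variable {k : Type u} [Field k] [IsAlgClosed k] {A : Type v} [Ring A] [Algebra k A] {s : ℕ}
  {P : Fin s → Type v} [∀ i, AddCommGroup (P i)] [∀ i, Module A (P i)]
  [∀ i, Module k (P i)] [∀ i, IsScalarTower k A (P i)] [∀ i, FiniteDimensional k (P i)]
  {r : ℤ →₀ (Fin s → ℕ)} {I : Ideal A}
  {T : Type*} [TopologicalSpace T] {cls : T → HomSpace k P r I}

/-- If the orbits over a constructible set of points have dimension `m` and the loci of isomorphic
complexes have dimension at most `i`, the complexes over that set fill a set of dimension at least
`d + m - i`. -/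
theorem OrbitChart.dimGe_image_graph {O : Set T} (C : OrbitChart cls O)
    {Y : Set (Fin C.dim → k)} (hY : IsCons k Y) (hYO : Y ⊆ C.chart '' O) {m i d a : ℕ}
    (hm : ∀ b ∈ Y, DimGe k {h | (b, h) ∈ C.graph} m)
    (hi : ∀ x ∈ O, C.chart x ∈ Y →
      ¬ DimGe k {b ∈ Y | ∃ h, (b, h) ∈ C.graph ∧ (C.chart x, h) ∈ C.graph} (i + 1))
    (hd : DimGe k Y d) (ha : a + i = d + m) :
    DimGe k {h | ∃ b ∈ Y, (b, h) ∈ C.graph} a := by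
  have hne : (unitSet A P r).Nonempty := ⟨_, 1, rfl⟩
  -- `γ` is the dimension of the group, and hence of every fibre of `total` over a point of the
  -- chart.
  obtain ⟨γ, hγ, hγ'⟩ := exists_dim (k := k) hne
  have hfib {b : Fin C.dim → k} (hb : b ∈ Y) : ∃ x ∈ O, C.chart x = b ∧
      ∃ φ : VectorSpace P r C.gens, (∀ n, Submodule.span A (Set.range (φ n)) = ⊤) ∧
        {y | (b, y) ∈ C.total} = torsor I φ (cls x) := by
    obtain ⟨x, hx, rfl⟩ := hYO hb
    exact ⟨x, hx, rfl, C.fibre x hx⟩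
  -- Stabilizers of complexes over `Y` have dimension at most `γ - m`, since their orbits have
  -- dimension at least `m`.
  have hstab {b : Fin C.dim → k} (hb : b ∈ Y) {h : HomSpace k P r I} {c : ℕ}
      (hc : DimGe k {ψ | (b, (ψ, h)) ∈ C.total} c) : m + c ≤ γ := by
    obtain ⟨x, hx, rfl, φ, hφ, hT⟩ := hfib hb
    have hT' : IsCons k (torsor I φ (cls x)) := hT ▸ C.isCons.fibre (C.chart x)
    have h1 : {h | (C.chart x, h) ∈ C.graph} = MulAction.orbit (AutGroup A P r) (cls x) :=
      Set.ext fun h => C.mem_graph_iff hx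
    have h2 : {ψ | (C.chart x, (ψ, h)) ∈ C.total} = {ψ | (ψ, h) ∈ torsor I φ (cls x)} := by
      rw [← hT]; rfl
    have h3 := dimGe_unitSet_of_torsor_fibre hφ hT' (h1 ▸ hm _ hb) (h2 ▸ hc)
    by_contra! hlt
    exact hγ' (h3.of_le hlt)
  have hmγ : m ≤ γ := by
    obtain ⟨b, hb⟩ := hd.nonempty
    obtain ⟨h, ψ, hψ⟩ := (hm b hb).nonempty
    exact hstab hb (c := 0) (dimGe_zero.2 ⟨ψ, hψ⟩)
  let R : Set ((Fin C.dim → k) × (VectorSpace P r C.gens × HomSpace k P r I)) :=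
    {x | x ∈ C.total ∧ x.1 ∈ Y}
  have hR : IsCons k R := C.isCons.inter _ _ (hY.preimage IsPolyMap.fst)
  have hRdim : DimGe k R (d + γ) := by
    refine hd.of_fibres hR fun b hb => ?_
    obtain ⟨x, hx, rfl, φ, hφ, hT⟩ := hfib hb
    have hT' : IsCons k (torsor I φ (cls x)) := hT ▸ C.isCons.fibre (C.chart x)
    refine ((dimGe_torsor hφ hT').2 hγ).mono ?_
    rw [← hT]
    exact fun y hy => ⟨hy, hb⟩
  -- The count is `a + i + (γ - m) = d + γ`: the points with a given complex contribute at most `i`,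
  -- the trivializations at most `γ - m`.
  refine (DimGe.image_of_two_fibres hR (a := a) (b := i) (c := γ - m) (hRdim.of_le (by omega))
    (fun b h hb => ?_) fun h h1 => ?_).mono ?_
  · obtain ⟨ψ, -, hbY⟩ := hb.nonempty
    have := hstab (b := b) hbY (h := h) (c := γ - m + 1) (hb.mono fun ψ hψ => hψ.1)
    omega
  · obtain ⟨b, ψ, hb, hbY⟩ := h1.nonempty
    obtain ⟨x, hx, rfl⟩ := hYO hbY
    refine hi x hx hbY (h1.mono ?_)
    rintro b' ⟨ψ', hb', hbY'⟩
    exact ⟨hbY', h, ⟨ψ', hb'⟩, ⟨ψ, hb⟩⟩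
  · rintro h ⟨b, ψ, hb, hbY⟩
    exact ⟨b, hbY, ψ, hb⟩

/-- The parameter number of a family is at most that of the canonical family. -/
theorem sub_le_canonicalPar {J : Type*} [Finite J] {O : J → Set T} (hO : ∀ x, ∃ j, x ∈ O j)
    (C : ∀ j, OrbitChart cls (O j)) (hcls : ∀ x, ∀ n : ℤ, (cls x).1 (n - 1) ∘ₗ (cls x).1 n = 0)
    (hD : (canonicalBase k P r I).Nonempty) {i d : ℕ}
    (hd : (d : WithBot ℕ∞) ≤ topologicalKrullDim (orbitStratum cls i)) :
    (d : ℤ) - i ≤ canonicalPar k P r I := by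
  rcases le_or_gt d i with hdi | hdi
  · have := zero_le_canonicalPar hD
    omega
  obtain ⟨j, hj⟩ := (le_dim_iff_of_charts hO C).1 hd
  set Y0 := (C j).chart '' (orbitStratum cls i ∩ O j) with hY0
  have hY0c : IsCons k Y0 := isCons_image_orbitStratum hO C i j
  -- The stratum is cut into finitely many constructible parts according to the exact orbit
  -- dimension `m` in `HomSpace`; one of them still has dimension at least `d`.
  let Y (m : Fin (Module.finrank k (HomSpace k P r I) + 1)) : Set (Fin (C j).dim → k) :=
    Y0 ∩ ({b | DimGe k {h | (b, h) ∈ (C j).graph} m} ∩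
      {b | DimGe k {h | (b, h) ∈ (C j).graph} (m + 1)}ᶜ)
  have hYc (m) : IsCons k (Y m) := hY0c.inter _ _
    (((C j).isCons_graph.dimGe_fibre _).inter _ _ ((C j).isCons_graph.dimGe_fibre _).compl)
  have hYU : Y0 ⊆ ⋃ m, Y m := by
    intro b hb
    obtain ⟨x, hx, rfl⟩ := hb
    have hne : {h | ((C j).chart x, h) ∈ (C j).graph}.Nonempty :=
      (C j).mem_image_iff.1 ⟨x, hx.2, rfl⟩
    obtain ⟨m, hm, hm'⟩ := exists_dim (k := k) hne
    have hmle := hm.le_finrank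
    exact Set.mem_iUnion.2 ⟨⟨m, by omega⟩, ⟨x, hx, rfl⟩, hm, hm'⟩
  obtain ⟨⟨m, hm⟩, hYd⟩ := (dimGe_iUnion hYc).1 (hj.mono hYU)
  set Z := Y ⟨m, hm⟩ with hZ
  have hZO : Z ⊆ (C j).chart '' O j := by
    rintro b ⟨⟨x, hx, rfl⟩, -⟩
    exact ⟨x, hx.2, rfl⟩
  have hgraph {x : T} (hx : x ∈ O j) : {h | ((C j).chart x, h) ∈ (C j).graph} =
      MulAction.orbit (AutGroup A P r) (cls x) := Set.ext fun h => (C j).mem_graph_iff hx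
  have hzero {x : T} (hx : x ∈ O j) (hxZ : (C j).chart x ∈ Z) (h0 : m = 0) : cls x = 0 := by
    subst h0
    by_contra hne
    refine hxZ.2.2 ?_
    rw [Set.mem_ofPred_eq, hgraph hx]
    exact dimGe_one_of_smul_mem hne fun c hc => smul_mem_orbit _ hc
  have hlocus : ∀ x ∈ O j, (C j).chart x ∈ Z →
      ¬ DimGe k {b ∈ Z | ∃ h, (b, h) ∈ (C j).graph ∧ ((C j).chart x, h) ∈ (C j).graph} (i + 1) := by
    intro x hx hxZ hdim
    obtain ⟨x', hx', hxx'⟩ := hxZ.1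
    obtain rfl := (C j).isChart.injOn hx'.2 hx hxx'
    have h1 : topologicalKrullDim (orbitLocus cls x') ≤ i := hx'.1
    rw [withBot_le_iff_not_succ_le, le_dim_iff_of_charts hO C] at h1
    refine h1 ⟨j, hdim.mono ?_⟩
    rw [← (C j).isoRel_fibre (C j) hx]
    rintro b ⟨-, h, hb, hx⟩
    exact ⟨h, hx, hb⟩
  have hmain := (C j).dimGe_image_graph (hYc ⟨m, hm⟩) hZO (m := m) (i := i) (d := d)
    (a := d + m - i) (fun b hb => hb.2.1) hlocus hYd (by omega)
  set S := {h | ∃ b ∈ Z, (b, h) ∈ (C j).graph} with hS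
  have hSc : IsCons k S := by
    have h1 : IsCons k {x : (Fin (C j).dim → k) × HomSpace k P r I | x ∈ (C j).graph ∧ x.1 ∈ Z} :=
      (C j).isCons_graph.inter _ _ ((hYc ⟨m, hm⟩).preimage IsPolyMap.fst)
    convert h1.exists_fst using 1
    ext h
    exact exists_congr fun b => and_comm
  -- An orbit of dimension zero is a cone, hence `{0}`. With `m = 0` the set `S` would lie in `{0}`,
  -- although its dimension is at least `d - i > 0`.
  have hmpos : m ≠ 0 := by
    rintro rfl
    have hSsub : S ⊆ {0} := by
      rintro h ⟨b, hb, hbh⟩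
      obtain ⟨x, hx, rfl⟩ := hZO hb
      obtain ⟨g, rfl⟩ := ((C j).mem_graph_iff hx).1 hbh
      rw [hzero hx hb rfl]
      exact smul_zero g
    exact not_dimGe_of_subsingleton (m := 0) (Set.subsingleton_singleton.anti hSsub)
      (hmain.of_le (by omega))
  have hScone : ∀ c : k, c ≠ 0 → ∀ h ∈ S, c • h ∈ S := by
    rintro c hc h ⟨b, hb, hbh⟩
    obtain ⟨x, hx, rfl⟩ := hZO hb
    refine ⟨_, hb, ((C j).mem_graph_iff hx).2 ?_⟩
    have h1 := smul_mem_orbit h hc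
    rwa [MulAction.orbit_eq_iff.2 (((C j).mem_graph_iff hx).1 hbh)] at h1
  have hproj := (le_dim_projectivization_cone hSc hScone (m := d + m - i - 1)).2
    (hmain.of_le (by omega))
  -- In projective space the orbits have dimension `m - 1`. Both this and the dimension of `S` drop
  -- by one, so the difference is again `d - i`.
  have hsub : {p : ℙ k (HomSpace k P r I) | p.rep ∈ S} ⊆ canonicalStratum k P r I (m - 1) := by
    rintro p ⟨b, hb, hbp⟩
    obtain ⟨x, hx, rfl⟩ := hZO hb
    have hp := ((C j).mem_graph_iff hx).1 hbp
    refine ⟨isComplex_of_mem_orbit hp (hcls x), ?_⟩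
    rw [withBot_le_iff_not_succ_le, le_dim_orbit_iff, MulAction.orbit_eq_iff.2 hp, ← hgraph hx,
      Nat.sub_add_cancel (Nat.one_le_iff_ne_zero.2 hmpos)]
    exact hb.2.2
  have h1 := le_sSup_excesses (bound_dim_projectivization k (HomSpace k P r I))
    (S := canonicalStratum k P r I) (hproj.trans (topologicalKrullDim_mono hsub))
  have h2 : (((d + m - i - 1 : ℕ) : ℤ) - ((m - 1 : ℕ) : ℤ)) = (d : ℤ) - i := by omega
  rw [h2] at h1
  exact h1

end ParInequality

/-! ### Sections of quasi-coherent sheaves over basic open sets. -/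

section QuasiCoherent

variable {X : Scheme.{u}} {U : X.Opens} (hU : IsAffineOpen U) (M : X.Modules)

theorem fromSpec_image_le (W : (Spec Γ(X, U)).Opens) : hU.fromSpec ''ᵁ W ≤ U := by
  rintro _ ⟨y, -, rfl⟩
  have h : hU.fromSpec y ∈ (U : Set X) := hU.range_fromSpec ▸ Set.mem_range_self y
  exact h

theorem appIso_inv_fromSpec (W : (Spec Γ(X, U)).Opens) :
    (Scheme.ΓSpecIso Γ(X, U)).inv ≫ (Spec Γ(X, U)).presheaf.map W.leTop.op ≫
      (hU.fromSpec.appIso W).inv = X.presheaf.map (homOfLE (fromSpec_image_le hU W)).op := by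
  rw [← Category.assoc, Iso.comp_inv_eq, Scheme.Hom.appIso_hom', Scheme.Hom.map_appLE,
    Scheme.Hom.appLE, hU.fromSpec_app_self, Category.assoc, ← Functor.map_comp]
  rfl

/-- Compares the scalars of the restriction to the spectrum of `Γ(X, U)`, where sections over basic
open sets are localizations, with restricted functions on `X`. -/
theorem restrictAppIso_smul_fromSpec (W : (Spec Γ(X, U)).Opens) (a : Γ(X, U))
    (m : Γ(M.restrict hU.fromSpec, W)) :
    (M.restrictAppIso hU.fromSpec W).hom (a • m) =
      X.presheaf.map (homOfLE (fromSpec_image_le hU W)).op a •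
        (M.restrictAppIso hU.fromSpec W).hom m := by
  rw [Scheme.Modules.smul_Spec_def, Scheme.Modules.smul_restrictAppIso_hom_apply,
    ← appIso_inv_fromSpec]
  rfl

variable [M.IsQuasicoherent]

theorem isLocalizedModule_fromSpec (g : Γ(X, U)) :
    IsLocalizedModule (.powers g)
      ((modulesSpecToSheaf.obj (M.restrict hU.fromSpec)).obj.map
        (PrimeSpectrum.basicOpen g).leTop.op).hom :=
  (isIso_fromTildeΓ_iff_isLocalizing (M.restrict hU.fromSpec)).1 inferInstance g

theorem exists_pow_smul_eq_map_fromSpec (g : Γ(X, U)) (W : (Spec Γ(X, U)).Opens)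
    (hW : W = PrimeSpectrum.basicOpen g) (t : Γ(M.restrict hU.fromSpec, W)) :
    ∃ (n : ℕ) (m : Γ(M.restrict hU.fromSpec, ⊤)),
      g ^ n • t = (M.restrict hU.fromSpec).presheaf.map W.leTop.op m := by
  subst hW
  obtain ⟨⟨m, ⟨_, n, rfl⟩⟩, h⟩ := (isLocalizedModule_fromSpec hU M g).surj t
  exact ⟨n, m, h⟩

theorem exists_pow_smul_eq_zero_fromSpec (g : Γ(X, U)) (W : (Spec Γ(X, U)).Opens)
    (hW : W = PrimeSpectrum.basicOpen g) (m : Γ(M.restrict hU.fromSpec, ⊤))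
    (hm : (M.restrict hU.fromSpec).presheaf.map W.leTop.op m = 0) :
    ∃ n : ℕ, g ^ n • m = 0 := by
  subst hW
  obtain ⟨⟨_, n, rfl⟩, h⟩ := (isLocalizedModule_fromSpec hU M g).exists_of_eq
    (x₁ := m) (x₂ := (0 : Γ(M.restrict hU.fromSpec, ⊤))) (hm.trans (map_zero _).symm)
  have h' : g ^ n • m = g ^ n • (0 : Γ(M.restrict hU.fromSpec, ⊤)) := h
  exact ⟨n, h'.trans (smul_zero _)⟩

end QuasiCoherent

/-! ### Stalks of coherent sheaves by clearing denominators. -/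

namespace ASheaf

variable {k : Type u} [Field k] {X : Scheme.{u}} {f : X ⟶ Spec (.of k)} {A : Type v} [Ring A]
  [Algebra k A] (F : ASheaf f A) {U : X.Opens} {x : X} (hx : x ∈ U)

theorem isUnit_germ {g : Γ(X, U)} (hg : x ∈ X.basicOpen g) :
    IsUnit (AComplex.germ f x U hx g) := (X.mem_basicOpen g x hx).1 hg

/-- A germ is defined on some basic open set `D(g)` around `x`; by quasi-coherence a power of `g`
times it extends to `U`, and `g` is a unit at `x`. -/
theorem exists_isUnit_smul_eq_germ (hU : IsAffineOpen U) (hF : F.IsCoherent) (t : F.Stalk x) :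
    ∃ (a : Γ(X, U)) (m : Γ(F.sheaf, U)), IsUnit (AComplex.germ f x U hx a) ∧
      AComplex.germ f x U hx a • t = F.germ x U hx m := by
  have := hF.1
  obtain ⟨V, hV, s, rfl⟩ := F.exists_germ_eq x t
  obtain ⟨g, hgV, hxg⟩ := hU.exists_basicOpen_le ⟨x, hV⟩ hx
  let W : (Spec Γ(X, U)).Opens := PrimeSpectrum.basicOpen g
  have hW : hU.fromSpec ''ᵁ W = X.basicOpen g := hU.fromSpec_image_basicOpen g
  have hxW : x ∈ hU.fromSpec ''ᵁ W := hW.symm ▸ hxg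
  have hWV : hU.fromSpec ''ᵁ W ≤ V := hW.trans_le hgV
  let t' : Γ(F.sheaf.restrict hU.fromSpec, W) :=
    (F.sheaf.restrictAppIso hU.fromSpec W).inv (F.sheaf.presheaf.map (homOfLE hWV).op s)
  obtain ⟨n, m', hm'⟩ := exists_pow_smul_eq_map_fromSpec hU F.sheaf g W rfl t'
  have h1 := congrArg (F.sheaf.restrictAppIso hU.fromSpec W).hom hm'
  rw [restrictAppIso_smul_fromSpec, Iso.inv_hom_id_apply] at h1
  have h2 : (F.sheaf.restrictAppIso hU.fromSpec W).hom
      ((F.sheaf.restrict hU.fromSpec).presheaf.map W.leTop.op m') =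
      F.sheaf.presheaf.map (hU.fromSpec.opensFunctor.map W.leTop).op
        ((F.sheaf.restrictAppIso hU.fromSpec ⊤).hom m') := rfl
  have hUtop : U ≤ hU.fromSpec ''ᵁ ⊤ := by
    intro y hy
    have h : y ∈ Set.range hU.fromSpec := hU.range_fromSpec ▸ hy
    obtain ⟨z, rfl⟩ := h
    exact ⟨z, trivial, rfl⟩
  refine ⟨g ^ n, F.sheaf.presheaf.map (homOfLE hUtop).op
    ((F.sheaf.restrictAppIso hU.fromSpec ⊤).hom m'), ?_, ?_⟩
  · rw [map_pow]
    exact (isUnit_germ hx hxg).pow n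
  · have h3 := congrArg (F.germ x _ hxW) (h1.trans h2)
    rw [F.germ_smul, F.germ_res, F.germ_res] at h3
    rw [F.germ_res]
    refine Eq.trans ?_ h3
    congr 1
    exact (X.presheaf.germ_res_apply (homOfLE (fromSpec_image_le hU W)) x hxW (g ^ n)).symm

theorem exists_isUnit_smul_eq_zero (hU : IsAffineOpen U) (hF : F.IsCoherent) (m : Γ(F.sheaf, U))
    (hm : F.germ x U hx m = 0) :
    ∃ a : Γ(X, U), IsUnit (AComplex.germ f x U hx a) ∧ a • m = 0 := by
  have := hF.1
  obtain ⟨V, hV, i, j, hij⟩ := F.sheaf.presheaf.germ_eq x hx hx m 0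
    (hm.trans (map_zero (F.germ x U hx)).symm)
  obtain ⟨g, hgV, hxg⟩ := hU.exists_basicOpen_le ⟨x, hV⟩ hx
  let W : (Spec Γ(X, U)).Opens := PrimeSpectrum.basicOpen g
  have hW : hU.fromSpec ''ᵁ W = X.basicOpen g := hU.fromSpec_image_basicOpen g
  have hWV : hU.fromSpec ''ᵁ W ≤ V := hW.trans_le hgV
  have hUtop : U ≤ hU.fromSpec ''ᵁ ⊤ := by
    intro y hy
    have h : y ∈ Set.range hU.fromSpec := hU.range_fromSpec ▸ hy
    obtain ⟨z, rfl⟩ := h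
    exact ⟨z, trivial, rfl⟩
  let m' : Γ(F.sheaf.restrict hU.fromSpec, ⊤) :=
    (F.sheaf.restrictAppIso hU.fromSpec ⊤).inv
      (F.sheaf.presheaf.map (homOfLE (fromSpec_image_le hU ⊤)).op m)
  have hm' : (F.sheaf.restrict hU.fromSpec).presheaf.map W.leTop.op m' = 0 := by
    change F.sheaf.presheaf.map (hU.fromSpec.opensFunctor.map W.leTop).op
      (F.sheaf.presheaf.map (homOfLE (fromSpec_image_le hU ⊤)).op m) = 0
    rw [← ConcreteCategory.comp_apply, ← Functor.map_comp]
    have h3 := congrArg (F.sheaf.presheaf.map (homOfLE hWV).op) hij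
    rw [map_zero, map_zero, ← ConcreteCategory.comp_apply, ← Functor.map_comp] at h3
    exact h3
  obtain ⟨n, hn⟩ := exists_pow_smul_eq_zero_fromSpec hU F.sheaf g W rfl m' hm'
  refine ⟨g ^ n, ?_, ?_⟩
  · rw [map_pow]
    exact (isUnit_germ hx hxg).pow n
  · have h1 := congrArg (F.sheaf.restrictAppIso hU.fromSpec ⊤).hom hn
    rw [restrictAppIso_smul_fromSpec, Iso.inv_hom_id_apply, map_zero] at h1
    have h2 := congrArg (F.sheaf.presheaf.map (homOfLE hUtop).op) h1
    rw [map_zero, Scheme.Modules.map_smul, ← ConcreteCategory.comp_apply,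
      ← ConcreteCategory.comp_apply, ← Functor.map_comp, ← Functor.map_comp] at h2
    have h4 : (homOfLE (fromSpec_image_le hU ⊤)).op ≫ (homOfLE hUtop).op = 𝟙 (Opposite.op U) :=
      Subsingleton.elim _ _
    rw [h4, CategoryTheory.Functor.map_id, CategoryTheory.Functor.map_id] at h2
    exact h2

end ASheaf

/-! ### Closed points of an affine open set as points of affine space. -/

section AffineCoordinates

variable {k : Type u} [Field k] {X : Scheme.{u}}

theorem mem_primeIdealOf_iff (f : X ⟶ Spec (.of k)) {U : X.Opens} (hU : IsAffineOpen U) {x : X}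
    (hx : x ∈ U) (r : Γ(X, U)) :
    r ∈ (hU.primeIdealOf ⟨x, hx⟩).asIdeal ↔
      germ f x U hx r ∈ IsLocalRing.maximalIdeal (LocalRing f x) := by
  rw [hU.primeIdealOf_eq_map_closedPoint]
  rfl

theorem germ_notMem_iff (f : X ⟶ Spec (.of k)) {U : X.Opens} {x : X}
    (hx : x ∈ U) (r : Γ(X, U)) :
    germ f x U hx r ∉ IsLocalRing.maximalIdeal (LocalRing f x) ↔ x ∈ X.basicOpen r := by
  rw [X.mem_basicOpen r x hx, IsLocalRing.mem_maximalIdeal, mem_nonunits_iff, not_not]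
  rfl

/-- Coordinates on an affine open subset `U`: a surjection of `k`-algebras from a polynomial ring
onto `Γ(X, U)`. -/
structure AffineCoordinates (f : X ⟶ Spec (.of k)) (U : X.Opens) where
  isAffineOpen : IsAffineOpen U
  dim : ℕ
  hom : MvPolynomial (Fin dim) k →+* Γ(X, U)
  hom_C (c : k) : hom (MvPolynomial.C c) = scalar f U c
  surjective : Function.Surjective hom

theorem scalar_finiteType (f : X ⟶ Spec (.of k)) [LocallyOfFiniteType f] {U : X.Opens}
    (hU : IsAffineOpen U) : (scalar f U).FiniteType := by
  have h := LocallyOfFiniteType.finiteType_appLE f (isAffineOpen_top (Spec (.of k))) hU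
    (fun _ _ => trivial)
  have h2 : scalar f U = (f.appLE ⊤ U (fun _ _ => trivial)).hom.comp
      (Scheme.ΓSpecIso (.of k)).inv.hom := by
    rfl
  rw [h2]
  refine h.comp (RingHom.FiniteType.of_surjective _ ?_)
  exact (ConcreteCategory.bijective_of_isIso (Scheme.ΓSpecIso (.of k)).inv).2

theorem nonempty_affineCoordinates (f : X ⟶ Spec (.of k)) [LocallyOfFiniteType f] {U : X.Opens}
    (hU : IsAffineOpen U) : Nonempty (AffineCoordinates f U) := by
  let _ := (scalar f U).toAlgebra
  have h : Algebra.FiniteType k Γ(X, U) := scalar_finiteType f hU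
  obtain ⟨n, g, hg⟩ := Algebra.FiniteType.iff_quotient_mvPolynomial''.1 h
  exact ⟨⟨hU, n, g.toRingHom, fun c => g.commutes c, hg⟩⟩

namespace AffineCoordinates

variable {f : X ⟶ Spec (.of k)} {U : X.Opens} (c : AffineCoordinates f U)

/-- The closed subset of affine space with coordinate ring `Γ(X, U)` modulo nilpotents. -/
def zeros : Set (Fin c.dim → k) := {b | ∀ p : RingHom.ker c.hom, MvPolynomial.eval b p.1 = 0}

theorem isCons_zeros : IsCons k c.zeros := isCons_forall_eval _

variable [IsAlgClosed k]

theorem exists_point {x : X} (hx : x ∈ U) (hcl : IsClosed {x}) :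
    ∃ b : Fin c.dim → k, ∀ p, MvPolynomial.eval b p = 0 ↔
      germ f x U hx (c.hom p) ∈ IsLocalRing.maximalIdeal (LocalRing f x) := by
  have hm := c.isAffineOpen.primeIdealOf_isMaximal_of_isClosed ⟨x, hx⟩ hcl
  have hm' := Ideal.comap_isMaximal_of_surjective c.hom c.surjective (H := hm)
  obtain ⟨b, hb⟩ := exists_pointToPoint_of_isMaximal
    (P := PrimeSpectrum.comap c.hom (c.isAffineOpen.primeIdealOf ⟨x, hx⟩)) hm'
  refine ⟨b, fun p => ?_⟩
  rw [← mem_pointToPoint_iff, hb, ← mem_primeIdealOf_iff f c.isAffineOpen hx]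
  rfl

open Classical in
/-- The coordinates of a closed point of `U`. -/
def point (x : closedPoints X) : Fin c.dim → k :=
  if hx : x.1 ∈ U then (c.exists_point hx x.2).choose else 0

theorem eval_point_eq_zero_iff {x : closedPoints X} (hx : x.1 ∈ U) (p : MvPolynomial (Fin c.dim) k) :
    MvPolynomial.eval (c.point x) p = 0 ↔
      germ f x.1 U hx (c.hom p) ∈ IsLocalRing.maximalIdeal (LocalRing f x.1) := by
  rw [point, dif_pos hx]
  exact (c.exists_point hx x.2).choose_spec p

theorem germ_sub_eval_mem {x : closedPoints X} (hx : x.1 ∈ U) (p : MvPolynomial (Fin c.dim) k) :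
    germ f x.1 U hx (c.hom p) - algebraMap k (LocalRing f x.1) (MvPolynomial.eval (c.point x) p) ∈
      IsLocalRing.maximalIdeal (LocalRing f x.1) := by
  rw [← germ_scalar f x.1 U hx, ← c.hom_C, ← map_sub, ← map_sub, ← c.eval_point_eq_zero_iff hx]
  simp

theorem point_mem_zeros {x : closedPoints X} (hx : x.1 ∈ U) : c.point x ∈ c.zeros := by
  rintro ⟨p, hp⟩
  rw [c.eval_point_eq_zero_iff hx, RingHom.mem_ker.1 hp, map_zero]
  exact Ideal.zero_mem _

theorem eval_point_ne_zero_iff {x : closedPoints X} (hx : x.1 ∈ U) (p : MvPolynomial (Fin c.dim) k) :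
    MvPolynomial.eval (c.point x) p ≠ 0 ↔ x.1 ∈ X.basicOpen (c.hom p) := by
  rw [← germ_notMem_iff f hx, ← c.eval_point_eq_zero_iff hx]

/-- Basic open sets of `U` correspond to non-vanishing loci of polynomials, so the map induces the
topology; injectivity follows because the space of closed points is T0. -/
theorem isChart : IsChart k {x : closedPoints X | x.1 ∈ U} c.point where
  isOpen := U.2.preimage continuous_subtype_val
  isEmbedding := by
    let _ := zariski k (Fin c.dim → k)
    have hind : Topology.IsInducing
        fun x : {x : closedPoints X | x.1 ∈ U} => c.point x.1 := by
      have hpre (p : MvPolynomial (Fin c.dim) k) :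
          (fun x : {x : closedPoints X | x.1 ∈ U} => c.point x.1) ⁻¹'
            {b | MvPolynomial.eval b p ≠ 0} = {x | x.1.1 ∈ X.basicOpen (c.hom p)} :=
        Set.ext fun x => c.eval_point_ne_zero_iff x.2 p
      have hcont : Continuous fun x : {x : closedPoints X | x.1 ∈ U} => x.1.1 := by fun_prop
      refine ⟨le_antisymm ?_ fun S hS => ?_⟩
      · rw [← continuous_iff_le_induced]
        refine continuous_generateFrom_iff.2 ?_
        rintro _ ⟨g, hg, rfl⟩
        obtain ⟨p, hp⟩ := mem_polyFun_pi_iff.1 hg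
        simp only [hp]
        rw [hpre]
        exact (X.basicOpen (c.hom p)).2.preimage hcont
      · let τ := TopologicalSpace.induced (fun x : {x : closedPoints X | x.1 ∈ U} => c.point x.1)
          (zariski k (Fin c.dim → k))
        refine (@isOpen_iff_forall_mem_open _ τ S).2 fun x hxS => ?_
        obtain ⟨S', hS', rfl⟩ := isOpen_induced_iff.1 hS
        obtain ⟨S'', hS'', rfl⟩ := isOpen_induced_iff.1 hS'
        obtain ⟨g, hgV, hxg⟩ := c.isAffineOpen.exists_basicOpen_le (V := ⟨S'', hS''⟩)
          ⟨x.1.1, hxS⟩ x.2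
        obtain ⟨p, rfl⟩ := c.surjective g
        refine ⟨_, ?_, ?_, (hpre p).ge hxg⟩
        · exact ((hpre p).le).trans fun y hy => hgV hy
        · exact isOpen_induced_iff.2 ⟨_, TopologicalSpace.isOpen_generateFrom_of_mem
            ⟨_, eval_mem_polyFun p, rfl⟩, rfl⟩
    exact ⟨hind, hind.injective⟩

variable [LocallyOfFiniteType f]

/-- The maximal ideal of `b` contains the kernel of the coordinate map, so its image is a maximal
ideal of `Γ(X, U)`. The corresponding closed point of the affine open set is closed in `X` because
`X` is a Jacobson space. -/
theorem exists_point_eq {b : Fin c.dim → k} (hb : b ∈ c.zeros) :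
    ∃ x : closedPoints X, x.1 ∈ U ∧ c.point x = b := by
  have hJ : JacobsonSpace X := LocallyOfFiniteType.jacobsonSpace f
  have hU := c.isAffineOpen
  have hsurj : Function.Surjective (MvPolynomial.eval b) := fun r => ⟨MvPolynomial.C r, by simp⟩
  have hmax : (RingHom.ker (MvPolynomial.eval b)).IsMaximal :=
    RingHom.ker_isMaximal_of_surjective _ hsurj
  have hcomap : Ideal.comap c.hom (Ideal.map c.hom (RingHom.ker (MvPolynomial.eval b))) =
      RingHom.ker (MvPolynomial.eval b) := by
    rw [Ideal.comap_map_of_surjective _ c.surjective, sup_eq_left]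
    exact fun p hp => hb ⟨p, hp⟩
  have hq : (Ideal.map c.hom (RingHom.ker (MvPolynomial.eval b))).IsMaximal := by
    refine (Ideal.map_eq_top_or_isMaximal_of_surjective c.hom c.surjective hmax).resolve_left ?_
    intro h
    rw [h, Ideal.comap_top] at hcomap
    exact hmax.ne_top hcomap.symm
  let y : Spec Γ(X, U) := ⟨_, hq.isPrime⟩
  have hy : y ∈ closedPoints (Spec Γ(X, U)) :=
    (PrimeSpectrum.isClosed_singleton_iff_isMaximal _).2 hq
  have hx : hU.fromSpec y ∈ closedPoints X := by
    rw [← hU.fromSpec.isOpenEmbedding.preimage_closedPoints] at hy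
    exact hy
  have hxU : hU.fromSpec y ∈ U := by
    have h : hU.fromSpec y ∈ (U : Set X) := hU.range_fromSpec ▸ Set.mem_range_self y
    exact h
  refine ⟨⟨_, hx⟩, hxU, ?_⟩
  have hprime : hU.primeIdealOf ⟨_, hxU⟩ = y :=
    hU.fromSpec.isOpenEmbedding.injective (hU.fromSpec_primeIdealOf _)
  have key (p : MvPolynomial (Fin c.dim) k) :
      MvPolynomial.eval (c.point ⟨_, hx⟩) p = 0 ↔ MvPolynomial.eval b p = 0 := by
    rw [c.eval_point_eq_zero_iff hxU, ← mem_primeIdealOf_iff f hU hxU, hprime,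
      ← RingHom.mem_ker, ← hcomap]
    rfl
  funext i
  have h := (key (MvPolynomial.X i - MvPolynomial.C (b i))).2 (by simp)
  simpa [sub_eq_zero] using h

end AffineCoordinates

end AffineCoordinates

/-! ### Values of sections in the fibres and the relations between them. -/

theorem smul_sub_smul_mem_smul_top {R M : Type*} [CommRing R] [AddCommGroup M] [Module R M]
    {I : Ideal R} {r e : R} (h : r - e ∈ I) (t : M) :
    r • t - e • t ∈ (I • ⊤ : Submodule R M) := by
  rw [← sub_smul]
  exact Submodule.smul_mem_smul h trivial

namespace ASheaf

section FibreGerm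

variable {k : Type u} [Field k] {X : Scheme.{u}} {f : X ⟶ Spec (.of k)} {A : Type v} [Ring A]
  [Algebra k A] (F : ASheaf f A) {G : ASheaf f A} {U : X.Opens}

/-- The value of a section in the fibre at `x`. -/
def fibreGerm {x : X} (hx : x ∈ U) : Γ(F.sheaf, U) →+ F.Fibre x :=
  (F.maximalSubmodule x).mkQ.toAddMonoidHom.comp (F.germ x U hx)

theorem smul_fibreGerm {x : X} (hx : x ∈ U) (a : A) (m : Γ(F.sheaf, U)) :
    a • F.fibreGerm hx m = F.fibreGerm hx ((F.act a).app U m) := by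
  change (F.maximalSubmodule x).mkQ (a • F.germ x U hx m) = _
  rw [smul_def, stalkHom_germ]
  rfl

variable {F} in
theorem Hom.fibreMap_fibreGerm (φ : Hom F G) {x : X} (hx : x ∈ U) (m : Γ(F.sheaf, U)) :
    φ.fibreMap x (F.fibreGerm hx m) = G.fibreGerm hx (φ.hom.app U m) := by
  change (G.maximalSubmodule x).mkQ (stalkHom x φ.hom (F.germ x U hx m)) = _
  rw [stalkHom_germ]
  rfl

theorem mkQ_smul_of_sub_mem {x : X} {r : LocalRing f x} {e : k}
    (h : r - algebraMap k _ e ∈ IsLocalRing.maximalIdeal (LocalRing f x)) (t : F.Stalk x) :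
    (F.maximalSubmodule x).mkQ (r • t) = e • (F.maximalSubmodule x).mkQ t := by
  have h2 := smul_sub_smul_mem_smul_top h t
  exact (Submodule.Quotient.eq (F.maximalSubmodule x)).2 h2

variable [IsAlgClosed k] (c : AffineCoordinates f U) {x : closedPoints X} (hx : x.1 ∈ U)

theorem mkQ_germ_smul (p : MvPolynomial (Fin c.dim) k) (t : F.Stalk x.1) :
    (F.maximalSubmodule x.1).mkQ (AComplex.germ f x.1 U hx (c.hom p) • t) =
      MvPolynomial.eval (c.point x) p • (F.maximalSubmodule x.1).mkQ t :=
  F.mkQ_smul_of_sub_mem (c.germ_sub_eval_mem hx p) t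

theorem fibreGerm_smul (p : MvPolynomial (Fin c.dim) k) (m : Γ(F.sheaf, U)) :
    F.fibreGerm hx (c.hom p • m) = MvPolynomial.eval (c.point x) p • F.fibreGerm hx m := by
  refine Eq.trans ?_ (F.mkQ_germ_smul c hx p (F.germ x.1 U hx m))
  rw [← F.germ_smul]
  rfl

theorem fibreGerm_sum_smul {N : ℕ} (p : Fin N → MvPolynomial (Fin c.dim) k)
    (m : Fin N → Γ(F.sheaf, U)) :
    F.fibreGerm hx (∑ j, c.hom (p j) • m j) =
      ∑ j, MvPolynomial.eval (c.point x) (p j) • F.fibreGerm hx (m j) := by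
  rw [map_sum]
  exact Finset.sum_congr rfl fun j _ => F.fibreGerm_smul c hx _ _

theorem isUnit_germ_iff (p : MvPolynomial (Fin c.dim) k) :
    IsUnit (AComplex.germ f x.1 U hx (c.hom p)) ↔ MvPolynomial.eval (c.point x) p ≠ 0 := by
  rw [Ne, c.eval_point_eq_zero_iff hx, IsLocalRing.mem_maximalIdeal, mem_nonunits_iff, not_not]

variable {c} {N : ℕ} {m : Fin N → Γ(F.sheaf, U)}

set_option linter.unusedSectionVars false in
theorem exists_coefficients (hm : Submodule.span Γ(X, U) (Set.range m) = ⊤)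
    (s : Γ(F.sheaf, U)) : ∃ p : Fin N → MvPolynomial (Fin c.dim) k, ∑ j, c.hom (p j) • m j = s := by
  obtain ⟨a, ha⟩ := (Submodule.mem_span_range_iff_exists_fun Γ(X, U)).1
    (hm.ge (Submodule.mem_top (x := s)))
  choose p hp using fun j => c.surjective (a j)
  exact ⟨p, by simp only [hp, ha]⟩

theorem exists_smul_eq_germ_sum (hF : F.IsCoherent)
    (hm : Submodule.span Γ(X, U) (Set.range m) = ⊤) (t : F.Stalk x.1) :
    ∃ (p : MvPolynomial (Fin c.dim) k) (q : Fin N → MvPolynomial (Fin c.dim) k),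
      MvPolynomial.eval (c.point x) p ≠ 0 ∧ AComplex.germ f x.1 U hx (c.hom p) • t =
        F.germ x.1 U hx (∑ j, c.hom (q j) • m j) := by
  obtain ⟨a, s, ha, h⟩ := F.exists_isUnit_smul_eq_germ hx c.isAffineOpen hF t
  obtain ⟨p, rfl⟩ := c.surjective a
  obtain ⟨q, rfl⟩ := F.exists_coefficients (c := c) hm s
  exact ⟨p, q, (isUnit_germ_iff c hx p).1 ha, h⟩

/-- A germ becomes a combination of the generators after multiplication by a function that is a unit
at `x`, and in the fibre this function acts as a non-zero scalar. -/
theorem span_fibreGerm (hF : F.IsCoherent) (hm : Submodule.span Γ(X, U) (Set.range m) = ⊤)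
    (c : AffineCoordinates f U) :
    Submodule.span k (Set.range fun j => F.fibreGerm hx (m j)) = ⊤ := by
  refine eq_top_iff.2 fun v _ => ?_
  obtain ⟨t, rfl⟩ := (F.maximalSubmodule x.1).mkQ_surjective v
  obtain ⟨p, q, hp, h⟩ := F.exists_smul_eq_germ_sum (c := c) hx hF hm t
  rw [← Submodule.smul_mem_iff _ hp, ← F.mkQ_germ_smul c hx, h]
  change F.fibreGerm hx _ ∈ _
  rw [F.fibreGerm_sum_smul]
  exact Submodule.sum_mem _ fun j _ => Submodule.smul_mem _ _ (Submodule.subset_span ⟨j, rfl⟩)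

theorem exists_smul_eq_of_mem (hF : F.IsCoherent)
    (hm : Submodule.span Γ(X, U) (Set.range m) = ⊤) (c : AffineCoordinates f U) {t : F.Stalk x.1}
    (ht : t ∈ (IsLocalRing.maximalIdeal (LocalRing f x.1) • ⊤ :
      Submodule (LocalRing f x.1) (F.Stalk x.1))) :
    ∃ (p : MvPolynomial (Fin c.dim) k) (q : Fin N → MvPolynomial (Fin c.dim) k),
      MvPolynomial.eval (c.point x) p ≠ 0 ∧ (∀ j, MvPolynomial.eval (c.point x) (q j) = 0) ∧
      AComplex.germ f x.1 U hx (c.hom p) • t = F.germ x.1 U hx (∑ j, c.hom (q j) • m j) := by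
  induction ht using Submodule.smul_induction_on' with
  | smul r hr t _ =>
    obtain ⟨p, q, hp, h⟩ := F.exists_smul_eq_germ_sum (c := c) hx hF hm t
    obtain ⟨a, s, hs, has⟩ : ∃ a s : Γ(X, U), IsUnit (AComplex.germ f x.1 U hx s) ∧
        AComplex.germ f x.1 U hx s * r = AComplex.germ f x.1 U hx a := by
      let _ := TopCat.Presheaf.algebra_section_stalk X.presheaf ⟨x.1, hx⟩
      have hloc := c.isAffineOpen.isLocalization_stalk ⟨x.1, hx⟩
      obtain ⟨⟨a, s⟩, h⟩ := IsLocalization.surj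
        (M := (c.isAffineOpen.primeIdealOf ⟨x.1, hx⟩).asIdeal.primeCompl)
        (S := X.presheaf.stalk x.1) r
      exact ⟨a, s, IsLocalization.map_units (X.presheaf.stalk x.1) s, (mul_comm _ _).trans h⟩
    obtain ⟨a, rfl⟩ := c.surjective a
    obtain ⟨s, rfl⟩ := c.surjective s
    refine ⟨s * p, fun j => a * q j, ?_, fun j => ?_, ?_⟩
    · rw [map_mul]
      exact mul_ne_zero ((isUnit_germ_iff c hx s).1 hs) hp
    · rw [map_mul, (c.eval_point_eq_zero_iff hx a).2, zero_mul]
      rw [← has]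
      exact Ideal.mul_mem_left _ _ hr
    · rw [map_mul, map_mul, smul_smul, mul_right_comm, has, ← smul_smul, h, ← F.germ_smul,
        Finset.smul_sum]
      simp only [map_mul, smul_smul]
  | add t _ t' _ ht ht' =>
    obtain ⟨p, q, hp, hq, h⟩ := ht
    obtain ⟨p', q', hp', hq', h'⟩ := ht'
    refine ⟨p * p', fun j => p' * q j + p * q' j, ?_, fun j => ?_, ?_⟩
    · rw [map_mul]
      exact mul_ne_zero hp hp'
    · simp [hq, hq']
    · rw [map_mul, map_mul, smul_add, mul_smul _ _ t', h', mul_comm, mul_smul, h, ← F.germ_smul,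
        ← F.germ_smul, ← map_add, Finset.smul_sum, Finset.smul_sum, ← Finset.sum_add_distrib]
      simp only [map_mul, map_add, smul_smul, add_smul]

/-- Every linear relation between the values of the generators at `x` is, up to a non-zero scalar,
the value of a relation between the sections themselves. Hence the relations over `U`, evaluated at
`x`, present the fibre exactly. -/
theorem exists_relation (hF : F.IsCoherent)
    (hm : Submodule.span Γ(X, U) (Set.range m) = ⊤) (c : AffineCoordinates f U) {α : Fin N → k}
    (hα : ∑ j, α j • F.fibreGerm hx (m j) = 0) :
    ∃ (p : Fin N → MvPolynomial (Fin c.dim) k) (e : k), ∑ j, c.hom (p j) • m j = 0 ∧ e ≠ 0 ∧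
      ∀ j, MvPolynomial.eval (c.point x) (p j) = e * α j := by
  have h : F.fibreGerm hx (∑ j, c.hom (.C (α j)) • m j) = 0 := by
    rw [F.fibreGerm_sum_smul]
    simpa using hα
  obtain ⟨p, q, hp, hq, hpq⟩ := F.exists_smul_eq_of_mem hx hF hm c
    ((Submodule.Quotient.mk_eq_zero _).1 h)
  rw [← F.germ_smul, ← sub_eq_zero, ← map_sub] at hpq
  obtain ⟨a, ha, h0⟩ := F.exists_isUnit_smul_eq_zero hx c.isAffineOpen hF _ hpq
  obtain ⟨a, rfl⟩ := c.surjective a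
  refine ⟨fun j => a * (p * .C (α j) - q j), MvPolynomial.eval (c.point x) (a * p), ?_, ?_, ?_⟩
  · rw [← h0, Finset.smul_sum, ← Finset.sum_sub_distrib, Finset.smul_sum]
    simp only [map_mul, map_sub, sub_smul, mul_smul, smul_sub]
  · rw [map_mul]
    exact mul_ne_zero ((isUnit_germ_iff c hx a).1 ha) hp
  · intro j
    simp [hq, mul_assoc]

end FibreGerm

end ASheaf

/-! ### Isomorphisms of modules given by generators and relations. -/

section Presentations

variable {k : Type u} [Field k] {A : Type v} [Ring A] [Algebra k A]

theorem map_sum_smul_of_tower {V Q : Type*} [AddCommGroup V] [AddCommGroup Q] [Module A V]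
    [Module A Q] [Module k V] [Module k Q] [IsScalarTower k A V] [IsScalarTower k A Q]
    (E : V →ₗ[A] Q) {N : ℕ} (α : Fin N → k) (m : Fin N → V) :
    E (∑ j, α j • m j) = ∑ j, α j • E (m j) := by
  rw [map_sum]
  exact Finset.sum_congr rfl fun j _ => E.map_smul_of_tower _ _

theorem span_map_eq_top {V Q : Type*} [AddCommGroup V] [AddCommGroup Q] [Module A V]
    [Module A Q] [Module k V] [Module k Q] [IsScalarTower k A V] [IsScalarTower k A Q]
    (E : V ≃ₗ[A] Q) {N : ℕ} {m : Fin N → V} (hm : Submodule.span k (Set.range m) = ⊤) :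
    Submodule.span k (Set.range fun j => E (m j)) = ⊤ := by
  have h : (Set.range fun j => E (m j)) = (E.restrictScalars k).toLinearMap '' Set.range m :=
    Set.range_comp _ _
  rw [h, Submodule.span_image, hm, Submodule.map_top]
  exact LinearMap.range_eq_top.2 E.surjective

/-- The relations make the assignment on generators a well defined surjective homomorphism. It is
injective because `e` shows that both modules have the same finite dimension. -/
theorem exists_linearEquiv_of_relations {V Q : Type*} [AddCommGroup V] [AddCommGroup Q] [Module A V]
    [Module A Q] [Module k V] [Module k Q] [IsScalarTower k A V] [IsScalarTower k A Q]
    [FiniteDimensional k Q] (e : V ≃ₗ[A] Q) {N : ℕ} {m : Fin N → V} {ψ : Fin N → Q}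
    (hm : Submodule.span k (Set.range m) = ⊤) (hψ : Submodule.span k (Set.range ψ) = ⊤)
    (hrel : ∀ α : Fin N → k, ∑ j, α j • m j = 0 → ∑ j, α j • ψ j = 0)
    (hact : ∀ (a : A) (j : Fin N), ∃ α : Fin N → k,
      a • m j = ∑ i, α i • m i ∧ a • ψ j = ∑ i, α i • ψ i) :
    ∃ E : V ≃ₗ[A] Q, ∀ j, E (m j) = ψ j := by
  let Φ := Fintype.linearCombination k m
  let Ψ := Fintype.linearCombination k ψ
  have hΦ : LinearMap.range Φ = ⊤ := (Fintype.range_linearCombination k m).trans hm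
  have hΨ : LinearMap.range Ψ = ⊤ := (Fintype.range_linearCombination k ψ).trans hψ
  obtain ⟨S, hS⟩ := Φ.exists_rightInverse_of_surjective hΦ
  let E₀ : V →ₗ[k] Q := Ψ ∘ₗ S
  have hE (α : Fin N → k) : E₀ (Φ α) = Ψ α := by
    have h1 : Φ (S (Φ α) - α) = 0 := by
      rw [map_sub, sub_eq_zero]
      exact LinearMap.congr_fun hS (Φ α)
    have h2 : Ψ (S (Φ α) - α) = 0 := hrel _ h1
    rwa [map_sub, sub_eq_zero] at h2
  have hEm (j : Fin N) : E₀ (m j) = ψ j := by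
    classical
    have h := hE (Pi.single j 1)
    simpa [Φ, Ψ, Fintype.linearCombination_apply_single] using h
  have hEsum (α : Fin N → k) : E₀ (∑ j, α j • m j) = ∑ j, α j • ψ j := hE α
  have hA (a : A) (v : V) : E₀ (a • v) = a • E₀ v := by
    have hv : v ∈ Submodule.span k (Set.range m) := hm ▸ trivial
    induction hv using Submodule.span_induction with
    | mem v hv =>
      obtain ⟨j, rfl⟩ := hv
      obtain ⟨α, h1, h2⟩ := hact a j
      rw [h1, hEsum, hEm, h2]
    | zero => simp
    | add v w _ _ hv hw => rw [smul_add, map_add, hv, hw, map_add, smul_add]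
    | smul c v _ hv => rw [smul_comm, map_smul, hv, map_smul, smul_comm]
  let E₁ : V →ₗ[A] Q := { E₀ with map_smul' := hA }
  have hsurj : Function.Surjective E₁ := by
    intro q
    have hq : q ∈ LinearMap.range Ψ := hΨ ▸ trivial
    obtain ⟨α, rfl⟩ := hq
    exact ⟨Φ α, hE α⟩
  have hinj : Function.Injective E₁ := by
    have h1 : Function.Surjective ((E₁ ∘ₗ e.symm.toLinearMap).restrictScalars k) :=
      hsurj.comp e.symm.surjective
    have h2 := LinearMap.injective_iff_surjective.2 h1
    intro v w hvw
    refine e.injective (h2 ?_)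
    change E₁ (e.symm (e v)) = E₁ (e.symm (e w))
    rw [e.symm_apply_apply, e.symm_apply_apply, hvw]
  exact ⟨LinearEquiv.ofBijective E₁ ⟨hinj, hsurj⟩, hEm⟩

variable {s : ℕ} {P : Fin s → Type v} [∀ i, AddCommGroup (P i)] [∀ i, Module A (P i)]
  [∀ i, Module k (P i)] [∀ i, IsScalarTower k A (P i)] {r : ℤ →₀ (Fin s → ℕ)}
  [∀ i, FiniteDimensional k (P i)] [IsAlgClosed k]

/-- Spanning means having a linear right inverse of the map of linear combinations; such pairs
satisfy polynomial equations, and the inverse is projected away. -/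
theorem isCons_forall_span_eq_top (N : ℤ → ℕ) :
    IsCons k {ψ : VectorSpace P r N | ∀ n, Submodule.span k (Set.range (ψ n)) = ⊤} := by
  let Λ : Type _ := ∀ n, ProjSum P (r n) →ₗ[k] (Fin (N n) → k)
  have hΛ : FiniteDimensional k Λ := finiteDimensional_pi_of_subsingleton r.support fun n hn => by
    have := subsingleton_projSum P r hn
    infer_instance
  have h : IsCons k {x : VectorSpace P r N × Λ | ∀ i : (Σ n, ProjSum P (r n)),
      ∑ j, x.2 i.1 i.2 j • x.1 i.1 j = i.2} := by
    refine IsCons.forall_eq (fun i => ?_) (fun i => IsPolyMap.const _)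
    refine IsPolyMap.sum _ fun j => IsPolyMap.smul ?_ ((IsPolyMap.fst.pi_apply _).pi_apply _)
    exact dual_mem_polyFun (LinearMap.proj j ∘ₗ LinearMap.applyₗ i.2 ∘ₗ LinearMap.proj i.1 ∘ₗ
      LinearMap.snd k (VectorSpace P r N) Λ)
  convert h.exists_snd using 1
  ext ψ
  constructor
  · intro hψ
    have h1 (n : ℤ) : LinearMap.range (Fintype.linearCombination k (ψ n)) = ⊤ :=
      (Fintype.range_linearCombination k (ψ n)).trans (hψ n)
    choose L hL using fun n => (Fintype.linearCombination k (ψ n)).exists_rightInverse_of_surjective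
      (h1 n)
    exact ⟨L, fun i => LinearMap.congr_fun (hL i.1) i.2⟩
  · rintro ⟨L, hL⟩ n
    refine eq_top_iff.2 fun v _ => ?_
    have h1 : ∑ j, L n v j • ψ n j = v := hL ⟨n, v⟩
    rw [← h1]
    exact Submodule.sum_mem _ fun j _ => Submodule.smul_mem _ _ (Submodule.subset_span ⟨j, rfl⟩)

end Presentations

/-! ### Fibres of a family as complexes in `HomSpace`; presentations of a family. -/

namespace Family

section Presentation

set_option linter.unusedSectionVars false

variable {k : Type u} [Field k] {X : Scheme.{u}} {f : X ⟶ Spec (.of k)} {A : Type v} [Ring A]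
  [Algebra k A] (F : Family f A) {s : ℕ} {P : Fin s → Type v} [∀ i, AddCommGroup (P i)]
  [∀ i, Module A (P i)] [∀ i, Module k (P i)] [∀ i, IsScalarTower k A (P i)]
  {r : ℤ →₀ (Fin s → ℕ)} {I : Ideal A}

variable {F} in
/-- A trivialization of the fibre `F_n(x)`. -/
def trivialization (hr : F.HasVectorRank P r) (x : closedPoints X) (n : ℤ) :
    (F.obj n).Fibre x.1 ≃ₗ[A] ProjSum P (r n) := (hr n x.1 x.2).some

variable {F} in
theorem fibreMap_mem (hF : F.IsIFamily I) (n : ℤ) (x : X) (v : (F.obj n).Fibre x) :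
    (F.d n).fibreMap x v ∈ (I • ⊤ : Submodule A ((F.obj (n - 1)).Fibre x)) := by
  obtain ⟨t, rfl⟩ := ((F.obj n).maximalSubmodule x).mkQ_surjective v
  exact map_mem_smul_top ((F.obj (n - 1)).maximalSubmodule x).mkQ (hF n x t)

theorem fibreMap_fibreMap (n : ℤ) (x : X) (v : (F.obj n).Fibre x) :
    (F.d (n - 1)).fibreMap x ((F.d n).fibreMap x v) = 0 := by
  obtain ⟨t, rfl⟩ := ((F.obj n).maximalSubmodule x).mkQ_surjective v
  obtain ⟨U, hx, m, rfl⟩ := (F.obj n).exists_germ_eq x t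
  change (F.d (n - 1)).fibreMap x ((F.d n).fibreMap x ((F.obj n).fibreGerm hx m)) = 0
  rw [ASheaf.Hom.fibreMap_fibreGerm, ASheaf.Hom.fibreMap_fibreGerm]
  have h : (F.d (n - 1)).hom.app U ((F.d n).hom.app U m) = 0 :=
    congrArg (fun φ : (F.obj n).sheaf ⟶ (F.obj (n - 1 - 1)).sheaf => φ.app U m) (F.d_comp_d n)
  rw [h, map_zero]

variable {F} in
/-- The complex of projective modules which the trivializations identify with the fibre at `x`. -/
def fibreClass (hF : F.IsIFamily I) (hr : F.HasVectorRank P r) (x : closedPoints X) :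
    HomSpace k P r I :=
  ⟨fun n => (trivialization hr x (n - 1)).toLinearMap ∘ₗ (F.d n).fibreMap x.1 ∘ₗ
      (trivialization hr x n).symm.toLinearMap,
    fun n _ => map_mem_smul_top (trivialization hr x (n - 1)).toLinearMap (fibreMap_mem hF n x.1 _)⟩

variable [∀ i, FiniteDimensional k (P i)] {F} (hF : F.IsIFamily I) (hr : F.HasVectorRank P r)

theorem fibreClass_trivialization (x : closedPoints X) (n : ℤ) (v : (F.obj n).Fibre x.1) :
    (fibreClass (k := k) hF hr x).1 n (trivialization hr x n v) =
      trivialization hr x (n - 1) ((F.d n).fibreMap x.1 v) := by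
  change trivialization hr x (n - 1) ((F.d n).fibreMap x.1 ((trivialization hr x n).symm _)) = _
  rw [LinearEquiv.symm_apply_apply]

theorem fibreClass_comp (x : closedPoints X) (n : ℤ) :
    (fibreClass (k := k) hF hr x).1 (n - 1) ∘ₗ (fibreClass (k := k) hF hr x).1 n = 0 := by
  refine LinearMap.ext fun q => ?_
  obtain ⟨v, rfl⟩ := (trivialization hr x n).surjective q
  rw [LinearMap.comp_apply, fibreClass_trivialization, fibreClass_trivialization,
    fibreMap_fibreMap, map_zero]
  rfl

/-- Conjugating by the chosen trivializations turns isomorphisms of complexes into group elements.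
The trivializations are chosen pointwise, and no regularity in `x` is needed. -/
theorem fibresIso_iff (x y : closedPoints X) : F.FibresIso y.1 x.1 ↔
    fibreClass (k := k) hF hr y ∈
      MulAction.orbit (AutGroup A P r) (fibreClass (k := k) hF hr x) := by
  constructor
  · rintro ⟨e, he⟩
    refine ⟨fun n => (trivialization hr x n).symm.trans
      ((e n).symm.trans (trivialization hr y n)), ?_⟩
    change _ • fibreClass (k := k) hF hr x = fibreClass (k := k) hF hr y
    rw [smul_eq_iff]
    intro n q
    obtain ⟨v, rfl⟩ := (trivialization hr x n).surjective q
    obtain ⟨w, rfl⟩ := (e n).surjective v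
    simp only [LinearEquiv.trans_apply, LinearEquiv.symm_apply_apply, fibreClass_trivialization,
      ← he]
  · rintro ⟨g, hg⟩
    change g • fibreClass (k := k) hF hr x = fibreClass (k := k) hF hr y at hg
    rw [smul_eq_iff] at hg
    refine ⟨fun n => (trivialization hr y n).trans
      ((g n).symm.trans (trivialization hr x n).symm), fun n t => ?_⟩
    obtain ⟨q, hq⟩ := (g n).surjective (trivialization hr y n t)
    obtain ⟨v, rfl⟩ := (trivialization hr x n).surjective q
    have h1 := hg n (trivialization hr x n v)
    rw [hq, fibreClass_trivialization, fibreClass_trivialization] at h1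
    simp only [LinearEquiv.trans_apply]
    rw [h1, ← hq]
    simp only [LinearEquiv.symm_apply_apply]

theorem isoLocus_eq (x : closedPoints X) :
    F.isoLocus x = orbitLocus (fibreClass (k := k) hF hr) x :=
  Set.ext fun y => fibresIso_iff hF hr x y

theorem stratum_eq : F.stratum = orbitStratum (fibreClass (k := k) hF hr) :=
  funext fun i => Set.ext fun x => by
    rw [stratum, orbitStratum, Set.mem_ofPred_eq, Set.mem_ofPred_eq, isoLocus_eq hF hr]

variable {U : X.Opens} (c : AffineCoordinates f U)

variable (F) in
/-- Generators of the modules of sections over `U` of a family of complexes, with polynomials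
describing the action of `A` and the differentials. -/
structure Presentation where
  gens : ℤ → ℕ
  sec (n : ℤ) : Fin (gens n) → Γ((F.obj n).sheaf, U)
  span_sec (n : ℤ) : Submodule.span Γ(X, U) (Set.range (sec n)) = ⊤
  act (n : ℤ) (a : A) (j : Fin (gens n)) : Fin (gens n) → MvPolynomial (Fin c.dim) k
  act_sec (n : ℤ) (a : A) (j : Fin (gens n)) :
    ∑ i, c.hom (act n a j i) • sec n i = ((F.obj n).act a).app U (sec n j)
  diff (n : ℤ) (j : Fin (gens n)) : Fin (gens (n - 1)) → MvPolynomial (Fin c.dim) k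
  diff_sec (n : ℤ) (j : Fin (gens n)) :
    ∑ i, c.hom (diff n j i) • sec (n - 1) i = (F.d n).hom.app U (sec n j)

variable (F) in
theorem nonempty_presentation [IsAlgClosed k] : Nonempty (F.Presentation c) := by
  have h (n : ℤ) : ∃ (N : ℕ) (m : Fin N → Γ((F.obj n).sheaf, U)),
      Submodule.span Γ(X, U) (Set.range m) = ⊤ := by
    have := (F.coherent n).2 U c.isAffineOpen
    exact Module.Finite.exists_fin
  choose N m hm using h
  choose C hC using fun n (a : A) j =>
    (F.obj n).exists_coefficients (c := c) (hm n) (((F.obj n).act a).app U (m n j))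
  choose D hD using fun n j =>
    (F.obj (n - 1)).exists_coefficients (c := c) (hm (n - 1)) ((F.d n).hom.app U (m n j))
  exact ⟨⟨N, m, hm, C, hC, D, hD⟩⟩

namespace Presentation

variable {c} (p : F.Presentation c)

/-- The relations between the chosen generators. -/
def Relation (n : ℤ) : Type u :=
  {q : Fin (p.gens n) → MvPolynomial (Fin c.dim) k // ∑ j, c.hom (q j) • p.sec n j = 0}

variable (P r I) in
/-- The triples of a point of the affine open set, of images of the generators under isomorphisms
of the fibres with the given projective modules, and of the differential transported along
these isomorphisms. -/
def total : Set ((Fin c.dim → k) × (VectorSpace P r p.gens × HomSpace k P r I)) :=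
  {x | x.1 ∈ c.zeros} ∩
  ({x | ∀ i : (Σ n, p.Relation n), ∑ j, MvPolynomial.eval x.1 (i.2.1 j) • x.2.1 i.1 j = 0} ∩
  ({x | ∀ i : (Σ n, A × Fin (p.gens n)), i.2.1 • x.2.1 i.1 i.2.2 =
    ∑ j, MvPolynomial.eval x.1 (p.act i.1 i.2.1 i.2.2 j) • x.2.1 i.1 j} ∩
  ({x | ∀ n, Submodule.span k (Set.range (x.2.1 n)) = ⊤} ∩
  {x | ∀ i : (Σ n, Fin (p.gens n)), x.2.2.1 i.1 (x.2.1 i.1 i.2) =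
    ∑ j, MvPolynomial.eval x.1 (p.diff i.1 i.2 j) • x.2.1 (i.1 - 1) j})))

variable [IsAlgClosed k]

theorem isCons_total : IsCons k (p.total P r I) := by
  have heval (q : MvPolynomial (Fin c.dim) k) :
      (fun x : (Fin c.dim → k) × (VectorSpace P r p.gens × HomSpace k P r I) =>
        MvPolynomial.eval x.1 q) ∈
      polyFun k ((Fin c.dim → k) × (VectorSpace P r p.gens × HomSpace k P r I)) :=
    polyFun_comp IsPolyMap.fst (eval_mem_polyFun q)
  have hψ (n : ℤ) (j : Fin (p.gens n)) : IsPolyMap k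
      (fun x : (Fin c.dim → k) × (VectorSpace P r p.gens × HomSpace k P r I) => x.2.1 n j) :=
    ((IsPolyMap.fst.comp IsPolyMap.snd).pi_apply n).pi_apply j
  have hh (n : ℤ) : IsPolyMap k
      (fun x : (Fin c.dim → k) × (VectorSpace P r p.gens × HomSpace k P r I) => x.2.2.1 n) :=
    (isPolyMap_val (k := k) n).comp (IsPolyMap.snd.comp IsPolyMap.snd)
  refine IsCons.inter _ _ (c.isCons_zeros.preimage IsPolyMap.fst)
    (IsCons.inter _ _ ?_ (IsCons.inter _ _ ?_ (IsCons.inter _ _ ?_ ?_)))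
  · exact IsCons.forall_eq (fun i => IsPolyMap.sum _ fun j => IsPolyMap.smul (heval _) (hψ _ _))
      (fun i => IsPolyMap.const _)
  · refine IsCons.forall_eq (fun i => ?_)
      (fun i => IsPolyMap.sum _ fun j => IsPolyMap.smul (heval _) (hψ _ _))
    let _ : SMulCommClass k A (ProjSum P (r i.1)) := inferInstance
    let E : ProjSum P (r i.1) →ₗ[k] ProjSum P (r i.1) :=
      { toFun := fun v => i.2.1 • v
        map_add' := fun _ _ => smul_add _ _ _
        map_smul' := fun _ _ => smul_comm _ _ _ }
    exact E.isPolyMap.comp (hψ _ _)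
  · exact (isCons_forall_span_eq_top p.gens).preimage (IsPolyMap.fst.comp IsPolyMap.snd)
  · exact IsCons.forall_eq (fun i => IsPolyMap.apply (hh _) (hψ _ _))
      (fun i => IsPolyMap.sum _ fun j => IsPolyMap.smul (heval _) (hψ _ _))

end Presentation

end Presentation

end Family

/-! ### Orbit charts from presentations. -/

namespace Family

section OrbitCharts

variable {k : Type u} [Field k] [IsAlgClosed k] {X : Scheme.{u}} {f : X ⟶ Spec (.of k)}
  {A : Type v} [Ring A] [Algebra k A] {F : Family f A} {s : ℕ} {P : Fin s → Type v}
  [∀ i, AddCommGroup (P i)] [∀ i, Module A (P i)] [∀ i, Module k (P i)]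
  [∀ i, IsScalarTower k A (P i)] {r : ℤ →₀ (Fin s → ℕ)} {I : Ideal A}
  (hF : F.IsIFamily I) (hr : F.HasVectorRank P r)
  {U : X.Opens} {c : AffineCoordinates f U} (p : F.Presentation c)

namespace Presentation

/-- The images of the generators under the chosen trivializations of the fibre at `x`. -/
def frame {x : closedPoints X} (hx : x.1 ∈ U) : VectorSpace P r p.gens :=
  fun n j => trivialization hr x n ((F.obj n).fibreGerm hx (p.sec n j))

theorem span_sec_fibre {x : closedPoints X} (hx : x.1 ∈ U) (n : ℤ) :
    Submodule.span k (Set.range fun j => (F.obj n).fibreGerm hx (p.sec n j)) = ⊤ :=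
  (F.obj n).span_fibreGerm hx (F.coherent n) (p.span_sec n) c

theorem smul_sec_fibre {x : closedPoints X} (hx : x.1 ∈ U) (n : ℤ) (a : A) (j : Fin (p.gens n)) :
    a • (F.obj n).fibreGerm hx (p.sec n j) =
      ∑ i, MvPolynomial.eval (c.point x) (p.act n a j i) • (F.obj n).fibreGerm hx (p.sec n i) := by
  rw [ASheaf.smul_fibreGerm, ← p.act_sec, ASheaf.fibreGerm_sum_smul]

theorem fibreMap_sec {x : closedPoints X} (hx : x.1 ∈ U) (n : ℤ) (j : Fin (p.gens n)) :
    (F.d n).fibreMap x.1 ((F.obj n).fibreGerm hx (p.sec n j)) =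
      ∑ i, MvPolynomial.eval (c.point x) (p.diff n j i) •
        (F.obj (n - 1)).fibreGerm hx (p.sec (n - 1) i) := by
  rw [ASheaf.Hom.fibreMap_fibreGerm, ← p.diff_sec, ASheaf.fibreGerm_sum_smul]

theorem relation_fibre {x : closedPoints X} (hx : x.1 ∈ U) (n : ℤ) (q : p.Relation n) :
    ∑ j, MvPolynomial.eval (c.point x) (q.1 j) • (F.obj n).fibreGerm hx (p.sec n j) = 0 := by
  rw [← ASheaf.fibreGerm_sum_smul, q.2, map_zero]

theorem span_frame {x : closedPoints X} (hx : x.1 ∈ U) (n : ℤ) :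
    Submodule.span A (Set.range (p.frame hr hx n)) = ⊤ := by
  have h := span_map_eq_top (trivialization hr x n) (p.span_sec_fibre hx n)
  refine eq_top_iff.2 fun v _ => ?_
  exact Submodule.span_subset_span k A _ (h.ge (Submodule.mem_top (x := v)))

variable [∀ i, FiniteDimensional k (P i)]

theorem mem_total_of_mem_torsor {x : closedPoints X} (hx : x.1 ∈ U)
    {y : VectorSpace P r p.gens × HomSpace k P r I}
    (hy : y ∈ torsor I (p.frame hr hx) (fibreClass hF hr x)) :
    (c.point x, y) ∈ p.total P r I := by
  obtain ⟨g, h1, h2⟩ := hy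
  obtain ⟨ψ, h⟩ := y
  have h2 := (smul_eq_iff (k := k) g _ _).1 h2.symm
  let E (n : ℤ) : (F.obj n).Fibre x.1 ≃ₗ[A] ProjSum P (r n) := (trivialization hr x n).trans (g n)
  have hψ : ψ = fun n j => E n ((F.obj n).fibreGerm hx (p.sec n j)) :=
    funext fun n => funext fun j => h1 n j
  have hE (n : ℤ) (v : (F.obj n).Fibre x.1) : h.1 n (E n v) = E (n - 1) ((F.d n).fibreMap x.1 v) := by
    refine (h2 n (trivialization hr x n v)).trans ?_
    rw [fibreClass_trivialization]
    rfl
  subst hψ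
  refine ⟨c.point_mem_zeros hx, fun ⟨n, q⟩ => ?_, fun ⟨n, a, j⟩ => ?_, fun n => ?_, fun ⟨n, j⟩ => ?_⟩
  · have h3 := congrArg (E n).toLinearMap (p.relation_fibre hx n q)
    rw [map_sum_smul_of_tower, map_zero] at h3
    exact h3
  · have h3 := congrArg (E n).toLinearMap (p.smul_sec_fibre hx n a j)
    rw [map_sum_smul_of_tower, map_smul] at h3
    exact h3
  · exact span_map_eq_top (E n) (p.span_sec_fibre hx n)
  · have h3 := congrArg (E (n - 1)).toLinearMap (p.fibreMap_sec hx n j)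
    rw [map_sum_smul_of_tower] at h3
    exact (hE n _).trans h3

/-- The equations defining `total` at `x` hold for the relations over `U`; by `exists_relation` they
hold for all relations in the fibre, so `ψ` comes from isomorphisms of the fibres. Compatibility of
`h` with the differential is checked on generators and extended linearly. -/
theorem mem_torsor_of_mem_total {x : closedPoints X} (hx : x.1 ∈ U)
    {y : VectorSpace P r p.gens × HomSpace k P r I} (hy : (c.point x, y) ∈ p.total P r I) :
    y ∈ torsor I (p.frame hr hx) (fibreClass hF hr x) := by
  obtain ⟨ψ, h⟩ := y
  obtain ⟨-, hrel, hact, hspan, hdiff⟩ := hy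
  have hE (n : ℤ) : ∃ E : (F.obj n).Fibre x.1 ≃ₗ[A] ProjSum P (r n),
      ∀ j, E ((F.obj n).fibreGerm hx (p.sec n j)) = ψ n j := by
    refine exists_linearEquiv_of_relations (trivialization hr x n) (p.span_sec_fibre hx n)
      (hspan n) (fun α hα => ?_) (fun a j => ⟨_, p.smul_sec_fibre hx n a j, hact ⟨n, a, j⟩⟩)
    obtain ⟨q, e, hq, he, h1⟩ := (F.obj n).exists_relation hx (F.coherent n) (p.span_sec n) c hα
    have h2 : ∑ j, MvPolynomial.eval (c.point x) (q j) • ψ n j = 0 := hrel ⟨n, ⟨q, hq⟩⟩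
    simp only [h1, mul_smul, ← Finset.smul_sum] at h2
    exact (smul_eq_zero.1 h2).resolve_left he
  choose E hE using hE
  refine ⟨fun n => (trivialization hr x n).symm.trans (E n), fun n j => ?_, ?_⟩
  · rw [frame, LinearEquiv.trans_apply, LinearEquiv.symm_apply_apply, hE]
  · refine ((smul_eq_iff (k := k) _ _ _).2 fun n q => ?_).symm
    obtain ⟨v, rfl⟩ := (trivialization hr x n).surjective q
    rw [fibreClass_trivialization, LinearEquiv.trans_apply, LinearEquiv.trans_apply,
      LinearEquiv.symm_apply_apply, LinearEquiv.symm_apply_apply]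
    have hv : v ∈ Submodule.span k
        (Set.range fun j => (F.obj n).fibreGerm hx (p.sec n j)) := by
      rw [p.span_sec_fibre]
      trivial
    induction hv using Submodule.span_induction with
    | mem v hv =>
      obtain ⟨j, rfl⟩ := hv
      have h3 := congrArg (E (n - 1)).toLinearMap (p.fibreMap_sec hx n j)
      rw [map_sum_smul_of_tower] at h3
      simp only [LinearEquiv.coe_coe, hE] at h3
      rw [h3, hE]
      exact hdiff ⟨n, j⟩
    | zero => simp only [map_zero]
    | add v w _ _ hv hw => simp only [map_add, hv, hw]
    | smul b v _ hv =>
      have h1 : E n (b • v) = b • E n v := (E n).toLinearMap.map_smul_of_tower b v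
      have h2 : (F.d n).fibreMap x.1 (b • v) = b • (F.d n).fibreMap x.1 v :=
        ((F.d n).fibreMap x.1).map_smul_of_tower b v
      have h3 (w) : E (n - 1) (b • w) = b • E (n - 1) w :=
        (E (n - 1)).toLinearMap.map_smul_of_tower b w
      rw [h1, h2, h3, (h.1 n).map_smul_of_tower b (E n v), hv]

variable [LocallyOfFiniteType f]

/-- The chart given by a presentation of the family over an affine open set. -/
def orbitChart : OrbitChart (fibreClass (k := k) hF hr) {x : closedPoints X | x.1 ∈ U} where
  dim := c.dim
  chart := c.point
  isChart := c.isChart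
  gens := p.gens
  total := p.total P r I
  isCons := p.isCons_total
  fibre _ hx := ⟨p.frame hr hx, p.span_frame hr hx, Set.ext fun _ =>
    ⟨p.mem_torsor_of_mem_total hF hr hx, p.mem_total_of_mem_torsor hF hr hx⟩⟩
  mem_image _ _ h := c.exists_point_eq h.1

end Presentation

theorem nonempty_orbitChart [∀ i, FiniteDimensional k (P i)] [LocallyOfFiniteType f]
    (hU : IsAffineOpen U) :
    Nonempty (OrbitChart (fibreClass (k := k) hF hr) {x : closedPoints X | x.1 ∈ U}) := by
  obtain ⟨c⟩ := nonempty_affineCoordinates f hU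
  obtain ⟨p⟩ := F.nonempty_presentation c
  exact ⟨p.orbitChart hF hr⟩

end OrbitCharts

end Family

/-! ### Finite affine covers and the main theorem. -/

theorem exists_finite_affine_cover (X : Scheme.{u}) [CompactSpace X] :
    ∃ (N : ℕ) (U : Fin N → X.Opens), (∀ j, IsAffineOpen (U j)) ∧ ∀ x : X, ∃ j, x ∈ U j := by
  let U (i : X.affineCover.finiteSubcover.I₀) : X.Opens :=
    (X.affineCover.finiteSubcover.f i).opensRange
  let e := Finite.equivFin X.affineCover.finiteSubcover.I₀
  refine ⟨_, fun j => U (e.symm j), fun j => isAffineOpen_opensRange _, fun x => ?_⟩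
  refine ⟨e (X.affineCover.finiteSubcover.idx x), ?_⟩
  change x ∈ U (e.symm (e _))
  rw [e.symm_apply_apply]
  exact X.affineCover.finiteSubcover.covers x

end AComplex

end

theorem mainTheorem10 {k : Type u} [Field k] [IsAlgClosed k]
    {A : Type v} [Ring A] [Algebra k A] [FiniteDimensional k A]
    {s : ℕ} (P : Fin s → Type v) [∀ i, AddCommGroup (P i)] [∀ i, Module A (P i)]
    [∀ i, Module k (P i)] [∀ i, IsScalarTower k A (P i)]
    (hP : AComplex.IsCompleteIndecProj A P)
    (I : Ideal A) [I.IsTwoSided] (hI : I ≤ Ring.jacobson A)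
    {X : Scheme.{u}} (f : X ⟶ Spec (.of k)) [IsSeparated f] [LocallyOfFiniteType f]
    [QuasiCompact f] [IsReduced X] [ConnectedSpace X]
    (F : AComplex.Family f A) (hF : F.IsIFamily I)
    (r : ℤ →₀ (Fin s → ℕ)) (hr : F.HasVectorRank P r) :
    (∀ x : closedPoints X, AComplex.IsConstructibleSet (F.isoLocus x)) ∧
    (∀ i : ℕ, AComplex.IsConstructibleSet (F.stratum i)) ∧
    IsGreatest (AComplex.excesses F.stratum) F.par ∧
    ((AComplex.canonicalBase k P r I).Nonempty →
      IsGreatest (AComplex.excesses (AComplex.canonicalStratum k P r I))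
        (AComplex.canonicalPar k P r I) ∧
      F.par ≤ AComplex.canonicalPar k P r I) := by
  have hk := hP.finite
  have hfin (i : Fin s) : FiniteDimensional k (P i) := Module.Finite.trans A (P i)
  have hcomp : CompactSpace X := QuasiCompact.compactSpace_of_compactSpace f
  have hJ : JacobsonSpace X := LocallyOfFiniteType.jacobsonSpace f
  have hne : Nonempty (closedPoints X) := by
    obtain ⟨x, -, hx⟩ := nonempty_inter_closedPoints (Set.univ_nonempty (α := X))
      isOpen_univ.isLocallyClosed
    exact ⟨⟨x, hx⟩⟩
  obtain ⟨N, U, hU, hcov⟩ := AComplex.exists_finite_affine_cover X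
  have hO (x : closedPoints X) : ∃ j, x ∈ {x : closedPoints X | x.1 ∈ U j} := hcov x.1
  let C (j : Fin N) := (AComplex.Family.nonempty_orbitChart hF hr (hU j)).some
  have hlocus := AComplex.Family.isoLocus_eq (k := k) hF hr
  have hstratum := AComplex.Family.stratum_eq (k := k) hF hr
  have hmax : IsGreatest (AComplex.excesses F.stratum) F.par := by
    rw [AComplex.Family.par, hstratum]
    exact AComplex.isGreatest_excesses_orbitStratum hO C
  refine ⟨fun x => ?_, fun i => ?_, hmax, fun hD => ⟨?_, ?_⟩⟩
  · rw [hlocus]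
    exact AComplex.isConstructibleSet_orbitLocus hO C x
  · rw [hstratum]
    exact AComplex.isConstructibleSet_of_charts hO C
      fun j => AComplex.isCons_image_orbitStratum hO C i j
  · exact AComplex.isGreatest_excesses_canonicalStratum hD
  -- The maximum is attained, so one stratum has to be compared with the canonical family.
  · obtain ⟨i, d, hd, hpar⟩ := hmax.1
    rw [hpar]
    rw [hstratum] at hd
    exact AComplex.sub_le_canonicalPar hO C (AComplex.Family.fibreClass_comp hF hr) hD hd.ge
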